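/- **Setting.** Atoms $p(t_1,\dots,t_k)$ are built from predicates, constants and variables; $\top$ is a distinguished unary predicate. The domain $\mathbb D_S$ of a structure (set of atoms) $S$ is the set of terms occurring in it, and $S^\top=S\cup\{\top(t):t\in\mathbb D_S\}$. A finite structure is connected if it is a single atom or can be partitioned into two nonempty connected structures whose domains share a term. A knowledge base $K=(D,O)$ consists of a finite nonempty set $D$ of atoms over constants (a dataset) and a theory $O$ (a string). Fix a notion of model, i.e. a map assigning to each $K$ a set of structures over constants; $\mathit{ent}(K)$ is the set of atoms belonging to all models of $K$. A summary selector $\varsigma$ maps $K$ and a nonempty tuple $\tau$ of constants of $\mathbb D_{\mathit{ent}(K)}$ to a dataset $\varsigma(K,\tau)=\varsigma(\tau)\subseteq \mathit{ent}(K)^\top$ that is closed under $S\mapsto S^\top$ and has all constants of $\tau$ in its domain. A unit $\mathbf U=\{\tau_1,\dots,\tau_m\}$ is a finite nonempty set of $n$-ary tuples ($n>0$) over $\mathbb D_{\mathit{ent}(K)}$. Put $\mathcal S=(K,\varsigma)$. **Canonical characterization.** Let $P=\varsigma(\tau_1)\otimes\dots\otimes\varsigma(\tau_m)$ be the set of all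 atoms $p(d_{\mathbf s_1},\dots,d_{\mathbf s_k})$, where $\mathbf s_j=(c^1_j,\dots,c^m_j)$ and $p(c^i_1,\dots,c^i_k)\in\varsigma(\tau_i)$ for every $i$. Let $\mathbf s^*_j=(\tau_1[j],\dots,\tau_m[j])$ for $j=1,\dots,n$, and let $\mathit{Fr}=\{\mathbf s^*_1,\dots,\mathbf s^*_n\}$. Let $\Phi$ be the set of all atoms obtained from atoms of $P$ by replacing each occurrence of each $d_{\mathbf s}$ as follows: by the variable $x_{\mathbf s}$ if $\mathbf s$ is not of the form $(c,\dots,c)$; by the constant $c$ if $\mathbf s=(c,\dots,c)\notin\mathit{Fr}$; and by either of $x_{\mathbf s}$ and $c$ (independently for each occurrence) if $\mathbf s=(c,\dots,c)\in \mathit{Fr}$. Then $\mathit{can}(\mathbf U,\mathcal S)$ is the formula with free variables $x_{\mathbf s^*_1},\dots,x_{\mathbf s^*_n}$ whose atoms are those atoms of $\Phi$ that lie in a connected structure $S\subseteq\Phi$ in which some free variable occurs. Its size $|\mathit{can}(\mathbf U,\mathcal S)|$ is its number of atoms. **The problem and the cases.** For a fixed notion of model and a fixed $\varsigma$, and a class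 $\mathcal I$ of instances $(K,\mathbf U)$, the task CAN is to compute $\mathit{can}(\mathbf U,\mathcal S)$, with each atom written once, in some order, from $(K,\mathbf U)$ (finite sets being given by duplicate-free lists, numbers in binary). CAN is in a class of functions if some function of that class, from bit strings to bit strings, is correct on all instances of $\mathcal I$. * *Broad*: the arity of the predicates of $K$ (those of $D$ and of $\mathit{ent}(K)$) is bounded on $\mathcal I$ by a constant, and $\mathit{ent}(K)$ and $\varsigma(K,\tau)$ are polynomial-time computable for the knowledge bases of $\mathcal I$. * *Medium*: in addition, $m=|\mathbf U|$ is bounded on $\mathcal I$ by a constant. * *Handy*: in addition, $|\mathbb D_{\varsigma(K,\tau)}|\in O\big(\sqrt[m+1]{\log_2|\mathbb D_{\mathit{ent}(K)}|}\big)$ for $\tau\in\mathbf U$, $(K,\mathbf U)\in\mathcal I$. $F\mathsf P$ is the class of functions computable in polynomial time, $F\mathsf P^{\mathsf{PH}}$ the class of those computable in polynomial time with an oracle in the polynomial hierarchy, and $F\mathsf{PSPACE}$ the class of those computable by a deterministic Turing machine with a one-way, write-only output tape (of unrestricted length) and a constant number of other tapes of polynomial length. **Theorem.** 1. CAN is in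 $F\mathsf{PSPACE}$ in the broad case, and in $F\mathsf P$ in the medium and in the handy case, for every notion of model, every $\varsigma$ and every $\mathcal I$. 2. If the predicates of $K$ have arity at most $\omega$, then $\mathit{can}(\mathbf U,\mathcal S)$ is finite and $|\mathit{can}(\mathbf U,\mathcal S)|\le 2^{\omega}\cdot\prod_{i=1}^m|\varsigma(\tau_i)|$. 3. CAN is not in $F\mathsf P^{\mathsf{PH}}$ in the broad case. In fact let $p_i$ be the $i$-th prime number, and let $\Gamma_i=\{r(c^i_1,c^i_2),\dots,r(c^i_{p_i-1},c^i_{p_i}),r(c^i_{p_i},c^i_1)\}\cup\{\top(c^i_j):1\le j\le p_i\}$ be a directed cycle of length $p_i$. With a suitable choice of the pairwise distinct constants $c^i_j$ and of a summary selector $\varsigma$, for the semantics in which the models of $(D,O)$ are the structures containing $D$, the instances $K_m=(\Gamma_1\cup\dots\cup\Gamma_m,\emptyset)$, $\mathbf U_m=\{\langle c_1^1\rangle,\dots,\langle c_1^m\rangle\}$, $m\ge2$, fall under the broad case; $\varsigma(K_m,\langle c^i_1\rangle)=\Gamma_i$ and $|\Gamma_i|>2$ for $i\le m$; $$|\mathit{can}(\mathbf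 U_m,\mathcal S_m)|=2^{1-m}\prod_{i=1}^m|\Gamma_i|\ \ge\ 2^m,\qquad \mathcal S_m=(K_m,\varsigma);$$ and no function in $F\mathsf P^{\mathsf{PH}}$ solves CAN on these instances. -/

import Mathlib

open Turing StateTransition

namespace Nexus

/-! ### Terms, atoms, structures -/

/-- An atom `p(t₁,…,tₙ)` over terms of type `T`. A predicate is a pair (name, arity); its arity is
the number of arguments, so every arity has infinitely many predicates. -/
@[ext] structure Atom (T : Type) where
  name : ℕ
  args : List T
deriving DecidableEq

/-- The arity of the predicate of an atom. -/
def Atom.arity {T : Type} (a : Atom T) : ℕ := a.args.length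

/-- The atom `⊤(t)` of the distinguished unary predicate `⊤`. -/
def topAtom {T : Type} (t : T) : Atom T := ⟨0, [t]⟩

/-- The domain `𝔻_S` of a structure: the terms that occur in its atoms. -/
def dom {T : Type} (S : Set (Atom T)) : Set T := {t | ∃ a ∈ S, t ∈ a.args}

/-- The closure `S^⊤ = S ∪ {⊤(t) | t ∈ 𝔻_S}`. -/
def topClosure {T : Type} (S : Set (Atom T)) : Set (Atom T) := S ∪ {a | ∃ t ∈ dom S, a = topAtom t}

/-- A structure is connected if it consists of a single atom, or can be partitioned into two
(nonempty) connected structures whose domains share a term. -/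
inductive Connected {T : Type} : Set (Atom T) → Prop
  | single (a : Atom T) : Connected {a}
  | union {S S' : Set (Atom T)} : Connected S → Connected S' → Disjoint S S' →
      (dom S ∩ dom S').Nonempty → Connected (S ∪ S')

/-- Constants are natural numbers. The variables are `x_s`, one for every finite sequence `s` of
constants. -/
inductive Term where
  | const (c : ℕ)
  | var (s : List ℕ)
deriving DecidableEq

/-! ### Knowledge bases, summary selectors, units -/

/-- A knowledge base `(D, O)`: a finite nonempty structure over constants, and an ontological
theory, given by the string of its text. -/
structure KB where
  D : Finset (Atom ℕ)
  nonempty : D.Nonempty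
  O : List Bool

/-- A notion of model: it assigns to each knowledge base its models, which are structures (possibly
infinite) over constants. -/
abbrev Semantics := KB → Set (Set (Atom ℕ))

/-- `ent(K)`: the atoms that belong to every model of `K`. -/
def ent (models : Semantics) (K : KB) : Set (Atom ℕ) := {a | ∀ M ∈ models K, a ∈ M}

/-- The semantics of plain databases: the models are the structures that contain the dataset. -/
def databaseSemantics : Semantics := fun K => {M | (K.D : Set (Atom ℕ)) ⊆ M}

/-- A tuple (of positive arity) over the constants of `ent(K)`. -/
def IsTupleOver (models : Semantics) (K : KB) (τ : List ℕ) : Prop :=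
  τ ≠ [] ∧ ∀ c ∈ τ, c ∈ dom (ent models K)

/-- A summary selector: `ς(K,τ)` is a dataset of atoms of `ent(K)^⊤`, is closed under `⊤`, and has
the constants of `τ` in its domain. (Its computability is part of the cases below.) -/
structure Selector (models : Semantics) where
  sel : KB → List ℕ → Finset (Atom ℕ)
  subset : ∀ K τ, IsTupleOver models K τ → (sel K τ : Set (Atom ℕ)) ⊆ topClosure (ent models K)
  closed : ∀ K τ, IsTupleOver models K τ →
    topClosure (sel K τ : Set (Atom ℕ)) = (sel K τ : Set (Atom ℕ))
  contains : ∀ K τ, IsTupleOver models K τ → ∀ c ∈ τ, c ∈ dom (sel K τ : Set (Atom ℕ))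

/-- A unit: a finite nonempty set of tuples of the same arity `n > 0`. -/
def UnitOver (models : Semantics) (K : KB) (U : Finset (List ℕ)) : Prop :=
  U.Nonempty ∧ (∃ n, 0 < n ∧ ∀ τ ∈ U, τ.length = n) ∧ ∀ τ ∈ U, IsTupleOver models K τ

/-- The predicates of `K` (of its dataset and of its entailed atoms) have arity at most `ω`. -/
def ArityLE (models : Semantics) (K : KB) (ω : ℕ) : Prop :=
  ∀ a : Atom ℕ, a ∈ K.D ∨ a ∈ ent models K → a.arity ≤ ω

/-! ### The canonical characterization

The constant `d_s` of a direct product is represented by the sequence `s` itself. -/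

/-- The direct product `τ₁ ⊗ … ⊗ τₘ` of tuples of the same arity. -/
def tupleProd (us : List (List ℕ)) : List (List ℕ) :=
  (List.range (us.headD []).length).map fun j => us.map fun τ => τ.getD j 0

/-- The `i`-th projection of an atom over sequences of constants. -/
def proj (i : ℕ) (a : Atom (List ℕ)) : Atom ℕ := ⟨a.name, a.args.map fun s => s.getD i 0⟩

/-- The direct product `D₁ ⊗ … ⊗ Dₘ` of datasets: the atoms `p(d_{s₁},…,d_{sₖ})`, the sequences `sⱼ`
having length `m`, all of whose projections are in the factors. -/
def prod (Ds : List (Finset (Atom ℕ))) : Set (Atom (List ℕ)) :=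
  {a | (∀ s ∈ a.args, s.length = Ds.length) ∧ ∀ (i : ℕ) (h : i < Ds.length), proj i a ∈ Ds[i]}

/-- `s` is a nonempty constant sequence `(c,…,c)`. -/
def IsConstSeq (c : ℕ) (s : List ℕ) : Prop := s ≠ [] ∧ ∀ b ∈ s, b = c

/-- The terms by which an occurrence of `d_s` can be replaced, where `Fr` lists the free sequences:
the variable `x_s`, if `s` is free or not constant; the constant `c`, if `s = (c,…,c)`. An
occurrence with both roles is what gives rise to clones. -/
inductive Replace (Fr : List (List ℕ)) : List ℕ → Term → Prop
  | var (s : List ℕ) : (s ∈ Fr ∨ ¬ ∃ c, IsConstSeq c s) → Replace Fr s (.var s)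
  | const (s : List ℕ) (c : ℕ) : IsConstSeq c s → Replace Fr s (.const c)

/-- The atoms obtained from the direct product `ς(τ₁) ⊗ … ⊗ ς(τₘ)`, clones included. -/
def allAtoms (sel : List ℕ → Finset (Atom ℕ)) (us : List (List ℕ)) : Set (Atom Term) :=
  {β | ∃ α ∈ prod (us.map sel), β.name = α.name ∧
    List.Forall₂ (Replace (tupleProd us)) α.args β.args}

/-- `atm(can(U,S))` for `U = {τ₁,…,τₘ}` listed as `us`, where `sel τ` is the summary of `τ`: the
atoms above that are connected, within these atoms, to a free variable. The free variables of
`can(U,S)` are `x_{s₁},…,x_{sₙ}` with `s₁,…,sₙ` the sequences in `tupleProd us`. -/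
def canAtoms (sel : List ℕ → Finset (Atom ℕ)) (us : List (List ℕ)) : Set (Atom Term) :=
  {β | β ∈ allAtoms sel us ∧ ∃ s ∈ tupleProd us, ∃ S : Set (Atom Term),
    Connected S ∧ S ⊆ allAtoms sel us ∧ β ∈ S ∧ Term.var s ∈ dom S}

/-! ### Encodings by strings of bits (all of them self-delimiting) -/

/-- `l` lists the elements of the set `S`, each one once. -/
def Lists {α : Type} (l : List α) (S : Set α) : Prop := l.Nodup ∧ ∀ a, a ∈ l ↔ a ∈ S

def encList {α : Type} (e : α → List Bool) (l : List α) : List Bool :=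
  (l.flatMap fun a => true :: e a) ++ [false]

def encStr : List Bool → List Bool := encList fun b => [b]

/-- Numbers are written in binary. -/
def encNat (n : ℕ) : List Bool := encStr n.bits

def encTuple : List ℕ → List Bool := encList encNat

def encTerm : Term → List Bool
  | .const c => false :: encNat c
  | .var s => true :: encTuple s

def encAtoms {T : Type} (e : T → List Bool) : List (Atom T) → List Bool :=
  encList fun a => encNat a.name ++ encList e a.args

/-- The code of a knowledge base whose dataset is listed as `l`. -/
def encKB (l : List (Atom ℕ)) (O : List Bool) : List Bool := encAtoms encNat l ++ encStr O

/-- The code of the formula with the free variables `x_s`, `s` in `head`, and the list `body` of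
atoms. -/
def encFormula (head : List (List ℕ)) (body : List (Atom Term)) : List Bool :=
  encList encTuple head ++ encAtoms encTerm body

/-! ### Complexity classes of functions on strings

Turing machines are Mathlib's `Turing.FinTM2`, where each tape is a stack. -/

/-- `FP`: the functions computable in polynomial time. -/
def FP (f : List Bool → List Bool) : Prop :=
  Nonempty (TM2ComputableInPolyTime (id : List Bool → List Bool) (id : List Bool → List Bool) f)

/-- The statement never reads the stack `k₁`. -/
def WriteOnly {K : Type} {Γ : K → Type} {Λ σ : Type} (k₁ : K) : TM2.Stmt Γ Λ σ → Prop
  | .push _ _ q => WriteOnly k₁ q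
  | .peek k _ q => k ≠ k₁ ∧ WriteOnly k₁ q
  | .pop k _ q => k ≠ k₁ ∧ WriteOnly k₁ q
  | .load _ q => WriteOnly k₁ q
  | .branch _ q₁ q₂ => WriteOnly k₁ q₁ ∧ WriteOnly k₁ q₂
  | .goto _ => True
  | .halt => True

/-- `FPSPACE`: the functions computable by a machine with a one-way, write-only output tape `k₁`
all of whose other tapes have polynomial length throughout the computation. The first symbol
written is at the bottom of the stack `k₁`, whence the reversal. -/
def FPSPACE (f : List Bool → List Bool) : Prop :=
  ∃ (M : FinTM2) (e₀ : M.Γ M.k₀ ≃ Bool) (e₁ : M.Γ M.k₁ ≃ Bool) (p : Polynomial ℕ),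
    M.k₀ ≠ M.k₁ ∧ (∀ l, WriteOnly M.k₁ (M.m l)) ∧ ∀ x : List Bool,
      Nonempty (TM2Outputs M (x.map e₀.symm) (some ((f x).reverse.map e₁.symm))) ∧
      ∀ c, Reaches M.step (initList M (x.map e₀.symm)) c →
        ∀ k, k ≠ M.k₁ → (c.stk k).length ≤ p.eval x.length

/-- A machine with a query tape `kq` and three special labels. -/
structure OracleTM extends FinTM2 where
  kq : K
  queryAlphabet : Γ kq ≃ Bool
  query : Λ
  yes : Λ
  no : Λ

open Classical in
/-- One step with oracle `A`: at the label `query` the word on the query tape is erased and the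
machine goes to `yes` or `no`, according to whether the word is in `A`. -/
noncomputable def OracleTM.oracleStep (M : OracleTM) (A : Set (List Bool))
    (c : M.toFinTM2.Cfg) : Option M.toFinTM2.Cfg :=
  if c.l = some M.query then
    some { l := some (if (c.stk M.kq).map M.queryAlphabet ∈ A then M.yes else M.no)
           var := c.var
           stk := Function.update c.stk M.kq [] }
  else M.toFinTM2.step c

/-- `FP^A`: the functions computable in polynomial time with oracle `A`. -/
def FPOracle (A : Set (List Bool)) (f : List Bool → List Bool) : Prop :=
  ∃ (M : OracleTM) (e₀ : M.Γ M.k₀ ≃ Bool) (e₁ : M.Γ M.k₁ ≃ Bool) (p : Polynomial ℕ),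
    ∀ x : List Bool,
      Nonempty (EvalsToInTime (M.oracleStep A) (initList M.toFinTM2 (x.map e₀.symm))
        (some (haltList M.toFinTM2 ((f x).map e₁.symm))) (p.eval x.length))

/-- The polynomial hierarchy: the closure of `P` under complement and polynomially bounded
existential quantification. -/
inductive PH : Set (List Bool) → Prop
  | ofP (f : List Bool → List Bool) : FP f → PH {x | f x = [true]}
  | compl {A : Set (List Bool)} : PH A → PH Aᶜ
  | exists_bounded {A : Set (List Bool)} (p : Polynomial ℕ) : PH A →
      PH {x | ∃ y : List Bool, y.length ≤ p.eval x.length ∧ encStr x ++ y ∈ A}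

/-- `FP^PH`. -/
def FPPH (f : List Bool → List Bool) : Prop := ∃ A, PH A ∧ FPOracle A f

/-! ### The problem CAN and the three cases

An instance consists of a knowledge base and a unit; the semantics and the summary selector are
parameters of the problem. -/

/-- `f` solves CAN on the instances in `I`: given `K` and `U`, listed in any way, it returns
`can(U,S)`, its atoms being written once each, in some order. -/
def SolvesCAN {models : Semantics} (ς : Selector models) (I : Set (KB × Finset (List ℕ)))
    (f : List Bool → List Bool) : Prop :=
  ∀ K U, (K, U) ∈ I → ∀ (l : List (Atom ℕ)) (us : List (List ℕ)), Lists l K.D → Lists us U →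
    ∃ body : List (Atom Term), Lists body (canAtoms (ς.sel K) us) ∧
      f (encKB l K.O ++ encList encTuple us) = encFormula (tupleProd us) body

/-- `ent(K)` is polynomial-time computable from `K`, for the knowledge bases in `Ks`. -/
def EntPolyTime (models : Semantics) (Ks : Set KB) : Prop :=
  ∃ f, FP f ∧ ∀ K ∈ Ks, ∀ l : List (Atom ℕ), Lists l K.D →
    ∃ l' : List (Atom ℕ), Lists l' (ent models K) ∧ f (encKB l K.O) = encAtoms encNat l'

/-- `ς(K,τ)` is polynomial-time computable from `K` and `τ`, for the knowledge bases in `Ks`. -/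
def SelPolyTime {models : Semantics} (ς : Selector models) (Ks : Set KB) : Prop :=
  ∃ f, FP f ∧ ∀ K ∈ Ks, ∀ τ, IsTupleOver models K τ → ∀ l : List (Atom ℕ), Lists l K.D →
    ∃ l' : List (Atom ℕ), Lists l' (ς.sel K τ) ∧
      f (encKB l K.O ++ encTuple τ) = encAtoms encNat l'

/-- The broad case: the arity of predicates is bounded on `I`, and `ent` and `ς` are
polynomial-time computable on the knowledge bases of `I`. -/
structure Broad {models : Semantics} (ς : Selector models) (I : Set (KB × Finset (List ℕ))) :
    Prop where
  unitOver : ∀ K U, (K, U) ∈ I → UnitOver models K U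
  arity : ∃ ω, ∀ K U, (K, U) ∈ I → ArityLE models K ω
  ent : EntPolyTime models (Prod.fst '' I)
  sel : SelPolyTime ς (Prod.fst '' I)

/-- The medium case: in addition, the number of tuples of the unit is bounded on `I`. -/
structure Medium {models : Semantics} (ς : Selector models) (I : Set (KB × Finset (List ℕ))) :
    Prop extends Broad ς I where
  card : ∃ b, ∀ K U, (K, U) ∈ I → U.card ≤ b

/-- The handy case: in addition, with `m = |U|`, the number of constants of a summary is
`O((log₂ |𝔻_{ent(K)}|)^{1/(m+1)})` on `I`. -/
structure Handy {models : Semantics} (ς : Selector models) (I : Set (KB × Finset (List ℕ))) :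
    Prop extends Medium ς I where
  small : ∃ (C : ℝ) (N : ℕ), ∀ K U, (K, U) ∈ I → N ≤ (dom (Nexus.ent models K)).ncard →
    ∀ τ ∈ U, ((dom (ς.sel K τ : Set (Atom ℕ))).ncard : ℝ) ≤
      C * Real.logb 2 ((dom (Nexus.ent models K)).ncard) ^ (1 / ((U.card : ℝ) + 1))

/-! ### The family of directed cycles of prime lengths

Here `c i j`, for `j` less than the `i`-th prime number, is the `j`-th constant of the `i`-th
cycle; cycles, constants and primes are counted from `0`. -/

/-- The `i`-th cycle: the atoms `r(c_j, c_{j+1})`, the index being cyclic, and `⊤(c_j)`. -/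
noncomputable def cycle (c : ℕ → ℕ → ℕ) (i : ℕ) : Finset (Atom ℕ) :=
  ((Finset.range (Nat.nth Nat.Prime i)).image fun j =>
    ⟨1, [c i j, c i ((j + 1) % Nat.nth Nat.Prime i)]⟩) ∪
  ((Finset.range (Nat.nth Nat.Prime i)).image fun j => topAtom (c i j))

theorem cycles_nonempty (c : ℕ → ℕ → ℕ) (m : ℕ) (hm : 2 ≤ m) :
    ((Finset.range m).biUnion (cycle c)).Nonempty := by
  refine ⟨topAtom (c 0 0), Finset.mem_biUnion.2 ⟨0, Finset.mem_range.2 (by omega), ?_⟩⟩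
  refine Finset.mem_union_right _ (Finset.mem_image.2 ⟨0, ?_, rfl⟩)
  exact Finset.mem_range.2 (Nat.prime_nth_prime 0).pos

/-- The union of the first `m` cycles, with the empty theory. -/
noncomputable def cycleKB (c : ℕ → ℕ → ℕ) (m : ℕ) (hm : 2 ≤ m) : KB where
  D := (Finset.range m).biUnion (cycle c)
  nonempty := cycles_nonempty c m hm
  O := []

/-- The unit that consists of one constant of each of the first `m` cycles. -/
def cycleUnit (c : ℕ → ℕ → ℕ) (m : ℕ) : Finset (List ℕ) := (Finset.range m).image fun i => [c i 0]

/-- The instances formed by the unions of at least two cycles. -/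
def cycleInstances (c : ℕ → ℕ → ℕ) : Set (KB × Finset (List ℕ)) :=
  {q | ∃ (m : ℕ) (hm : 2 ≤ m), q = (cycleKB c m hm, cycleUnit c m)}

end Nexus

open Nexus

/-! Upper bounds. The term in an argument position of an atom of the characterization determines the
sequence it replaces (`replace_iff`), so membership in the set of all atoms, clones included, is a
direct check of the projections against the summaries (`Inst.Spec.mem_allAtoms`, `Inst.test`). Being
connected to a free variable is reachability in the graph of atoms that share a term
(`mem_canAtoms_iff`). If the number of tuples and the arity are bounded, there are polynomially many
candidate atoms; they are listed, filtered, and saturated under links (`Medium.exists_fp`). The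
handy case contains this bound on the number of tuples, so it follows at once.

In the broad case there may be exponentially many atoms, but each has a code of polynomial length. A
counter runs through all bit vectors of that length. For each one, Savitch's recursive halving
decides in polynomial space whether it represents an atom with a path to a free variable, and if so
the code is written (`yields_search`, `FPSPACE.enumerate`, `Broad.exists_fpspace`). Padding is
fixed, so each atom is written once.

To make this an argument about actual machines, programs over five bit registers, which may call
given machines, are compiled to `TM2` (`code`, `Exec`). From these come composition, pairing,
branching and iteration for polynomial-time functions on serialized binary trees, and then a
calculus `PT` of functions between types encoded by trees. A separate construction turns a
polynomial-time transition function on polynomially bounded states into a machine with a write-only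
output, however long the run (`FPSPACE.of_yields`).

Size. An atom is determined by its projections to the summaries and by the set of positions that
hold variables (`projections_injOn`). There are at most `∏ |ς(τᵢ)|` families of projections and `2 ^
ω` sets of positions.

Lower bound. The constants `2 ^ i * (2 * j + 1)` reveal their cycle by their trailing zeros, so a
polynomial-time selector can isolate the cycle. By the Chinese remainder theorem the product of
directed cycles of pairwise coprime lengths is a single directed cycle whose length is the product
of the lengths (`allAtoms_cycles`), and all of it is linked to the free variable
(`canAtoms_cycles`). Thus the output has `2 * ∏ pᵢ ≥ m!` atoms, whereas the input has length at most
`2 ^ (9 * m)`. Since `m!` outgrows `(2 ^ (9 * d)) ^ m` for each `d`, the output is not polynomially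
long in the input. A polynomial-time machine cannot write it, whatever its oracle
(`FPOracle.polyBd`); nothing about the polynomial hierarchy is needed. -/

namespace Nexus

/-! ### Runs of a transition function -/

/-- `Run step B t a b`: `t` steps lead from `a` to `b`, and all states on the way satisfy `B`. -/
inductive Run {C : Type} (step : C → Option C) (B : C → Prop) : ℕ → C → C → Prop
  | refl {a : C} : B a → Run step B 0 a a
  | head {a b c : C} {t : ℕ} : B a → step a = some b → Run step B t b c → Run step B (t + 1) a c

namespace Run

variable {C : Type} {step : C → Option C} {B : C → Prop}

theorem trans {s t : ℕ} {a b c : C} (h : Run step B s a b) (h' : Run step B t b c) :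
    Run step B (s + t) a c := by
  induction h with
  | refl => simpa using h'
  | @head _ _ _ n hB hs _ ih =>
    rw [Nat.add_right_comm]
    exact .head hB hs (ih h')

theorem congr {t t' : ℕ} {a b b' : C} (h : Run step B t a b) (ht : t = t') (hb : b = b') :
    Run step B t' a b' := by
  subst ht hb
  exact h

theorem congr_left {t : ℕ} {a a' b : C} (h : Run step B t a b) (ha : a = a') :
    Run step B t a' b := by
  subst ha
  exact h

theorem mono {B' : C → Prop} (hB : ∀ c, B c → B' c) {t : ℕ} {a b : C} (h : Run step B t a b) :
    Run step B' t a b := by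
  induction h with
  | refl h => exact .refl (hB _ h)
  | head h hs _ ih => exact .head (hB _ h) hs ih

/-- This iterate is the form in which `EvalsTo` records a computation. -/
theorem iterate {t : ℕ} {a b : C} (h : Run step B t a b) :
    (flip bind step)^[t] (some a) = some b := by
  induction h with
  | refl => rfl
  | head _ hs _ ih => rw [Function.iterate_succ_apply]; simpa [flip, hs] using ih

theorem of_iterate {t : ℕ} {a b : C} (h : (flip bind step)^[t] (some a) = some b) :
    Run step (fun _ => True) t a b := by
  induction t generalizing a with
  | zero => cases h; exact .refl trivial
  | succ n ih =>
    rw [Function.iterate_succ_apply] at h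
    cases hs : step a with
    | none =>
      -- A computation that has stopped stays at `none`, so it cannot end in `some b`.
      have : ∀ k, (flip bind step)^[k] (none : Option C) = none := by
        intro k
        induction k with
        | zero => rfl
        | succ k ih => rw [Function.iterate_succ_apply]; exact ih
      simp only [flip, Option.bind_eq_bind, Option.bind_some, hs] at h
      have h2 := this n
      simp only [Option.bind_eq_bind] at h2
      rw [h2] at h
      cases h
    | some c =>
      refine .head trivial hs (ih ?_)
      simpa [flip, hs] using h

/-- Steps are deterministic and `b` is terminal, so every reachable state lies on the run. This
transfers a bound along one run to all reachable configurations, as `FPSPACE` demands. -/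
theorem invariant_of_reaches {t : ℕ} {a b c : C} (h : Run step B t a b) (hb : step b = none)
    (hc : Reaches step a c) : B c := by
  induction h with
  | refl h =>
    rcases Relation.ReflTransGen.cases_head hc with rfl | ⟨d, hd, _⟩
    · exact h
    · simp [hb] at hd
  | head h hs _ ih =>
    rcases Relation.ReflTransGen.cases_head hc with rfl | ⟨d, hd, hdc⟩
    · exact h
    · rw [hs] at hd
      cases hd
      exact ih hb hdc

end Run

/-! ### Stacks grow by a bounded amount in each step -/

section Growth

variable {K : Type} [DecidableEq K] {Γ : K → Type} {Λ σ : Type}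

/-- The number of pushes in a statement. -/
def pushes : TM2.Stmt Γ Λ σ → ℕ
  | .push _ _ q => pushes q + 1
  | .peek _ _ q => pushes q
  | .pop _ _ q => pushes q
  | .load _ q => pushes q
  | .branch _ q₁ q₂ => pushes q₁ + pushes q₂
  | .goto _ => 0
  | .halt => 0

/-- A statement contains no loops, so each of its pushes is executed at most once per step. -/
theorem length_stepAux_le (q : TM2.Stmt Γ Λ σ) (v : σ) (S : ∀ k, List (Γ k)) (k : K) :
    ((TM2.stepAux q v S).stk k).length ≤ (S k).length + pushes q := by
  induction q generalizing v S with
  | push k' f q ih =>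
    refine (ih _ _).trans ?_
    by_cases h : k = k'
    · subst h; simp [pushes]; omega
    · simp [pushes, h]; try omega
  | peek k' f q ih => exact ih _ _
  | pop k' f q ih =>
    refine (ih _ _).trans ?_
    by_cases h : k = k'
    · subst h; simp [pushes]
    · simp [pushes, h]
  | load f q ih => exact ih _ _
  | branch f q₁ q₂ ih₁ ih₂ =>
    simp only [TM2.stepAux, pushes]
    cases f v
    · exact (ih₂ _ _).trans (by omega)
    · exact (ih₁ _ _).trans (by omega)
  | goto f => simp [TM2.stepAux]
  | halt => simp [TM2.stepAux]

theorem length_step_le {m : Λ → TM2.Stmt Γ Λ σ} {C : ℕ} (hC : ∀ l, pushes (m l) ≤ C)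
    {c c' : TM2.Cfg Γ Λ σ} (h : TM2.step m c = some c') (k : K) :
    (c'.stk k).length ≤ (c.stk k).length + C := by
  obtain ⟨l, v, S⟩ := c
  cases l with
  | none => simp at h
  | some l =>
    simp only [TM2.step, Option.some.injEq] at h
    subst h
    exact (length_stepAux_le _ _ _ _).trans (Nat.add_le_add_left (hC l) _)

theorem exists_pushes_le {K : Type} {Γ : K → Type} {Λ σ : Type} [Finite Λ]
    (m : Λ → TM2.Stmt Γ Λ σ) : ∃ C, ∀ l, pushes (m l) ≤ C := by
  obtain ⟨C, hC⟩ := (Set.finite_range fun l => pushes (m l)).bddAbove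
  exact ⟨C, fun l => hC ⟨l, rfl⟩⟩

/-- Time bounds space. This yields both the polynomial length of outputs and the space needed by a
polynomial-time call inside a long run. -/
theorem Run.length_le {m : Λ → TM2.Stmt Γ Λ σ} {C : ℕ} (hC : ∀ l, pushes (m l) ≤ C) {t : ℕ}
    {a b : TM2.Cfg Γ Λ σ} {B : TM2.Cfg Γ Λ σ → Prop} (h : Run (TM2.step m) B t a b) :
    Run (TM2.step m) (fun c => ∀ k, (c.stk k).length ≤ (a.stk k).length + C * t) t a b := by
  induction h with
  | refl => exact .refl fun k => Nat.le_add_right _ _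
  | @head a b c t hB hs _ ih =>
    refine .head (fun k => Nat.le_add_right _ _) hs (ih.mono fun c hc k => ?_)
    have := length_step_le hC hs k
    have := hc k
    rw [Nat.mul_succ]
    omega

theorem Run.right {C : Type} {step : C → Option C} {B : C → Prop} {t : ℕ} {a b : C}
    (h : Run step B t a b) : B b := by
  induction h with
  | refl h => exact h
  | head _ _ _ ih => exact ih

end Growth

/-! ### Programs over bit registers with calls of machines -/

/-- A machine whose input and output are strings of bits. -/
abbrev Box := TM2ComputableAux Bool Bool

/-- The machine outputs `y` on input `x` after `t` steps. -/
def Box.Outputs (M : Box) (x y : List Bool) (t : ℕ) : Prop :=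
  Run M.tm.step (fun _ => True) t (initList M.tm (x.map M.inputAlphabet.symm))
    (haltList M.tm (y.map M.outputAlphabet.symm))

/-- Programs on registers that contain strings of bits. `call i r r'` moves the register `r` to the
input stack of the `i`-th machine, runs it, and moves its output on top of the register `r'`. -/
inductive Prog
  | push (r : Fin 5) (b : Bool)
  | pop (r : Fin 5)
  | seq (P Q : Prog)
  | ite (r : Fin 5) (p : Option Bool → Bool) (P Q : Prog)
  | loop (r : Fin 5) (p : Option Bool → Bool) (P : Prog)
  | call (i : Bool) (r r' : Fin 5)

section Compile

variable (M : Bool → Box)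

/-- The stacks: the registers and the stacks of the machines. -/
abbrev Stk := Fin 5 ⊕ (Σ i, (M i).tm.K)

/-- The alphabets of the stacks. -/
abbrev Gam : Stk M → Type
  | .inl _ => Bool
  | .inr p => (M p.1).tm.Γ p.2

/-- The internal states: the last bit read and the internal states of the machines. -/
abbrev Sta := Option Bool × ∀ i, (M i).tm.σ

/-- The labels of a program. -/
def Lab : Prog → Type
  | .push _ _ => Unit
  | .pop _ => Unit
  | .seq P Q => Lab P ⊕ Lab Q
  | .ite _ _ P Q => Option (Lab P ⊕ Lab Q)
  | .loop _ _ P => Option (Lab P)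
  | .call i _ _ => Option (Option (M i).tm.Λ)

/-- The first label of a program. -/
def entry : (P : Prog) → Lab M P
  | .push _ _ => ()
  | .pop _ => ()
  | .seq P _ => .inl (entry P)
  | .ite _ _ _ _ => none
  | .loop _ _ _ => none
  | .call _ _ _ => none

theorem finite_lab (P : Prog) : Finite (Lab M P) := by
  induction P with
  | push | pop => exact inferInstanceAs (Finite Unit)
  | seq P Q ihP ihQ => exact inferInstanceAs (Finite (Lab M P ⊕ Lab M Q))
  | ite r p P Q ihP ihQ => exact inferInstanceAs (Finite (Option (Lab M P ⊕ Lab M Q)))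
  | loop r p P ih => exact inferInstanceAs (Finite (Option (Lab M P)))
  | call i =>
    have := (M i).tm.ΛFin
    exact inferInstanceAs (Finite (Option (Option (M i).tm.Λ)))

variable {M} {L : Type}

/-- The statements of the `i`-th machine as statements of a larger one, which goes to `ex` where the
machine halts. -/
def liftStmt (i : Bool) (emb : (M i).tm.Λ → L) (ex : L) :
    TM2.Stmt (M i).tm.Γ (M i).tm.Λ (M i).tm.σ → TM2.Stmt (Gam M) L (Sta M)
  | .push k f q => .push (.inr ⟨i, k⟩) (fun s => f (s.2 i)) (liftStmt i emb ex q)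
  | .peek k f q => .peek (.inr ⟨i, k⟩)
      (fun s o => (s.1, Function.update s.2 i (f (s.2 i) o))) (liftStmt i emb ex q)
  | .pop k f q => .pop (.inr ⟨i, k⟩)
      (fun s o => (s.1, Function.update s.2 i (f (s.2 i) o))) (liftStmt i emb ex q)
  | .load f q => .load (fun s => (s.1, Function.update s.2 i (f (s.2 i)))) (liftStmt i emb ex q)
  | .branch f q₁ q₂ => .branch (fun s => f (s.2 i)) (liftStmt i emb ex q₁) (liftStmt i emb ex q₂)
  | .goto f => .goto fun s => emb (f (s.2 i))
  | .halt => .goto fun _ => ex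

/-- The compiled statements of a program. -/
def code : (P : Prog) → (Lab M P → L) → L → Lab M P → TM2.Stmt (Gam M) L (Sta M)
  | .push r b, _, next, _ => .push (.inl r) (fun _ => b) (.goto fun _ => next)
  | .pop r, _, next, _ => .pop (.inl r) (fun s _ => s) (.goto fun _ => next)
  | .seq P Q, emb, _, .inl l => code P (emb ∘ .inl) (emb (.inr (entry M Q))) l
  | .seq _ Q, emb, next, .inr l => code Q (emb ∘ .inr) next l
  | .ite r p P Q, emb, _, none => .peek (.inl r) (fun s o => (o, s.2))
      (.branch (fun s => p s.1) (.goto fun _ => emb (some (.inl (entry M P))))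
        (.goto fun _ => emb (some (.inr (entry M Q)))))
  | .ite _ _ P _, emb, next, some (.inl l) => code P (fun l => emb (some (.inl l))) next l
  | .ite _ _ _ Q, emb, next, some (.inr l) => code Q (fun l => emb (some (.inr l))) next l
  | .loop r p P, emb, next, none => .peek (.inl r) (fun s o => (o, s.2))
      (.branch (fun s => p s.1) (.goto fun _ => emb (some (entry M P))) (.goto fun _ => next))
  | .loop _ _ P, emb, _, some l => code P (fun l => emb (some l)) (emb none) l
  -- The transfer bit by bit reverses the string: a call expects its argument reversed in the
  -- register and delivers its result reversed.
  | .call i r _, emb, _, none => .pop (.inl r) (fun s o => (o, s.2))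
      (.branch (fun s => s.1.isSome)
        (.push (.inr ⟨i, (M i).tm.k₀⟩)
          (fun s => (M i).inputAlphabet.symm (s.1.getD false)) (.goto fun _ => emb none))
        (.goto fun _ => emb (some (some (M i).tm.main))))
  | .call i _ r', emb, next, some none => .pop (.inr ⟨i, (M i).tm.k₁⟩)
      (fun s o => (o.map (M i).outputAlphabet, s.2))
      (.branch (fun s => s.1.isSome)
        (.push (.inl r') (fun s => s.1.getD false) (.goto fun _ => emb (some none)))
        (.goto fun _ => next))
  | .call i _ _, emb, _, some (some l) =>
      liftStmt i (fun l => emb (some (some l))) (emb (some none)) ((M i).tm.m l)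

/-- The contents of all stacks. -/
def mk (R : Fin 5 → List Bool) (T : ∀ i, ∀ k : (M i).tm.K, List ((M i).tm.Γ k)) :
    ∀ k, List (Gam M k)
  | .inl r => R r
  | .inr p => T p.1 p.2

theorem update_mk_inl (R : Fin 5 → List Bool) (T : ∀ i, ∀ k : (M i).tm.K, List ((M i).tm.Γ k))
    (r : Fin 5) (x : List Bool) :
    Function.update (mk R T) (.inl r) x = mk (Function.update R r x) T := by
  funext k
  rcases k with r' | p
  · by_cases h : r' = r
    · subst h; simp [mk]
    · rw [Function.update_of_ne (by simpa using h)]; simp [mk, h]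
  · rw [Function.update_of_ne (by simp)]; rfl

theorem update_mk_inr (R : Fin 5 → List Bool) (T : ∀ i, ∀ k : (M i).tm.K, List ((M i).tm.Γ k))
    (i : Bool) (k : (M i).tm.K) (x : List ((M i).tm.Γ k)) :
    Function.update (mk R T) (.inr ⟨i, k⟩) x =
      mk R (Function.update T i (Function.update (T i) k x)) := by
  funext k'
  rcases k' with r | ⟨j, k'⟩
  · rw [Function.update_of_ne (by simp)]; rfl
  · by_cases h : j = i
    · subst h
      by_cases h : k' = k
      · subst h; simp [mk]
      · rw [Function.update_of_ne (by simpa using h)]; simp [mk, h]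
    · rw [Function.update_of_ne (by simp [h])]; simp [mk, h]

/-- The lifted statement touches only the stacks and the state of machine `i`; halting becomes a
jump to `ex`, so the simulation is step for step. -/
theorem stepAux_liftStmt (i : Bool) (emb : (M i).tm.Λ → L) (ex : L)
    (q : TM2.Stmt (M i).tm.Γ (M i).tm.Λ (M i).tm.σ) (o : Option Bool) (V : ∀ i, (M i).tm.σ)
    (R : Fin 5 → List Bool) (T : ∀ i, ∀ k : (M i).tm.K, List ((M i).tm.Γ k)) :
    TM2.stepAux (liftStmt i emb ex q) (o, V) (mk R T) =
      ⟨some ((TM2.stepAux q (V i) (T i)).l.elim ex emb),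
        (o, Function.update V i (TM2.stepAux q (V i) (T i)).var),
        mk R (Function.update T i (TM2.stepAux q (V i) (T i)).stk)⟩ := by
  induction q generalizing V T with
  | push k f q ih =>
    simp only [liftStmt, TM2.stepAux]
    rw [update_mk_inr, ih]
    simp [mk]
  | peek k f q ih =>
    simp only [liftStmt, TM2.stepAux]
    rw [ih]
    simp [mk]
  | pop k f q ih =>
    simp only [liftStmt, TM2.stepAux]
    rw [update_mk_inr, ih]
    simp [mk]
  | load f q ih =>
    simp only [liftStmt, TM2.stepAux]
    rw [ih]
    simp
  | branch f q₁ q₂ ih₁ ih₂ =>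
    simp only [liftStmt, TM2.stepAux]
    cases f (V i)
    · exact ih₂ _ _
    · exact ih₁ _ _
  | goto f => simp [liftStmt, TM2.stepAux]
  | halt => simp [liftStmt, TM2.stepAux]

/-- The initial internal states of the machines. -/
def V₀ (M : Bool → Box) : ∀ i, (M i).tm.σ := fun i => (M i).tm.initialState

/-- The configuration in which the machines are idle. -/
def idle (l : L) (o : Option Bool) (R : Fin 5 → List Bool) : TM2.Cfg (Gam M) L (Sta M) :=
  ⟨some l, (o, V₀ M), mk R fun _ _ => []⟩

variable (M) in
/-- The program leads from the registers `R` to the registers `R'` in at most `T` steps. -/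
def Exec (P : Prog) (R R' : Fin 5 → List Bool) (T : ℕ) : Prop :=
  -- Quantifying over the surrounding machine and the exit label makes the notion compositional. The
  -- bits `o` and `o'` are leftovers of the last read and carry no information.
  ∀ (L : Type) (m : L → TM2.Stmt (Gam M) L (Sta M)) (emb : Lab M P → L) (next : L),
    (∀ l, m (emb l) = code P emb next l) → ∀ o, ∃ t ≤ T, ∃ o',
      Run (TM2.step m) (fun _ => True) t (idle (emb (entry M P)) o R) (idle next o' R')

theorem initList_stk (M : FinTM2) (x : List (M.Γ M.k₀)) :
    (initList M x).stk = Function.update (fun _ => []) M.k₀ x := by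
  funext k
  by_cases h : k = M.k₀
  · subst h; simp [initList]
  · simp [initList, h]

theorem haltList_stk (M : FinTM2) (x : List (M.Γ M.k₁)) :
    (haltList M x).stk = Function.update (fun _ => []) M.k₁ x := by
  funext k
  by_cases h : k = M.k₁
  · subst h; simp [haltList]
  · simp [haltList, h]

namespace Exec

theorem mono {P : Prog} {R R' : Fin 5 → List Bool} {T T' : ℕ} (h : Exec M P R R' T)
    (hT : T ≤ T') : Exec M P R R' T' := by
  intro L m emb next hm o
  obtain ⟨t, ht, o', h⟩ := h L m emb next hm o
  exact ⟨t, ht.trans hT, o', h⟩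

theorem push {r : Fin 5} {b : Bool} {R R' : Fin 5 → List Bool}
    (h : R' = Function.update R r (b :: R r)) : Exec M (.push r b) R R' 1 := by
  intro L m emb next hm o
  refine ⟨1, le_rfl, o, .head trivial ?_ (.refl trivial)⟩
  simp only [idle, TM2.step, hm, code, TM2.stepAux]
  rw [h, ← update_mk_inl]
  rfl

theorem pop {r : Fin 5} {R R' : Fin 5 → List Bool}
    (h : R' = Function.update R r (R r).tail) : Exec M (.pop r) R R' 1 := by
  intro L m emb next hm o
  refine ⟨1, le_rfl, o, .head trivial ?_ (.refl trivial)⟩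
  simp only [idle, TM2.step, hm, code, TM2.stepAux]
  rw [h, ← update_mk_inl]
  rfl

theorem seq {P Q : Prog} {R R' R'' : Fin 5 → List Bool} {T T' : ℕ} (h : Exec M P R R' T)
    (h' : Exec M Q R' R'' T') : Exec M (.seq P Q) R R'' (T + T') := by
  intro L m emb next hm o
  obtain ⟨t, ht, o', h⟩ := h L m (emb ∘ .inl) (emb (.inr (entry M Q))) (fun l => hm (.inl l)) o
  obtain ⟨t', ht', o'', h'⟩ := h' L m (emb ∘ .inr) next (fun l => hm (.inr l)) o'
  exact ⟨t + t', Nat.add_le_add ht ht', o'', h.trans h'⟩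

theorem ite_true {r : Fin 5} {p : Option Bool → Bool} {P Q : Prog} {R R' : Fin 5 → List Bool}
    {T : ℕ} (hp : p (R r).head? = true) (h : Exec M P R R' T) :
    Exec M (.ite r p P Q) R R' (T + 1) := by
  intro L m emb next hm o
  obtain ⟨t, ht, o', h⟩ := h L m (fun l => emb (some (.inl l))) next (fun l => hm (some (.inl l)))
    (R r).head?
  refine ⟨t + 1, Nat.succ_le_succ ht, o', .head trivial ?_ h⟩
  simp only [idle, TM2.step, entry]
  rw [hm none]
  simp [code, TM2.stepAux, mk, hp]

theorem ite_false {r : Fin 5} {p : Option Bool → Bool} {P Q : Prog} {R R' : Fin 5 → List Bool}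
    {T : ℕ} (hp : p (R r).head? = false) (h : Exec M Q R R' T) :
    Exec M (.ite r p P Q) R R' (T + 1) := by
  intro L m emb next hm o
  obtain ⟨t, ht, o', h⟩ := h L m (fun l => emb (some (.inr l))) next (fun l => hm (some (.inr l)))
    (R r).head?
  refine ⟨t + 1, Nat.succ_le_succ ht, o', .head trivial ?_ h⟩
  simp only [idle, TM2.step, entry]
  rw [hm none]
  simp [code, TM2.stepAux, mk, hp]

theorem step_loop {r : Fin 5} {p : Option Bool → Bool} {P : Prog} {R : Fin 5 → List Bool}
    {L : Type} {m : L → TM2.Stmt (Gam M) L (Sta M)} {emb : Lab M (.loop r p P) → L} {next : L}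
    (hm : ∀ l, m (emb l) = code (.loop r p P) emb next l) (o : Option Bool) :
    TM2.step m (idle (emb none) o R) = some (idle
      (if p (R r).head? then emb (some (entry M P)) else next) (R r).head? R) := by
  simp only [idle, TM2.step]
  rw [hm none]
  cases h : p (R r).head? <;> simp [code, TM2.stepAux, mk, h]

theorem loop_true {r : Fin 5} {p : Option Bool → Bool} {P : Prog} {R R' R'' : Fin 5 → List Bool}
    {T T' : ℕ} (hp : p (R r).head? = true) (h : Exec M P R R' T)
    (h' : Exec M (.loop r p P) R' R'' T') : Exec M (.loop r p P) R R'' (T + T' + 1) := by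
  intro L m emb next hm o
  obtain ⟨t, ht, o', h⟩ := h L m (fun l => emb (some l)) (emb none) (fun l => hm (some l))
    (R r).head?
  obtain ⟨t', ht', o'', h'⟩ := h' L m emb next hm o'
  refine ⟨t + t' + 1, by omega, o'', .head trivial ?_ (h.trans h')⟩
  rw [entry, step_loop hm, hp]
  rfl

theorem loop_false {r : Fin 5} {p : Option Bool → Bool} {P : Prog} {R : Fin 5 → List Bool}
    (hp : p (R r).head? = false) : Exec M (.loop r p P) R R 1 := by
  intro L m emb next hm o
  refine ⟨1, le_rfl, (R r).head?, .head trivial ?_ (.refl trivial)⟩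
  rw [entry, step_loop hm, hp]
  rfl

theorem run_lift {i : Bool} {L : Type} {m : L → TM2.Stmt (Gam M) L (Sta M)}
    {emb : (M i).tm.Λ → L} {ex : L} (hm : ∀ l, m (emb l) = liftStmt i emb ex ((M i).tm.m l))
    {t : ℕ} {a b : (M i).tm.Cfg} (h : Run (M i).tm.step (fun _ => True) t a b) (o : Option Bool)
    (R : Fin 5 → List Bool) :
    Run (TM2.step m) (fun _ => True) t
      ⟨some (a.l.elim ex emb), (o, Function.update (V₀ M) i a.var),
        mk R (Function.update (fun _ _ => []) i a.stk)⟩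
      ⟨some (b.l.elim ex emb), (o, Function.update (V₀ M) i b.var),
        mk R (Function.update (fun _ _ => []) i b.stk)⟩ := by
  induction h with
  | refl => exact .refl trivial
  | @head a b c t _ hs _ ih =>
    refine .head trivial ?_ ih
    obtain ⟨l, v, S⟩ := a
    cases l with
    | none => cases hs
    | some l =>
      cases hs
      simp only [Option.elim_some, TM2.step, hm]
      rw [stepAux_liftStmt]
      simp

/-- A configuration `haltList` has the initial internal state and only the output on its stacks.
Once the output has been drained the machine is idle again, so it can be called any number of times.
-/
theorem call {i : Bool} {r r' : Fin 5} {x y : List Bool} {R : Fin 5 → List Bool} {t : ℕ}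
    (hx : R r = x.reverse) (h : (M i).Outputs x y t) {R' : Fin 5 → List Bool} {T : ℕ}
    (hR : R' = Function.update (Function.update R r []) r'
      (y.reverse ++ Function.update R r [] r'))
    (hT : x.length + t + y.length + 2 ≤ T) : Exec M (.call i r r') R R' T := by
  intro L m emb next hm o
  -- Here `x` is the part still in the register and `z` the part already transferred; the register
  -- holds `x` reversed, so the induction removes last elements.
  have h₁ : ∀ (x z : List Bool) (R : Fin 5 → List Bool) (o : Option Bool), R r = x.reverse →
      Run (TM2.step m) (fun _ => True) (x.length + 1)
        ⟨some (emb none), (o, V₀ M), mk R (Function.update (fun _ _ => []) i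
          (initList (M i).tm (z.map (M i).inputAlphabet.symm)).stk)⟩
        ⟨some (emb (some (some (M i).tm.main))), (none, V₀ M), mk (Function.update R r [])
          (Function.update (fun _ _ => []) i
          (initList (M i).tm ((x ++ z).map (M i).inputAlphabet.symm)).stk)⟩ := by
    intro x
    induction x using List.reverseRecOn with
    | nil =>
      intro z R o hR
      refine .head trivial ?_ (.refl trivial)
      rw [TM2.step, hm none]
      simp only [code, TM2.stepAux, update_mk_inl]
      simp [mk, hR]
    | append_singleton x b ih =>
      intro z R o hR
      rw [List.length_append, List.length_singleton, Nat.add_right_comm]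
      refine .head trivial ?_ ((ih (b :: z) (Function.update R r x.reverse) (some b)
        (by simp)).congr rfl (by simp))
      rw [TM2.step, hm none]
      simp only [code, TM2.stepAux, update_mk_inl]
      simp [mk, hR, initList_stk]
      rw [update_mk_inr]
      simp
  have h₂ : ∀ (y : List Bool) (R : Fin 5 → List Bool) (o : Option Bool),
      Run (TM2.step m) (fun _ => True) (y.length + 1)
        ⟨some (emb (some none)), (o, V₀ M), mk R (Function.update (fun _ _ => []) i
          (haltList (M i).tm (y.map (M i).outputAlphabet.symm)).stk)⟩
        (idle next none (Function.update R r' (y.reverse ++ R r'))) := by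
    intro y
    induction y with
    | nil =>
      intro R o
      refine .head trivial ?_ (.refl trivial)
      rw [TM2.step, hm (some none)]
      simp only [code, TM2.stepAux, update_mk_inr]
      simp [mk, haltList_stk, idle]
    | cons b y ih =>
      intro R o
      refine .head trivial ?_ ((ih (Function.update R r' (b :: R r')) (some b)).congr rfl
        (by simp))
      rw [TM2.step, hm (some none)]
      simp only [code, TM2.stepAux, update_mk_inr]
      simp [mk, haltList_stk]
      rw [update_mk_inl]
  have h₃ := run_lift (emb := fun l => emb (some (some l))) (ex := emb (some none))
    (fun l => hm (some (some l))) h none (Function.update R r [])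
  have h₁' := h₁ x [] R o hx
  have e₁ : Function.update (V₀ M) i (M i).tm.initialState = V₀ M := Function.update_eq_self i _
  have e₂ : (initList (M i).tm (([] : List Bool).map (M i).inputAlphabet.symm)).stk =
      fun _ => [] := by
    rw [initList_stk]; exact Function.update_eq_self _ _
  have e₃ : Function.update (fun _ _ => []) i (fun _ => []) =
      (fun i (k : (M i).tm.K) => ([] : List ((M i).tm.Γ k))) := Function.update_eq_self i _
  rw [e₂, e₃, List.append_nil] at h₁'
  have h₃' : Run (TM2.step m) (fun _ => True) t
      ⟨some (emb (some (some (M i).tm.main))), (none, V₀ M), mk (Function.update R r [])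
        (Function.update (fun _ _ => []) i
          (initList (M i).tm (x.map (M i).inputAlphabet.symm)).stk)⟩
      ⟨some (emb (some none)), (none, V₀ M), mk (Function.update R r [])
        (Function.update (fun _ _ => []) i
          (haltList (M i).tm (y.map (M i).outputAlphabet.symm)).stk)⟩ := by
    rw [← e₁]; exact h₃
  exact ⟨_, by omega, none,
    (h₁'.trans (h₃'.trans (h₂ y (Function.update R r []) none))).congr rfl (by rw [hR])⟩

end Exec

end Compile

end Nexus

/-! ### Closure properties of polynomial-time string functions -/

namespace Nexus

/-! ### Polynomial bounds -/

/-- `f` is bounded by a polynomial in `s`. -/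
def PolyBd {α : Type} (s f : α → ℕ) : Prop := ∃ c : ℕ, ∀ a, f a ≤ (s a + 2) ^ c

namespace PolyBd

variable {α : Type} {s f g : α → ℕ}

theorem of_le (hg : PolyBd s g) (h : ∀ a, f a ≤ g a) : PolyBd s f :=
  hg.imp fun _ hc a => (h a).trans (hc a)

theorem self (s : α → ℕ) : PolyBd s s := ⟨1, fun a => by simp⟩

/-- The base `s a + 2` is at least 2, so constants can be absorbed into the exponent. -/
theorem const (s : α → ℕ) (n : ℕ) : PolyBd s fun _ => n :=
  ⟨n, fun a => n.lt_two_pow_self.le.trans (Nat.pow_le_pow_left (by omega) _)⟩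

theorem add (hf : PolyBd s f) (hg : PolyBd s g) : PolyBd s fun a => f a + g a := by
  obtain ⟨c, hc⟩ := hf
  obtain ⟨d, hd⟩ := hg
  refine ⟨max c d + 1, fun a => ?_⟩
  have h₁ := (hc a).trans (Nat.pow_le_pow_right (by omega) (le_max_left c d))
  have h₂ := (hd a).trans (Nat.pow_le_pow_right (by omega) (le_max_right c d))
  rw [pow_succ]
  nlinarith

theorem mul (hf : PolyBd s f) (hg : PolyBd s g) : PolyBd s fun a => f a * g a := by
  obtain ⟨c, hc⟩ := hf
  obtain ⟨d, hd⟩ := hg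
  exact ⟨c + d, fun a => by rw [pow_add]; exact Nat.mul_le_mul (hc a) (hd a)⟩

theorem trans (hf : PolyBd s f) (hg : PolyBd f g) : PolyBd s g := by
  obtain ⟨c, hc⟩ := hf
  obtain ⟨d, hd⟩ := hg
  refine ⟨(c + 2) * d, fun a => (hd a).trans ?_⟩
  rw [pow_mul]
  refine Nat.pow_le_pow_left ?_ d
  have h₁ := hc a
  have h₂ : 1 ≤ (s a + 2) ^ c := Nat.one_le_pow _ _ (by omega)
  calc f a + 2 ≤ (s a + 2) ^ c * 2 ^ 2 := by omega
    _ ≤ (s a + 2) ^ c * (s a + 2) ^ 2 :=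
      Nat.mul_le_mul_left _ (Nat.pow_le_pow_left (by omega) _)
    _ = (s a + 2) ^ (c + 2) := (pow_add _ _ _).symm

theorem pow (hf : PolyBd s f) (n : ℕ) : PolyBd s fun a => f a ^ n := by
  induction n with
  | zero => exact (const s 1).of_le fun a => by simp
  | succ n ih => exact (ih.mul hf).of_le fun a => by rw [pow_succ]

theorem eval (hf : PolyBd s f) (p : Polynomial ℕ) : PolyBd s fun a => p.eval (f a) := by
  induction p using Polynomial.induction_on' with
  | add p q hp hq => exact (hp.add hq).of_le fun a => by simp
  | monomial n c => exact ((const s c).mul (hf.pow n)).of_le fun a => by simp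

theorem comp {β : Type} (h : PolyBd s f) (φ : β → α) : PolyBd (s ∘ φ) (f ∘ φ) :=
  h.imp fun _ hc b => hc (φ b)

theorem mono_left {s' : α → ℕ} (h : PolyBd s f) (hs : ∀ a, s a ≤ s' a) : PolyBd s' f :=
  h.imp fun _ hc b => (hc b).trans (Nat.pow_le_pow_left (by have := hs b; omega) _)

end PolyBd

/-! ### Families of strings computed in polynomial time -/

/-- A machine computes `out a` from `inp a` in polynomial time. -/
def PolyOn {α : Type} (inp out : α → List Bool) : Prop :=
  ∃ (M : Box) (c : ℕ), ∀ a, ∃ t ≤ ((inp a).length + 2) ^ c, M.Outputs (inp a) (out a) t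

theorem Box.Outputs.length_le {M : Box} {C : ℕ} (hC : ∀ l, pushes (M.tm.m l) ≤ C)
    {x y : List Bool} {t : ℕ} (h : M.Outputs x y t) : y.length ≤ x.length + C * t := by
  have := (Run.length_le hC h).right M.tm.k₁
  rw [haltList_stk, initList_stk, Function.update_self, List.length_map] at this
  refine this.trans (Nat.add_le_add_right ?_ _)
  by_cases h : M.tm.k₁ = M.tm.k₀
  · rw [h, Function.update_self, List.length_map]
  · rw [Function.update_of_ne h]; simp

/-- Output length is bounded by input length plus pushes per step times time. Without this,
polynomial time would not compose. -/
theorem PolyOn.polyBd {α : Type} {inp out : α → List Bool} (h : PolyOn inp out) :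
    PolyBd (fun a => (inp a).length) fun a => (out a).length := by
  obtain ⟨M, c, h⟩ := h
  have := M.tm.ΛFin
  obtain ⟨C, hC⟩ := exists_pushes_le M.tm.m
  have hb : PolyBd (fun a => (inp a).length) fun a => ((inp a).length + 2) ^ c :=
    ⟨c, fun _ => le_rfl⟩
  refine ((PolyBd.self _).add ((PolyBd.const _ C).mul hb)).of_le fun a => ?_
  obtain ⟨t, ht, h⟩ := h a
  exact (Box.Outputs.length_le hC h).trans
    (Nat.add_le_add_left (Nat.mul_le_mul_left _ ht) _)

/-- The machine that runs a program, with input register `0`. -/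
noncomputable def Prog.machine (M : Bool → Box) (P : Prog) (out : Fin 5) : FinTM2 where
  K := Stk M
  kDecidableEq := inferInstance
  kFin := by
    have := fun i => (M i).tm.kFin
    exact inferInstance
  k₀ := .inl 0
  k₁ := .inl out
  Γ := Gam M
  Λ := Option (Lab M P)
  main := some (entry M P)
  ΛFin := by
    have := finite_lab M P
    exact Fintype.ofFinite _
  σ := Sta M
  initialState := (none, V₀ M)
  σFin := by
    have := fun i => (M i).tm.σFin
    exact inferInstance
  Γk₀Fin := inferInstanceAs (Fintype Bool)
  m
    -- `haltList` requires the initial internal state, so the last bit read is erased before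
    -- halting; this costs one extra step.
    | none => .load (fun _ => (none, V₀ M)) .halt
    | some l => code P some none l

/-- The registers with the given contents of register `0`, the others being empty. -/
def reg₀ (x : List Bool) : Fin 5 → List Bool := ![x, [], [], [], []]

theorem mk_reg₀ {M : Bool → Box} (x : List Bool) :
    Function.update (fun k : Stk M => ([] : List (Gam M k))) (.inl 0) x =
      mk (reg₀ x) fun _ _ => [] := by
  funext k
  rcases k with r | p
  · fin_cases r <;> rfl
  · rfl

/-- The program as a machine with input and output in register `0`. -/
noncomputable def Prog.box (M : Bool → Box) (P : Prog) : Box where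
  tm := P.machine M 0
  inputAlphabet := Equiv.refl Bool
  outputAlphabet := Equiv.refl Bool

theorem Exec.outputs {M : Bool → Box} {P : Prog} {x y : List Bool} {T : ℕ}
    (h : Exec M P (reg₀ x) (reg₀ y) T) : ∃ t ≤ T + 1, (P.box M).Outputs x y t := by
  obtain ⟨t, ht, o, h⟩ := h (Option (Lab M P)) (P.machine M 0).m some none (fun _ => rfl) none
  refine ⟨t + 1, by omega, ?_⟩
  have e₁ : initList (P.machine M 0) x = idle (some (entry M P)) none (reg₀ x) :=
    congrArg (TM2.Cfg.mk _ _) ((initList_stk (P.machine M 0) x).trans (mk_reg₀ x))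
  have e₂ : haltList (P.machine M 0) y = ⟨none, (none, V₀ M), mk (reg₀ y) fun _ _ => []⟩ :=
    congrArg (TM2.Cfg.mk _ _) ((haltList_stk (P.machine M 0) y).trans (mk_reg₀ y))
  have e₃ := (congrArg (initList (P.machine M 0)) (List.map_id x)).trans e₁
  have e₄ := (congrArg (haltList (P.machine M 0)) (List.map_id y)).trans e₂
  have : Run (P.machine M 0).step (fun _ => True) (t + 1) (idle (some (entry M P)) none (reg₀ x))
      ⟨none, (none, V₀ M), mk (reg₀ y) fun _ _ => []⟩ :=
    h.trans (.head trivial rfl (.refl trivial))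
  exact (this.congr rfl e₄.symm).congr_left e₃.symm

theorem PolyOn.of_exec {α : Type} {inp out : α → List Bool} {M : Bool → Box} (P : Prog)
    {T : α → ℕ} (hT : PolyBd (fun a => (inp a).length) T)
    (h : ∀ a, Exec M P (reg₀ (inp a)) (reg₀ (out a)) (T a)) : PolyOn inp out := by
  obtain ⟨c, hc⟩ := hT.add (.const _ 1)
  refine ⟨P.box M, c, fun a => ?_⟩
  obtain ⟨t, ht, h⟩ := (h a).outputs
  exact ⟨t, ht.trans (hc a), h⟩

theorem FP.polyOn {f : List Bool → List Bool} (h : FP f) : PolyOn id f := by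
  obtain ⟨M⟩ := h
  obtain ⟨c, hc⟩ := (PolyBd.self (fun x : List Bool => x.length)).eval M.time
  refine ⟨M.toTM2ComputableAux, c, fun x => ?_⟩
  obtain ⟨⟨t, h⟩, ht⟩ := M.outputsFun x
  exact ⟨t, ht.trans (hc x), Run.of_iterate h⟩

theorem PolyOn.fp {f : List Bool → List Bool} (h : PolyOn id f) : FP f := by
  obtain ⟨M, c, h⟩ := h
  refine ⟨{ M with
    time := (Polynomial.X + 2) ^ c
    outputsFun := fun x => Classical.choice ?_ }⟩
  obtain ⟨t, ht, h⟩ := h x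
  exact ⟨⟨⟨t, h.iterate⟩, by simpa using ht⟩⟩

/-! ### Basic programs -/

section Basic

variable {M : Bool → Box}

@[simp] theorem update_vec_zero (a b c d e x : List Bool) :
    Function.update ![a, b, c, d, e] 0 x = ![x, b, c, d, e] := by
  funext i; fin_cases i <;> rfl

@[simp] theorem update_vec_one (a b c d e x : List Bool) :
    Function.update ![a, b, c, d, e] 1 x = ![a, x, c, d, e] := by
  funext i; fin_cases i <;> rfl

@[simp] theorem update_vec_two (a b c d e x : List Bool) :
    Function.update ![a, b, c, d, e] 2 x = ![a, b, x, d, e] := by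
  funext i; fin_cases i <;> rfl

@[simp] theorem update_vec_three (a b c d e x : List Bool) :
    Function.update ![a, b, c, d, e] 3 x = ![a, b, c, x, e] := by
  funext i; fin_cases i <;> rfl

@[simp] theorem update_vec_four (a b c d e x : List Bool) :
    Function.update ![a, b, c, d, e] 4 x = ![a, b, c, d, x] := by
  funext i; fin_cases i <;> rfl

/-- Move register `r` to `r'`, reversing it. -/
def Prog.move (r r' : Fin 5) : Prog :=
  .loop r Option.isSome (.ite r (· == some true) (.seq (.pop r) (.push r' true))
    (.seq (.pop r) (.push r' false)))

theorem Exec.move {r r' : Fin 5} (hr : r ≠ r') {R R' : Fin 5 → List Bool} {T : ℕ}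
    (h : R' = Function.update (Function.update R r []) r' ((R r).reverse ++ R r'))
    (hT : 4 * (R r).length + 1 ≤ T) : Exec M (.move r r') R R' T := by
  generalize hx : R r = x at h hT
  induction x generalizing R T with
  | nil =>
    have : R' = R := by
      rw [h, ← hx, Function.update_eq_self]
      simp [hx]
    rw [this]
    exact (Exec.loop_false (by simp [hx])).mono (by omega)
  | cons b x ih =>
    refine (Exec.loop_true (R' := Function.update (Function.update R r x) r' (b :: R r'))
      (T := 3) (T' := 4 * x.length + 1) (by simp [hx]) ?_
      (ih (by simp [hr]) ?_ le_rfl)).mono (by simp at hT; omega)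
    · cases b
      · refine (Exec.ite_false (by simp [hx]) (Exec.seq (Exec.pop rfl) (Exec.push ?_))).mono
          le_rfl
        simp [hx, hr.symm]
      · refine (Exec.ite_true (by simp [hx]) (Exec.seq (Exec.pop rfl) (Exec.push ?_))).mono
          le_rfl
        simp [hx, hr.symm]
    · rw [h]
      funext k
      by_cases h₁ : k = r' <;> by_cases h₂ : k = r <;> simp_all

/-- Empty register `r`. -/
def Prog.clear (r : Fin 5) : Prog := .loop r Option.isSome (.pop r)

theorem Exec.clear {r : Fin 5} {R R' : Fin 5 → List Bool} {T : ℕ}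
    (h : R' = Function.update R r []) (hT : 2 * (R r).length + 1 ≤ T) :
    Exec M (.clear r) R R' T := by
  generalize hx : R r = x at hT
  induction x generalizing R T with
  | nil =>
    have : R' = R := by rw [h, ← hx, Function.update_eq_self]
    rw [this]
    exact (Exec.loop_false (by simp [hx])).mono (by omega)
  | cons b x ih =>
    exact (Exec.loop_true (R' := Function.update R r x) (T := 1) (by simp [hx])
      (Exec.pop (by simp [hx])) (ih (by simp [h]) (by simp) le_rfl)).mono (by simp at hT; omega)

/-- Move register `0` to the registers `1` and `2`, reversing it. -/
def Prog.dup : Prog :=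
  .loop 0 Option.isSome (.ite 0 (· == some true)
    (.seq (.pop 0) (.seq (.push 1 true) (.push 2 true)))
    (.seq (.pop 0) (.seq (.push 1 false) (.push 2 false))))

theorem Exec.dup {x y z u v : List Bool} :
    Exec M .dup ![x, y, z, u, v] ![[], x.reverse ++ y, x.reverse ++ z, u, v]
      (5 * x.length + 1) := by
  induction x generalizing y z with
  | nil => exact Exec.loop_false rfl
  | cons b x ih =>
    refine (Exec.loop_true (R' := ![x, b :: y, b :: z, u, v]) (T := 4) (by simp) ?_
      (by simpa [Prog.dup] using ih)).mono (by simp; omega)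
    cases b
    · exact Exec.ite_false rfl (Exec.seq (R' := ![x, y, z, u, v]) (Exec.pop (by simp))
        (Exec.seq (R' := ![x, false :: y, z, u, v]) (Exec.push (by simp)) (Exec.push (by simp))))
    · exact Exec.ite_true rfl (Exec.seq (R' := ![x, y, z, u, v]) (Exec.pop (by simp))
        (Exec.seq (R' := ![x, true :: y, z, u, v]) (Exec.push (by simp)) (Exec.push (by simp))))

end Basic

/-- Two machines, indexed by a bit. -/
def boxes (M N : Box) : Bool → Box
  | true => M
  | false => N

/-- A call turns reversed arguments into reversed results, so calls chain directly; only the input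
and the final output have to be reversed by `move`. -/
theorem PolyOn.comp {α : Type} {x y z : α → List Bool} (h : PolyOn x y) (h' : PolyOn y z) :
    PolyOn x z := by
  have hy := h.polyBd
  have hz := hy.trans h'.polyBd
  obtain ⟨N, d, hN⟩ := h'
  obtain ⟨M, c, hM⟩ := h
  have ht : PolyBd (fun a => (x a).length) fun a => ((x a).length + 2) ^ c := ⟨c, fun _ => le_rfl⟩
  have ht' : PolyBd (fun a => (x a).length) fun a => ((y a).length + 2) ^ d :=
    hy.trans ⟨d, fun _ => le_rfl⟩
  refine .of_exec (M := boxes M N)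
    (.seq (.move 0 1) (.seq (.call true 1 2) (.seq (.call false 2 3) (.move 3 0))))
    (T := fun a => (4 * (x a).length + 1) + (((x a).length + ((x a).length + 2) ^ c +
      (y a).length + 2) + (((y a).length + ((y a).length + 2) ^ d + (z a).length + 2) +
      (4 * (z a).length + 1)))) ?_ fun a => ?_
  · have hx := PolyBd.self fun a => (x a).length
    have hc := PolyBd.const fun a => (x a).length
    exact (((hc 4).mul hx).add (hc 1)).add ((((hx.add ht).add hy).add (hc 2)).add
      ((((hy.add ht').add hz).add (hc 2)).add (((hc 4).mul hz).add (hc 1))))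
  · obtain ⟨t, ht, h₁⟩ := hM a
    obtain ⟨t', ht', h₂⟩ := hN a
    refine Exec.seq (R' := ![[], (x a).reverse, [], [], []])
      (.move (by decide) (by simp [reg₀]) (by simp [reg₀]))
      (.seq (R' := ![[], [], (y a).reverse, [], []]) (.call rfl h₁ (by simp) (by omega))
      (.seq (R' := ![[], [], [], (z a).reverse, []]) (.call rfl h₂ (by simp) (by omega))
      (.move (by decide) (by simp [reg₀]) (by simp))))

/-- The leading `true` is the node bit of `Tree.ser`: on serialized trees this is pairing. -/
theorem PolyOn.append {α : Type} {x y z : α → List Bool} (h : PolyOn x y) (h' : PolyOn x z) :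
    PolyOn x fun a => true :: (y a ++ z a) := by
  have hy := h.polyBd
  have hz := h'.polyBd
  obtain ⟨N, d, hN⟩ := h'
  obtain ⟨M, c, hM⟩ := h
  have ht : PolyBd (fun a => (x a).length) fun a => ((x a).length + 2) ^ c := ⟨c, fun _ => le_rfl⟩
  have ht' : PolyBd (fun a => (x a).length) fun a => ((x a).length + 2) ^ d :=
    ⟨d, fun _ => le_rfl⟩
  refine .of_exec (M := boxes M N)
    (.seq .dup (.seq (.call true 1 3) (.seq (.call false 2 3) (.seq (.move 3 0) (.push 0 true)))))
    (T := fun a => (5 * (x a).length + 1) + (((x a).length + ((x a).length + 2) ^ c +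
      (y a).length + 2) + (((x a).length + ((x a).length + 2) ^ d + (z a).length + 2) +
      ((4 * ((y a).length + (z a).length) + 1) + 1)))) ?_ fun a => ?_
  · have hx := PolyBd.self fun a => (x a).length
    have hc := PolyBd.const fun a => (x a).length
    exact (((hc 5).mul hx).add (hc 1)).add ((((hx.add ht).add hy).add (hc 2)).add
      ((((hx.add ht').add hz).add (hc 2)).add ((((hc 4).mul (hy.add hz)).add (hc 1)).add (hc 1))))
  · obtain ⟨t, ht, h₁⟩ := hM a
    obtain ⟨t', ht', h₂⟩ := hN a
    refine Exec.seq (R' := ![[], (x a).reverse, (x a).reverse, [], []]) (by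
      simpa [reg₀] using Exec.dup (M := boxes M N) (x := x a) (y := []) (z := []) (u := []) (v := []))
      (.seq (R' := ![[], [], (x a).reverse, (y a).reverse, []])
        (.call rfl h₁ (by simp) (by omega))
      (.seq (R' := ![[], [], [], (z a).reverse ++ (y a).reverse, []])
        (.call rfl h₂ (by simp) (by omega))
      (.seq (R' := ![y a ++ z a, [], [], [], []])
        (.move (by decide) (by simp) (by simp; omega)) (.push (by simp [reg₀])))))

/-! ### Trees -/

/-- Binary trees. -/
inductive Tree
  | nil
  | node (l r : Tree)

namespace Tree

/-- The serialization of a tree. -/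
def ser : Tree → List Bool
  | nil => [false]
  | node l r => true :: (ser l ++ ser r)

/-- The length of the serialization. -/
def size (t : Tree) : ℕ := t.ser.length

@[simp] theorem size_nil : size nil = 1 := rfl

@[simp] theorem size_node (l r : Tree) : size (node l r) = size l + size r + 1 := by
  simp [size, ser]

theorem size_pos (t : Tree) : 0 < t.size := by cases t <;> simp

end Tree

/-- Take one serialized tree off register `0`, reversing it into register `1`; register `2` counts
the pending subtrees. -/
def Prog.takeTree : Prog :=
  .loop 2 Option.isSome (.ite 0 (· == some true)
    (.seq (.pop 0) (.seq (.push 1 true) (.push 2 true)))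
    (.seq (.pop 0) (.seq (.push 1 false) (.pop 2))))

/-- Reading a node bit replaces one pending subtree by two, reading a leaf removes one. The run `h`
that remains after the tree is a parameter, so that the induction can treat the two subtrees of a
node in succession. -/
theorem Exec.takeTree {M : Bool → Box} (t : Tree) {x y z : List Bool} {E : Fin 5 → List Bool}
    {T : ℕ} (h : Exec M .takeTree ![x, t.ser.reverse ++ y, z, [], []] E T) :
    Exec M .takeTree ![t.ser ++ x, y, true :: z, [], []] E (T + 5 * t.size) := by
  induction t generalizing x y z T with
  | nil =>
    exact (Exec.loop_true (R' := ![x, false :: y, z, [], []]) (T := 4) rfl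
      (Exec.ite_false rfl (.seq (R' := ![x, y, true :: z, [], []]) (.pop (by simp [Tree.ser]))
        (.seq (R' := ![x, false :: y, true :: z, [], []]) (.push (by simp)) (.pop (by simp)))))
      h).mono (by simp; omega)
  | node l r ihl ihr =>
    refine (Exec.loop_true (R' := ![l.ser ++ (r.ser ++ x), true :: y, true :: true :: z, [], []])
      (T := 4) rfl
      (Exec.ite_true rfl (.seq (R' := ![l.ser ++ (r.ser ++ x), y, true :: z, [], []])
        (.pop (by simp [Tree.ser]))
        (.seq (R' := ![l.ser ++ (r.ser ++ x), true :: y, true :: z, [], []]) (.push (by simp))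
          (.push (by simp)))))
      (ihl (ihr (by simpa [Tree.ser] using h)))).mono (by simp; omega)

theorem PolyOn.fst {α : Type} (t : α → Tree) (x : α → List Bool) :
    PolyOn (fun a => true :: ((t a).ser ++ x a)) fun a => (t a).ser := by
  -- The program makes no calls; the identity machine only fills the parameter.
  refine .of_exec (M := fun _ => ⟨idComputer Bool, Equiv.refl Bool, Equiv.refl Bool⟩)
    (.seq (.pop 0) (.seq (.push 2 true) (.seq .takeTree (.seq (.clear 0) (.move 1 0)))))
    (T := fun a => 1 + (1 + ((1 + 5 * (t a).size) + ((2 * (x a).length + 1) +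
      (4 * (t a).size + 1))))) ?_ fun a => ?_
  · refine ((PolyBd.const _ 9).mul (.self _)).of_le fun a => ?_
    simp [Tree.size]
    omega
  · exact Exec.seq (R' := ![(t a).ser ++ x a, [], [], [], []]) (.pop (by simp [reg₀]))
      (.seq (R' := ![(t a).ser ++ x a, [], [true], [], []]) (.push (by simp))
      (.seq (R' := ![x a, (t a).ser.reverse, [], [], []])
        (.takeTree _ (by simpa [Prog.takeTree] using Exec.loop_false rfl))
      (.seq (R' := ![[], (t a).ser.reverse, [], [], []]) (.clear (by simp) (by simp))
        (.move (by decide) (by simp [reg₀]) (by simp [Tree.size])))))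

theorem PolyOn.snd {α : Type} (t : α → Tree) (x : α → List Bool) :
    PolyOn (fun a => true :: ((t a).ser ++ x a)) x := by
  refine .of_exec (M := fun _ => ⟨idComputer Bool, Equiv.refl Bool, Equiv.refl Bool⟩)
    (.seq (.pop 0) (.seq (.push 2 true) (.seq .takeTree (.clear 1))))
    (T := fun a => 1 + (1 + ((1 + 5 * (t a).size) + (2 * (t a).size + 1)))) ?_ fun a => ?_
  · refine ((PolyBd.const _ 7).mul (.self _)).of_le fun a => ?_
    simp [Tree.size]
    omega
  · exact Exec.seq (R' := ![(t a).ser ++ x a, [], [], [], []]) (.pop (by simp [reg₀]))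
      (.seq (R' := ![(t a).ser ++ x a, [], [true], [], []]) (.push (by simp))
      (.seq (R' := ![x a, (t a).ser.reverse, [], [], []])
        (.takeTree _ (by simpa [Prog.takeTree] using Exec.loop_false rfl))
        (.clear (by simp [reg₀]) (by simp [Tree.size]))))

theorem PolyOn.nil {α : Type} (x : α → List Bool) : PolyOn x fun _ => Tree.nil.ser := by
  refine .of_exec (M := fun _ => ⟨idComputer Bool, Equiv.refl Bool, Equiv.refl Bool⟩)
    (.seq (.clear 0) (.push 0 false)) (T := fun a => (2 * (x a).length + 1) + 1)
    ((((PolyBd.const _ 2).mul (.self _)).add (.const _ 1)).add (.const _ 1)) fun a => ?_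
  exact Exec.seq (R' := ![[], [], [], [], []]) (.clear (by simp [reg₀]) (by simp [reg₀]))
    (.push (by simp [reg₀, Tree.ser]))

theorem PolyOn.id {α : Type} (x : α → List Bool) : PolyOn x x := by
  refine .of_exec (M := fun _ => ⟨idComputer Bool, Equiv.refl Bool, Equiv.refl Bool⟩)
    (.seq (.push 0 true) (.pop 0)) (T := fun a => 1 + 1) (.const _ 2) fun a => ?_
  exact Exec.seq (R' := ![true :: x a, [], [], [], []]) (.push (by simp [reg₀]))
    (.pop (by simp [reg₀]))

/-- The tree of a truth value. -/
def Tree.ofBool : Bool → Tree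
  | false => nil
  | true => node nil nil

/-- Each machine is asked to be correct and fast only on the inputs that take its branch. This is
what makes case distinctions with a partial destructor possible. -/
theorem PolyOn.branch {α : Type} {x y : α → List Bool} (b : α → Tree)
    (hb : PolyOn x fun a => (b a).ser)
    (ht : PolyOn (fun a : {a // b a ≠ .nil} => x a) fun a => y a)
    (hf : PolyOn (fun a : {a // b a = .nil} => x a) fun a => y a) : PolyOn x y := by
  refine (hb.append (.id x)).comp ?_
  have hp : PolyBd (fun a => (true :: ((b a).ser ++ x a)).length)
      fun a => (x a).length := (PolyBd.self _).of_le fun a => by simp; omega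
  have hq : PolyBd (fun a => (true :: ((b a).ser ++ x a)).length)
      fun a => (b a).size := (PolyBd.self _).of_le fun a => by simp [Tree.size]; omega
  have ⟨d, hd⟩ := ht.polyBd
  have ⟨e, he⟩ := hf.polyBd
  obtain ⟨M, c, hM⟩ := ht
  obtain ⟨N, c', hN⟩ := hf
  refine .of_exec (M := boxes M N) (.seq (.pop 0) (.ite 0 (· == some true)
      (.seq (.push 2 true) (.seq .takeTree (.seq (.clear 1) (.seq (.move 0 1)
        (.seq (.call true 1 2) (.move 2 0))))))
      (.seq (.pop 0) (.seq (.move 0 1) (.seq (.call false 1 2) (.move 2 0))))))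
    (T := fun a => 1 + ((1 + ((1 + 5 * (b a).size) + ((2 * (b a).size + 1) +
      ((4 * (x a).length + 1) + (((x a).length +
      (((x a).length + 2) ^ c + ((x a).length + 2) ^ c') + (((x a).length + 2) ^ d +
      ((x a).length + 2) ^ e) + 2) + (4 * (((x a).length + 2) ^ d +
      ((x a).length + 2) ^ e) + 1)))))) + 1)) ?_ fun a => ?_
  · have hc := PolyBd.const fun a => (true :: ((b a).ser ++ x a)).length
    have hs := fun c => hp.trans (g := fun a => ((x a).length + 2) ^ c) ⟨c, fun _ => le_rfl⟩
    exact (hc 1).add (((hc 1).add (((hc 1).add ((hc 5).mul hq)).add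
      ((((hc 2).mul hq).add (hc 1)).add ((((hc 4).mul hp).add (hc 1)).add
      (((((hp.add ((hs c).add (hs c'))).add ((hs d).add (hs e))).add (hc 2))).add
      (((hc 4).mul ((hs d).add (hs e))).add (hc 1))))))).add (hc 1))
  · by_cases hba : b a = .nil
    · obtain ⟨t, ht, h⟩ := hN ⟨a, hba⟩
      have he := he ⟨a, hba⟩
      dsimp only at ht he h
      refine (Exec.seq (R' := ![false :: x a, [], [], [], []])
        (.pop (by simp [reg₀, hba, Tree.ser]))
        (.ite_false rfl (.seq (R' := ![x a, [], [], [], []]) (.pop (by simp))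
        (.seq (R' := ![[], (x a).reverse, [], [], []])
          (.move (T := 4 * (x a).length + 1) (by decide) (by simp) (by simp))
        (.seq (R' := ![[], [], (y a).reverse, [], []]) (.call rfl h (by simp) le_rfl)
          (.move (T := 4 * (y a).length + 1) (by decide) (by simp [reg₀]) (by simp))))))).mono ?_
      omega
    · obtain ⟨t, ht, h⟩ := hM ⟨a, hba⟩
      have hd := hd ⟨a, hba⟩
      dsimp only at ht hd h
      refine (Exec.seq (R' := ![(b a).ser ++ x a, [], [], [], []])
        (.pop (by simp [reg₀]))
        (.ite_true (by cases hb : b a <;> simp_all [Tree.ser])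
        (.seq (R' := ![(b a).ser ++ x a, [], [true], [], []]) (.push (by simp))
        (.seq (R' := ![x a, (b a).ser.reverse, [], [], []])
          (.takeTree _ (by simpa [Prog.takeTree] using Exec.loop_false rfl))
        (.seq (R' := ![x a, [], [], [], []]) (.clear (T := 2 * (b a).size + 1) (by simp)
          (by simp [Tree.size]))
        (.seq (R' := ![[], (x a).reverse, [], [], []])
          (.move (T := 4 * (x a).length + 1) (by decide) (by simp) (by simp))
        (.seq (R' := ![[], [], (y a).reverse, [], []]) (.call rfl h (by simp) le_rfl)
          (.move (T := 4 * (y a).length + 1) (by decide) (by simp [reg₀]) (by simp))))))))).mono ?_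
      omega

/-- Iteration of a function on serialized pairs of trees as long as the first tree is not `nil`. -/
theorem PolyOn.iterate {α σ : Type} {l r : σ → Tree} {step : σ → σ}
    (hs : PolyOn (fun s => (Tree.node (l s) (r s)).ser)
      fun s => (Tree.node (l (step s)) (r (step s))).ser)
    (init : α → σ) (n : α → ℕ)
    (hn : PolyBd (fun a => (Tree.node (l (init a)) (r (init a))).size) n)
    (hsz : ∃ c, ∀ a, ∀ k ≤ n a, (Tree.node (l (step^[k] (init a))) (r (step^[k] (init a)))).size ≤
      ((Tree.node (l (init a)) (r (init a))).size + 2) ^ c)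
    (hlt : ∀ a, ∀ k < n a, l (step^[k] (init a)) ≠ .nil)
    (heq : ∀ a, l (step^[n a] (init a)) = .nil) :
    PolyOn (fun a => (Tree.node (l (init a)) (r (init a))).ser)
      fun a => (Tree.node (l (step^[n a] (init a))) (r (step^[n a] (init a)))).ser := by
  obtain ⟨M, c, hM⟩ := hs
  obtain ⟨d, hd⟩ := hsz
  let S : α → ℕ := fun a => ((Tree.node (l (init a)) (r (init a))).size + 2) ^ d
  have hS : PolyBd (fun a => (Tree.node (l (init a)) (r (init a))).size) S := ⟨d, fun _ => le_rfl⟩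
  let T : α → ℕ := fun a => 1 + ((4 * S a + 1) + ((S a + (S a + 2) ^ c + S a + 2) +
    ((4 * S a + 1) + 1)))
  have hT : PolyBd (fun a => (Tree.node (l (init a)) (r (init a))).size) T := by
    have hc := PolyBd.const fun a => (Tree.node (l (init a)) (r (init a))).size
    exact (hc 1).add ((((hc 4).mul hS).add (hc 1)).add ((((hS.add (hS.trans ⟨c, fun _ => le_rfl⟩)).add
      hS).add (hc 2)).add ((((hc 4).mul hS).add (hc 1)).add (hc 1))))
  let body : Prog := .seq (.push 0 true) (.seq (.move 0 1) (.seq (.call true 1 2)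
    (.seq (.move 2 0) (.pop 0))))
  -- Induction on the number `j` of remaining rounds. Register `0` holds the pair without its node
  -- bit, so its first bit tells whether the first tree is `nil`.
  have key : ∀ a, ∀ j ≤ n a, Exec (boxes M M) (.loop 0 (· == some true) body)
      ![(l (step^[n a - j] (init a))).ser ++ (r (step^[n a - j] (init a))).ser, [], [], [], []]
      ![(l (step^[n a] (init a))).ser ++ (r (step^[n a] (init a))).ser, [], [], [], []]
      (j * (T a + 1) + 1) := by
    intro a j
    induction j with
    | zero =>
      intro _
      rw [Nat.sub_zero]
      exact (Exec.loop_false (by simp [heq, Tree.ser])).mono (by omega)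
    | succ j ih =>
      intro hj
      have hk : n a - j = n a - (j + 1) + 1 := by omega
      have h := ih (by omega)
      have hsz₁ := hd a (n a - j) (by omega)
      have hsz₂ := hd a (n a - (j + 1)) (by omega)
      have hne := hlt a (n a - (j + 1)) (by omega)
      rw [hk, Function.iterate_succ_apply'] at h hsz₁
      generalize step^[n a - (j + 1)] (init a) = s at *
      obtain ⟨t, ht, hM⟩ := hM s
      dsimp only at ht hM
      have ht : t ≤ (S a + 2) ^ c := ht.trans (Nat.pow_le_pow_left (Nat.add_le_add_right hsz₂ _) _)
      refine (Exec.loop_true (T := T a) ?_ ?_ h).mono (by rw [Nat.succ_mul]; omega)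
      · cases hl : l s with
        | nil => exact absurd hl hne
        | node => simp [Tree.ser]
      · change (Tree.ser _).length ≤ S a at hsz₁ hsz₂
        exact Exec.seq (R' := ![(Tree.node (l s) (r s)).ser, [], [], [], []])
          (.push (by simp [Tree.ser]))
          (.seq (R' := ![[], (Tree.node (l s) (r s)).ser.reverse, [], [], []])
            (.move (by decide) (by simp) (by simp; omega))
          (.seq (R' := ![[], [], (Tree.node (l (step s)) (r (step s))).ser.reverse, [], []])
            (.call rfl hM (by simp) (by omega))
          (.seq (R' := ![(Tree.node (l (step s)) (r (step s))).ser, [], [], [], []])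
            (.move (by decide) (by simp) (by simp; omega)) (.pop (by simp [Tree.ser])))))
  refine .of_exec (M := boxes M M)
    (.seq (.pop 0) (.seq (.loop 0 (· == some true) body) (.push 0 true)))
    (T := fun a => 1 + ((n a * (T a + 1) + 1) + 1)) ?_ fun a => ?_
  · have hc := PolyBd.const fun a => (Tree.node (l (init a)) (r (init a))).size
    exact (hc 1).add (((hn.mul (hT.add (hc 1))).add (hc 1)).add (hc 1))
  · have := key a (n a) le_rfl
    rw [Nat.sub_self] at this
    exact Exec.seq (.pop (by simp [reg₀, Tree.ser])) (.seq this (.push (by simp [reg₀, Tree.ser])))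

end Nexus

/-! ### Strings as trees, and machines bounded in space only -/

namespace Nexus

/-- The tree of a list, given the trees of its elements. -/
def Tree.ofList {α : Type} (f : α → Tree) : List α → Tree
  | [] => nil
  | a :: l => node (f a) (ofList f l)

/-! ### Strings of bits and their trees -/

/-- Turn a string of bits into the serialization of its tree. -/
def Prog.readBits : Prog :=
  .loop 0 Option.isSome (.ite 0 (· == some true)
    (.seq (.pop 0) (.seq (.push 1 true) (.seq (.push 1 true) (.seq (.push 1 false)
      (.push 1 false)))))
    (.seq (.pop 0) (.seq (.push 1 true) (.push 1 false))))

/-- The loop produces everything but the final `nil` of the list, whose bit is pushed afterwards;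
hence `dropLast`. -/
theorem Exec.readBits {M : Bool → Box} {x y : List Bool} :
    Exec M .readBits ![x, y, [], [], []]
      ![[], (Tree.ofList Tree.ofBool x).ser.dropLast.reverse ++ y, [], [], []]
      (7 * x.length + 1) := by
  have hne : ∀ x : List Bool, (Tree.ofList Tree.ofBool x).ser ≠ [] := fun x => by
    cases x <;> simp [Tree.ofList, Tree.ser]
  induction x generalizing y with
  | nil => exact Exec.loop_false rfl
  | cons b x ih =>
    cases b
    · refine (Exec.loop_true (T := 4) (R' := ![x, false :: true :: y, [], [], []]) rfl
        (Exec.ite_false rfl (.seq (R' := ![x, y, [], [], []]) (.pop (by simp))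
          (.seq (R' := ![x, true :: y, [], [], []]) (.push (by simp)) (.push (by simp))))) ?_).mono
        (T := 4 + (7 * x.length + 1) + 1) (by simp; omega)
      have := ih (y := false :: true :: y)
      simpa [Tree.ofList, Tree.ofBool, Tree.ser, List.dropLast_cons_of_ne_nil (hne x),
        Prog.readBits] using this
    · refine (Exec.loop_true (T := 6)
        (R' := ![x, false :: false :: true :: true :: y, [], [], []]) rfl
        (Exec.ite_true rfl (.seq (R' := ![x, y, [], [], []]) (.pop (by simp))
          (.seq (R' := ![x, true :: y, [], [], []]) (.push (by simp))
          (.seq (R' := ![x, true :: true :: y, [], [], []]) (.push (by simp))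
          (.seq (R' := ![x, false :: true :: true :: y, [], [], []]) (.push (by simp))
            (.push (by simp))))))) ?_).mono
        (T := 6 + (7 * x.length + 1) + 1) (by simp; omega)
      have := ih (y := false :: false :: true :: true :: y)
      simpa [Tree.ofList, Tree.ofBool, Tree.ser, List.dropLast_cons_of_ne_nil (hne x),
        Prog.readBits] using this

theorem Tree.ser_ofBits_eq (x : List Bool) : (ofList ofBool x).ser =
    (ofList ofBool x).ser.dropLast ++ [false] := by
  induction x with
  | nil => rfl
  | cons b x ih =>
    have hne : (ofList ofBool x).ser ≠ [] := by cases x <;> simp [ofList, ser]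
    rw [ofList, ser, ih]
    simp [List.dropLast_cons_of_ne_nil]

theorem length_ser_ofBits (x : List Bool) : (Tree.ofList Tree.ofBool x).ser.length ≤
    4 * x.length + 1 := by
  induction x with
  | nil => simp [Tree.ofList, Tree.ser]
  | cons b x ih =>
    cases b <;> simp [Tree.ofList, Tree.ser, Tree.ofBool] at * <;> omega

theorem length_le_ser_ofBits (x : List Bool) :
    x.length ≤ (Tree.ofList Tree.ofBool x).ser.length := by
  induction x with
  | nil => simp
  | cons b x ih => simp [Tree.ofList, Tree.ser] at *; omega

theorem PolyOn.readBits {α : Type} (x : α → List Bool) :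
    PolyOn x fun a => (Tree.ofList Tree.ofBool (x a)).ser := by
  refine .of_exec (M := fun _ => ⟨idComputer Bool, Equiv.refl Bool, Equiv.refl Bool⟩)
    (.seq .readBits (.seq (.push 1 false) (.move 1 0)))
    (T := fun a => (7 * (x a).length + 1) + (1 + (4 * (4 * (x a).length + 1) + 1)))
    (((PolyBd.const _ 30).mul ((PolyBd.self _).add (.const _ 1))).of_le fun a => by omega) fun a => ?_
  · have := length_ser_ofBits (x a)
    refine .seq Exec.readBits (.seq (R' := ![[],
      (Tree.ofList Tree.ofBool (x a)).ser.reverse, [], [], []]) (.push ?_)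
      (.move (by decide) (by simp [reg₀]) (by simpa using this)))
    conv_lhs => rw [Tree.ser_ofBits_eq]
    simp

/-- Turn the serialization of a tree of a string of bits into that string. -/
def Prog.printBits : Prog :=
  .loop 0 (· == some true) (.seq (.pop 0) (.ite 0 (· == some true)
    (.seq (.pop 0) (.seq (.pop 0) (.seq (.pop 0) (.push 1 true))))
    (.seq (.pop 0) (.push 1 false))))

theorem Exec.printBits {M : Bool → Box} {x y : List Bool} :
    Exec M .printBits ![(Tree.ofList Tree.ofBool x).ser, y, [], [], []]
      ![[false], x.reverse ++ y, [], [], []] (7 * x.length + 1) := by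
  induction x generalizing y with
  | nil => exact Exec.loop_false rfl
  | cons b x ih =>
    cases b
    · refine (Exec.loop_true (T := 4)
        (R' := ![(Tree.ofList Tree.ofBool x).ser, false :: y, [], [], []]) rfl
        (.seq (R' := ![false :: (Tree.ofList Tree.ofBool x).ser, y, [], [], []])
          (.pop (by simp [Tree.ofList, Tree.ser, Tree.ofBool]))
        (.ite_false rfl (.seq (R' := ![(Tree.ofList Tree.ofBool x).ser, y, [], [], []])
          (.pop (by simp)) (.push (by simp))))) ?_).mono
        (T := 4 + (7 * x.length + 1) + 1) (by simp; omega)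
      have := ih (y := false :: y)
      simpa [Prog.printBits] using this
    · refine (Exec.loop_true (T := 6)
        (R' := ![(Tree.ofList Tree.ofBool x).ser, true :: y, [], [], []]) rfl
        (.seq (R' := ![true :: false :: false :: (Tree.ofList Tree.ofBool x).ser, y, [], [], []])
          (.pop (by simp [Tree.ofList, Tree.ser, Tree.ofBool]))
        (.ite_true rfl (.seq (R' := ![false :: false :: (Tree.ofList Tree.ofBool x).ser, y,
            [], [], []]) (.pop (by simp))
          (.seq (R' := ![false :: (Tree.ofList Tree.ofBool x).ser, y, [], [], []]) (.pop (by simp))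
          (.seq (R' := ![(Tree.ofList Tree.ofBool x).ser, y, [], [], []]) (.pop (by simp))
            (.push (by simp))))))) ?_).mono
        (T := 6 + (7 * x.length + 1) + 1) (by simp; omega)
      have := ih (y := true :: y)
      simpa [Prog.printBits] using this

theorem PolyOn.printBits {α : Type} (x : α → List Bool) :
    PolyOn (fun a => (Tree.ofList Tree.ofBool (x a)).ser) x := by
  refine .of_exec (M := fun _ => ⟨idComputer Bool, Equiv.refl Bool, Equiv.refl Bool⟩)
    (.seq .printBits (.seq (.pop 0) (.move 1 0)))
    (T := fun a => (7 * (x a).length + 1) + (1 + (4 * (x a).length + 1)))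
    (((PolyBd.const _ 12).mul ((PolyBd.self _).add (.const _ 1))).of_le fun a => ?_) fun a => ?_
  · have := length_le_ser_ofBits (x a)
    simp; omega
  · refine .seq Exec.printBits (.seq (R' := ![[], (x a).reverse, [], [], []])
      (.pop (by simp)) (.move (by decide) (by simp [reg₀]) (by simp)))

/-! ### Machines of polynomial space with a write-only output -/

section Space

variable {M : Bool → Box}

/-- All stacks but the output register `4` have length at most `N`. -/
def Short (N : ℕ) (S : ∀ k, List (Gam M k)) : Prop := ∀ k, k ≠ .inl 4 → (S k).length ≤ N

/-- The program leads from the registers `R` to the registers `R'` in space `N`, if the single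
statements of the machine push at most `C` symbols. -/
def ExecShort (M : Bool → Box) (C N : ℕ) (P : Prog) (R R' : Fin 5 → List Bool) : Prop :=
  ∀ (L : Type) (m : L → TM2.Stmt (Gam M) L (Sta M)) (emb : Lab M P → L) (next : L),
    (∀ l, pushes (m l) ≤ C) → (∀ l, m (emb l) = code P emb next l) → ∀ o, ∃ t o',
      Run (TM2.step m) (fun c => Short N c.stk) t (idle (emb (entry M P)) o R) (idle next o' R')

theorem Short.mk {N : ℕ} {R : Fin 5 → List Bool} (hR : ∀ r, r ≠ 4 → (R r).length ≤ N) :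
    Short (M := M) N (mk R fun _ _ => []) := by
  rintro (r | p) h
  · exact hR r (by rintro rfl; exact h rfl)
  · exact Nat.zero_le _

/-- For subroutines a time bound suffices. Only the main loop, which may take exponentially many
rounds, needs a space bound of its own. -/
theorem Exec.short {P : Prog} {R R' : Fin 5 → List Bool} {T S C N : ℕ} (h : Exec M P R R' T)
    (hR : ∀ r, r ≠ 4 → (R r).length ≤ S) (hN : S + C * T ≤ N) : ExecShort M C N P R R' := by
  intro L m emb next hC hm o
  obtain ⟨t, ht, o', h⟩ := h L m emb next hm o
  refine ⟨t, o', (h.length_le hC).mono fun c hc k hk => (hc k).trans ?_⟩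
  exact (Nat.add_le_add (Short.mk hR k hk) (Nat.mul_le_mul_left _ ht)).trans hN

namespace ExecShort

variable {C N : ℕ}

theorem seq {P Q : Prog} {R R' R'' : Fin 5 → List Bool} (h : ExecShort M C N P R R')
    (h' : ExecShort M C N Q R' R'') : ExecShort M C N (.seq P Q) R R'' := by
  intro L m emb next hC hm o
  obtain ⟨t, o', h⟩ := h L m (emb ∘ .inl) (emb (.inr (entry M Q))) hC (fun l => hm (.inl l)) o
  obtain ⟨t', o'', h'⟩ := h' L m (emb ∘ .inr) next hC (fun l => hm (.inr l)) o'
  exact ⟨t + t', o'', h.trans h'⟩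

theorem loop_true {r : Fin 5} {p : Option Bool → Bool} {P : Prog} {R R' R'' : Fin 5 → List Bool}
    (hR : ∀ r, r ≠ 4 → (R r).length ≤ N)
    (hp : p (R r).head? = true) (h : ExecShort M C N P R R')
    (h' : ExecShort M C N (.loop r p P) R' R'') : ExecShort M C N (.loop r p P) R R'' := by
  intro L m emb next hC hm o
  obtain ⟨t, o', h⟩ := h L m (fun l => emb (some l)) (emb none) hC (fun l => hm (some l))
    (R r).head?
  obtain ⟨t', o'', h'⟩ := h' L m emb next hC hm o'
  refine ⟨t + t' + 1, o'', .head (Short.mk hR) ?_ (h.trans h')⟩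
  rw [entry, Exec.step_loop hm, hp]
  rfl

theorem loop_false {r : Fin 5} {p : Option Bool → Bool} {P : Prog} {R : Fin 5 → List Bool}
    (hR : ∀ r, r ≠ 4 → (R r).length ≤ N)
    (hp : p (R r).head? = false) : ExecShort M C N (.loop r p P) R R := by
  intro L m emb next hC hm o
  refine ⟨1, (R r).head?, .head (Short.mk hR) ?_ (.refl (Short.mk hR))⟩
  rw [entry, Exec.step_loop hm, hp]
  rfl

end ExecShort

/-- The program never reads the register `r`. -/
def Prog.WriteOnly (r : Fin 5) : Prog → Prop
  | .push _ _ => True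
  | .pop r' => r' ≠ r
  | .seq P Q => P.WriteOnly r ∧ Q.WriteOnly r
  | .ite r' _ P Q => r' ≠ r ∧ P.WriteOnly r ∧ Q.WriteOnly r
  | .loop r' _ P => r' ≠ r ∧ P.WriteOnly r
  | .call _ r' _ => r' ≠ r

theorem writeOnly_liftStmt {L : Type} (r : Fin 5) (i : Bool) (emb : (M i).tm.Λ → L) (ex : L)
    (q : TM2.Stmt (M i).tm.Γ (M i).tm.Λ (M i).tm.σ) :
    WriteOnly (Sum.inl r) (liftStmt i emb ex q) := by
  induction q with
  | push k f q ih => exact ih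
  | peek k f q ih => exact ⟨by simp, ih⟩
  | pop k f q ih => exact ⟨by simp, ih⟩
  | load f q ih => exact ih
  | branch f q₁ q₂ ih₁ ih₂ => exact ⟨ih₁, ih₂⟩
  | goto f => trivial
  | halt => trivial

theorem writeOnly_code {L : Type} {r : Fin 5} {P : Prog} (h : P.WriteOnly r) (emb : Lab M P → L)
    (next : L) (l : Lab M P) : WriteOnly (Sum.inl r) (code P emb next l) := by
  induction P generalizing next with
  | push => trivial
  | pop r' => exact ⟨by simpa [Prog.WriteOnly] using h, trivial⟩
  | seq P Q ihP ihQ =>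
    rcases l with l | l
    · exact ihP h.1 _ _ _
    · exact ihQ h.2 _ _ _
  | ite r' p P Q ihP ihQ =>
    rcases l with _ | l | l
    · exact ⟨by simpa using h.1, trivial, trivial⟩
    · exact ihP h.2.1 _ _ _
    · exact ihQ h.2.2 _ _ _
  | loop r' p P ih =>
    rcases l with _ | l
    · exact ⟨by simpa using h.1, trivial, trivial⟩
    · exact ih h.2 _ _ _
  | call i r₁ r₂ =>
    rcases l with _ | _ | l
    · exact ⟨by simpa [Prog.WriteOnly] using h, trivial, trivial⟩
    · exact ⟨by simp, trivial, trivial⟩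
    · exact writeOnly_liftStmt _ _ _ _ _

end Space

/-- Runs of a transition function `F` on the states `Y`, where a state comes with the order to halt
(`none`), to go on without output (`some none`), or to write a bit. `Yields F B s w s'` means that
`w` is written on the way from `s` to `s'`, all states on the way satisfying `B`. -/
inductive Yields {Y : Type} (F : Y → Option (Option Bool) × Y) (B : Y → Prop) :
    Option (Option Bool) × Y → List Bool → Option (Option Bool) × Y → Prop
  | refl {s} : B s.2 → Yields F B s [] s
  | step {y o w s'} : B y → Yields F B (F y) w s' → Yields F B (some o, y) (o.toList ++ w) s'

theorem Yields.trans {Y : Type} {F : Y → Option (Option Bool) × Y} {B : Y → Prop} {s s' s'' w w'}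
    (h : Yields F B s w s') (h' : Yields F B s' w' s'') : Yields F B s (w ++ w') s'' := by
  induction h with
  | refl => exact h'
  | step hB _ ih => rw [List.append_assoc]; exact .step hB (ih h')

theorem Yields.left {Y : Type} {F : Y → Option (Option Bool) × Y} {B : Y → Prop} {s s' w}
    (h : Yields F B s w s') : B s.2 := by
  cases h <;> assumption

theorem Yields.right {Y : Type} {F : Y → Option (Option Bool) × Y} {B : Y → Prop} {s s' w}
    (h : Yields F B s w s') : B s'.2 := by
  induction h with
  | refl h => exact h
  | step _ _ ih => exact ih

/-- The tree of a pair of an order and a state. -/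
def orderTree : Option (Option Bool) → Tree
  | none => .nil
  | some none => .node .nil .nil
  | some (some b) => .node (.node (.ofBool b) .nil) .nil

theorem size_orderTree_le (o : Option (Option Bool)) : (orderTree o).size ≤ 7 := by
  rcases o with _ | _ | _ | _ <;> decide

/-- Write the bit ordered by the state in register `0`, whose first bit is missing, and apply the
transition function to the state. -/
def Prog.spaceBody : Prog :=
  .seq (.pop 0) (.seq
    (.ite 0 (· == some true)
      (.seq (.pop 0) (.seq (.ite 0 (· == some true) (.push 4 true) (.push 4 false)) (.push 0 true)))
      (.seq (.pop 0) (.push 0 false)))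
    (.seq (.push 0 true) (.seq (.push 0 true)
      (.seq (.move 0 1) (.seq (.call true 1 2) (.seq (.move 2 0) (.pop 0)))))))

theorem Exec.spaceBody {A N : Box} (o : Option Bool) {t t' : Tree} {x : List Bool}
    {c : Option (Option Bool)} {k : ℕ}
    (h : A.Outputs (Tree.node (orderTree (some o)) t).ser (Tree.node (orderTree c) t').ser k) :
    Exec (boxes A N) .spaceBody ![(orderTree (some o)).ser ++ t.ser, [], [], [], x]
      ![(orderTree c).ser ++ t'.ser, [], [], [], o.toList ++ x]
      (5 * (t.size + t'.size) + k + 100) := by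
  -- Second half of the body: the first push restores the root bit of the order and the second adds
  -- the node bit of the pair; the last `pop` removes the node bit of the new pair.
  have h' : Exec (boxes A N) (.seq (.push 0 true) (.seq (.push 0 true)
      (.seq (.move 0 1) (.seq (.call true 1 2) (.seq (.move 2 0) (.pop 0))))))
      ![((orderTree (some o)).ser ++ t.ser).tail, [], [], [], o.toList ++ x]
      ![(orderTree c).ser ++ t'.ser, [], [], [], o.toList ++ x]
      (5 * (t.size + t'.size) + k + 90) := by
    have h₁ := size_orderTree_le (some o)
    have h₂ := size_orderTree_le c
    have h₃ : (Tree.node (orderTree (some o)) t).ser.length = (orderTree (some o)).size + t.size + 1 :=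
      Tree.size_node _ _
    have h₄ : (Tree.node (orderTree c) t').ser.length = (orderTree c).size + t'.size + 1 :=
      Tree.size_node _ _
    refine Exec.mono (T := 1 + (1 + ((4 * (Tree.node (orderTree (some o)) t).ser.length + 1) +
      (((Tree.node (orderTree (some o)) t).ser.length + k + (Tree.node (orderTree c) t').ser.length
        + 2) + ((4 * (Tree.node (orderTree c) t').ser.length + 1) + 1))))) ?_ (by omega)
    refine .seq (R' := ![(orderTree (some o)).ser ++ t.ser, [], [], [], o.toList ++ x])
      (.push ?_) (.seq (R' := ![(Tree.node (orderTree (some o)) t).ser, [], [], [], o.toList ++ x])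
      (.push (by simp [Tree.ser]))
      (.seq (R' := ![[], (Tree.node (orderTree (some o)) t).ser.reverse, [], [], o.toList ++ x])
        (.move (by decide) (by simp) (by simp))
      (.seq (R' := ![[], [], (Tree.node (orderTree c) t').ser.reverse, [], o.toList ++ x])
        (.call rfl h (by simp) le_rfl)
      (.seq (R' := ![(Tree.node (orderTree c) t').ser, [], [], [], o.toList ++ x])
        (.move (by decide) (by simp) (by simp)) (.pop (by simp [Tree.ser]))))))
    rcases o with _ | _ | _ <;> simp [orderTree, Tree.ser]
  -- First half of the body: the bits of the order are inspected to write on register `4`, and those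
  -- removed are put back.
  have key : Exec (boxes A N) (.ite 0 (· == some true)
      (.seq (.pop 0) (.seq (.ite 0 (· == some true) (.push 4 true) (.push 4 false)) (.push 0 true)))
      (.seq (.pop 0) (.push 0 false)))
      ![((orderTree (some o)).ser ++ t.ser).tail, [], [], [], x]
      ![((orderTree (some o)).ser ++ t.ser).tail, [], [], [], o.toList ++ x] 5 := by
    rcases o with _ | b
    · exact (Exec.ite_false rfl (.seq (R' := ![false :: t.ser, [], [], [], x])
        (.pop (by simp [orderTree, Tree.ser])) (.push (by simp [orderTree, Tree.ser])))).mono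
        (by omega)
    · refine (Exec.ite_true rfl (.seq
        (R' := ![(Tree.ofBool b).ser ++ false :: false :: t.ser, [], [], [], x])
        (.pop (by simp [orderTree, Tree.ser])) (.seq (T := 2)
        (R' := ![(Tree.ofBool b).ser ++ false :: false :: t.ser, [], [], [], b :: x]) ?_
        (.push (by simp [orderTree, Tree.ser]))))).mono le_rfl
      cases b
      · exact Exec.ite_false rfl (.push (by simp))
      · exact Exec.ite_true rfl (.push (by simp))
  refine (Exec.seq (.pop (R' := ![((orderTree (some o)).ser ++ t.ser).tail, [], [], [], x])
    (by simp)) (.seq key h')).mono (by omega)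

/-- Each round is one polynomial-time call on a state of polynomial size, so the space used within a
round is polynomial and does not accumulate. The number of rounds is irrelevant, and the output
register is only pushed to. -/
theorem FPSPACE.of_yields {Y : Type} {r : Y → Tree} {F : Y → Option (Option Bool) × Y}
    (hF : PolyOn (fun y => (r y).ser) fun y => (Tree.node (orderTree (F y).1) (r (F y).2)).ser)
    {init : List Bool → Y}
    (hi : PolyOn id fun x => (Tree.node (orderTree (some none)) (r (init x))).ser)
    {f : List Bool → List Bool}
    (h : ∃ d, ∀ x, ∃ y', Yields F (fun y => (r y).size ≤ (x.length + 2) ^ d)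
      (some none, init x) (f x) (none, y')) : FPSPACE f := by
  obtain ⟨d, hd⟩ := h
  -- The loop hands over the order together with the state; the transition function ignores it.
  have hF' : PolyOn (fun s : Option (Option Bool) × Y => (Tree.node (orderTree s.1) (r s.2)).ser)
      fun s => (Tree.node (orderTree (F s.2).1) (r (F s.2).2)).ser := by
    refine (PolyOn.snd (fun s : Option (Option Bool) × Y => orderTree s.1)
      fun s => (r s.2).ser).comp ?_
    obtain ⟨A, c, hA⟩ := hF
    exact ⟨A, c, fun s => hA s.2⟩
  obtain ⟨A, c, hA⟩ := hF'
  obtain ⟨I, e, hI⟩ := hi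
  let M := boxes A I
  let P : Prog := .seq (.seq (.move 0 1) (.seq (.call false 1 2) (.seq (.move 2 0) (.pop 0))))
    (.seq (.loop 0 (· == some true) .spaceBody) (.clear 0))
  have := (P.machine M 4).ΛFin
  obtain ⟨C, hC⟩ := exists_pushes_le (P.machine M 4).m
  -- `S` bounds the registers between rounds, `T` the time of a single round, and `N = S + C * T`
  -- the space at every moment.
  let S : List Bool → ℕ := fun x => x.length + (x.length + 2) ^ d + 10
  let T : List Bool → ℕ := fun x => 30 * S x + (S x + 2) ^ c + (x.length + 2) ^ e + 1000
  let N : List Bool → ℕ := fun x => S x + C * T x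
  have hN : PolyBd (fun x : List Bool => x.length) N := by
    have hc := PolyBd.const fun x : List Bool => x.length
    have hS : PolyBd (fun x : List Bool => x.length) S :=
      ((PolyBd.self _).add ⟨d, fun _ => le_rfl⟩).add (hc 10)
    exact hS.add ((hc C).mul (((((hc 30).mul hS).add (hS.trans ⟨c, fun _ => le_rfl⟩)).add
      ⟨e, fun _ => le_rfl⟩).add (hc 1000)))
  obtain ⟨p, hp⟩ := hN
  have hvec : ∀ (x y z : List Bool) (r : Fin 5) (n : ℕ), x.length ≤ n → r ≠ 4 →
      ((![x, [], [], [], z] : Fin 5 → List Bool) r).length ≤ n := by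
    intro x y z r n hx hr
    fin_cases r
    · exact hx
    · exact Nat.zero_le _
    · exact Nat.zero_le _
    · exact Nat.zero_le _
    · exact absurd rfl hr
  have loop : ∀ (x : List Bool) (s s' : Option (Option Bool) × Y) (w z : List Bool),
      Yields F (fun y => (r y).size ≤ (x.length + 2) ^ d) s w s' → s'.1 = none →
      ExecShort M C (N x) (.loop 0 (· == some true) .spaceBody)
        ![(orderTree s.1).ser ++ (r s.2).ser, [], [], [], z]
        ![(orderTree s'.1).ser ++ (r s'.2).ser, [], [], [], w.reverse ++ z] := by
    intro x s s' w z h hs'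
    have hlen : ∀ s : Option (Option Bool) × Y, (r s.2).size ≤ (x.length + 2) ^ d →
        ((orderTree s.1).ser ++ (r s.2).ser).length ≤ S x := by
      intro s hs
      have := size_orderTree_le s.1
      rw [List.length_append]
      change (orderTree s.1).size + (r s.2).size ≤ x.length + (x.length + 2) ^ d + 10
      omega
    induction h generalizing z with
    | @refl s hB =>
      refine .loop_false (fun r hr => hvec _ [] _ r _ ((hlen _ hB).trans (by simp [N])) hr) ?_
      rw [hs']
      rfl
    | @step y o w s' hB hy ih =>
      have hB' : (r (F y).2).size ≤ (x.length + 2) ^ d := hy.left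
      obtain ⟨t, ht, hA⟩ := hA (some o, y)
      have ht : t ≤ (S x + 2) ^ c := by
        refine ht.trans (Nat.pow_le_pow_left (Nat.add_le_add_right ?_ 2) _)
        change ((orderTree (some o)).node (r y)).size ≤ x.length + (x.length + 2) ^ d + 10
        have := size_orderTree_le (some o)
        rw [Tree.size_node]
        omega
      have h₁ := Exec.spaceBody (N := I) (x := z) o hA
      have h₂ := ih (o.toList ++ z) hs'
      refine .loop_true (fun r hr => hvec _ [] _ r _ ((hlen (some o, y) hB).trans (by simp [N])) hr)
        ?_ (h₁.short (S := S x) (fun r hr => hvec _ [] _ r _ (hlen (some o, y) hB) hr)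
          (Nat.add_le_add_left (Nat.mul_le_mul_left _ ?_) _)) ?_
      · rcases o with _ | b <;> rfl
      · dsimp only [T, S] at ht ⊢
        omega
      · convert h₂ using 1
        rcases o with _ | b <;> simp
  refine ⟨P.machine M 4, Equiv.refl Bool, Equiv.refl Bool, (Polynomial.X + 2) ^ p, ?_, ?_, ?_⟩
  · exact fun h => absurd (Sum.inl.inj h) (by decide)
  · rintro (_ | l)
    · trivial
    · exact writeOnly_code (by simp [P, Prog.WriteOnly, Prog.spaceBody, Prog.move, Prog.clear]) _ _ _
  · intro x
    obtain ⟨y', hy⟩ := hd x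
    have hB : (r (init x)).size ≤ (x.length + 2) ^ d := hy.left
    have hB' : (r y').size ≤ (x.length + 2) ^ d := hy.right
    obtain ⟨t, ht, hI⟩ := hI x
    have hsz : (Tree.node (orderTree (some none)) (r (init x))).ser.length =
      3 + (r (init x)).size + 1 := Tree.size_node _ _
    have h₁ : Exec M (.seq (.move 0 1) (.seq (.call false 1 2) (.seq (.move 2 0) (.pop 0))))
        ![x, [], [], [], []] ![(orderTree (some none)).ser ++ (r (init x)).ser, [], [], [], []]
        (T x) := by
      refine (Exec.seq (R' := ![[], x.reverse, [], [], []])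
        (.move (by decide) (by simp) le_rfl)
        (.seq (R' := ![[], [], (Tree.node (orderTree (some none)) (r (init x))).ser.reverse, [], []])
          (.call rfl hI (by simp) le_rfl)
        (.seq (R' := ![(Tree.node (orderTree (some none)) (r (init x))).ser, [], [], [], []])
          (.move (by decide) (by simp) (T := 4 * (4 + (r (init x)).size) + 1)
            (by simp [hsz])) (.pop (by simp [Tree.ser]))))).mono ?_
      change (4 * x.length + 1) + ((x.length + t + _ + 2) + _) ≤ _
      rw [hsz]
      simp only [id_eq] at ht
      dsimp only [T, S]
      omega
    have h₃ : Exec M (.clear 0) ![(r y').ser.cons false, [], [], [], (f x).reverse]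
        ![[], [], [], [], (f x).reverse] (T x) := by
      refine .clear (by simp) ?_
      change 2 * ((r y').size + 1) + 1 ≤ _
      dsimp only [T, S]
      omega
    have hS : x.length ≤ S x := by dsimp only [S]; omega
    have hall := ExecShort.seq
      (h₁.short (S := S x) (C := C) (N := N x) (fun r hr => hvec _ [] _ r _ hS hr) le_rfl)
      (.seq (R' := ![(r y').ser.cons false, [], [], [], (f x).reverse])
        (by simpa [orderTree, Tree.ser] using loop x _ _ _ [] hy rfl)
        (h₃.short (S := S x) (C := C) (N := N x) (fun k hk => hvec _ [] _ k _ (by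
          change (r y').size + 1 ≤ _; dsimp only [S]; omega) hk) le_rfl))
    obtain ⟨t, o, hrun⟩ := hall (Option (Lab M P)) (P.machine M 4).m some none hC (fun _ => rfl) none
    have hrun' : Run (P.machine M 4).step (fun c => Short (N x) c.stk) (t + 1)
        (idle (some (entry M P)) none ![x, [], [], [], []])
        ⟨none, (none, V₀ M), mk ![[], [], [], [], (f x).reverse] fun _ _ => []⟩ := by
      refine hrun.trans (.head hrun.right rfl (.refl hrun.right))
    have e₁ : initList (P.machine M 4) x = idle (some (entry M P)) none ![x, [], [], [], []] :=
      congrArg (TM2.Cfg.mk _ _) ((initList_stk (P.machine M 4) x).trans (mk_reg₀ x))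
    have e₂ : haltList (P.machine M 4) (f x).reverse =
        ⟨none, (none, V₀ M), mk ![[], [], [], [], (f x).reverse] fun _ _ => []⟩ := by
      refine congrArg (TM2.Cfg.mk _ _) ((haltList_stk (P.machine M 4) (f x).reverse).trans ?_)
      funext k
      rcases k with r | p
      · fin_cases r <;> rfl
      · rfl
    have e₃ := (congrArg (initList (P.machine M 4)) (List.map_id x)).trans e₁
    have e₄ := (congrArg (haltList (P.machine M 4)) (List.map_id (f x).reverse)).trans e₂
    have hfin := (hrun'.congr rfl e₄.symm).congr_left e₃.symm
    refine ⟨⟨⟨t + 1, hfin.iterate⟩⟩, fun c hc k hk => ?_⟩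
    have := hfin.invariant_of_reaches (c := c) rfl hc k hk
    exact this.trans ((hp x).trans (by simp))

end Nexus

/-! ### A calculus of polynomial-time functions between encoded types -/

namespace Nexus

/-! ### Types encoded by trees, and functions computable in polynomial time -/

/-- An injective encoding by trees. -/
class Enc (α : Type) where
  tr : α → Tree
  inj : Function.Injective tr

/-- The size of the code. -/
def sz {α : Type} [Enc α] (a : α) : ℕ := (Enc.tr a).size

/-- The functions computable in polynomial time. -/
@[fun_prop] def PT {α β : Type} [Enc α] [Enc β] (f : α → β) : Prop :=
  PolyOn (fun a => (Enc.tr a).ser) fun a => (Enc.tr (f a)).ser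

instance : Enc Tree := ⟨id, Function.injective_id⟩

instance {α β : Type} [Enc α] [Enc β] : Enc (α × β) where
  tr p := .node (Enc.tr p.1) (Enc.tr p.2)
  inj p q h := by
    injection h with h₁ h₂
    exact Prod.ext (Enc.inj h₁) (Enc.inj h₂)

instance : Enc Bool where
  tr := Tree.ofBool
  inj a b h := by cases a <;> cases b <;> simp_all [Tree.ofBool]

instance {α : Type} [Enc α] : Enc (List α) where
  tr := Tree.ofList Enc.tr
  inj l := by
    induction l with
    | nil => intro m h; cases m <;> simp_all [Tree.ofList]
    | cons a l ih =>
      intro m h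
      cases m with
      | nil => simp [Tree.ofList] at h
      | cons b m =>
        simp only [Tree.ofList, Tree.node.injEq] at h
        rw [Enc.inj h.1, ih h.2]

/-- The number with the given bits. -/
def ofBits (l : List Bool) : ℕ := l.foldr Nat.bit 0

@[simp] theorem ofBits_bits (n : ℕ) : ofBits n.bits = n := by
  induction n using Nat.binaryRec' with
  | zero => rfl
  | bit b n h ih =>
    rw [Nat.bits_append_bit n b h]
    simp only [ofBits, List.foldr_cons] at *
    rw [ih]

instance : Enc ℕ where
  tr n := Enc.tr n.bits
  inj m n h := by
    have := Enc.inj h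
    rw [← ofBits_bits m, this, ofBits_bits]

section

variable {α β γ : Type} [Enc α] [Enc β] [Enc γ]

theorem sz_pos (a : α) : 0 < sz a := Tree.size_pos _

@[simp] theorem sz_pair (a : α) (b : β) : sz (a, b) = sz a + sz b + 1 := Tree.size_node _ _

@[simp] theorem sz_nil : sz ([] : List α) = 1 := rfl

@[simp] theorem sz_cons (a : α) (l : List α) : sz (a :: l) = sz a + sz l + 1 := Tree.size_node _ _

theorem sz_append (l m : List α) : sz (l ++ m) + 1 = sz l + sz m := by
  induction l with
  | nil => simp; omega
  | cons a l ih => simp; omega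

theorem sz_reverse (l : List α) : sz l.reverse = sz l := by
  induction l with
  | nil => rfl
  | cons a l ih =>
    have := sz_append l.reverse [a]
    simp only [sz_cons, sz_nil, List.reverse_cons] at *
    omega

theorem sz_bool (b : Bool) : sz b ≤ 3 := by cases b <;> decide

theorem length_le_sz (l : List α) : l.length ≤ sz l := by
  induction l with
  | nil => simp
  | cons a l ih => simp; omega

theorem sz_le_of_mem {a : α} {l : List α} (h : a ∈ l) : sz a ≤ sz l := by
  induction l with
  | nil => simp at h
  | cons b l ih =>
    rcases List.mem_cons.1 h with rfl | h
    · simp; omega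
    · have := ih h; simp; omega

theorem sz_le_of_prefix {l m : List α} (h : l <+: m) : sz l ≤ sz m := by
  obtain ⟨k, rfl⟩ := h
  have := sz_append l k
  have := sz_pos k
  omega

theorem sz_le_of_sublist {l m : List α} (h : l.Sublist m) : sz l ≤ sz m := by
  induction h with
  | slnil => rfl
  | cons a _ ih => simp; omega
  | cons_cons a _ ih => simp; omega

theorem PT.polyBd {f : α → β} (hf : PT f) : PolyBd (fun a : α => sz a) fun a => sz (f a) :=
  PolyOn.polyBd hf

@[fun_prop] theorem PT.id : PT (fun a : α => a) := PolyOn.id _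

@[fun_prop] theorem PT.comp {g : β → γ} {f : α → β} (hg : PT g) (hf : PT f) :
    PT fun a => g (f a) := by
  obtain ⟨M, c, h⟩ := hg
  exact PolyOn.comp hf ⟨M, c, fun a => h (f a)⟩

theorem PolyOn.tree {A : Type} {x : A → List Bool} (t : Tree) : PolyOn x fun _ => t.ser := by
  induction t with
  | nil => exact .nil x
  | node l r ihl ihr => exact ihl.append ihr

@[fun_prop] theorem PT.const (b : β) : PT fun _ : α => b := PolyOn.tree _

@[fun_prop] theorem PT.pair {f : α → β} {g : α → γ} (hf : PT f) (hg : PT g) :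
    PT fun a => (f a, g a) := PolyOn.append hf hg

theorem PT.fst' : PT fun p : α × β => p.1 := PolyOn.fst (fun p : α × β => Enc.tr p.1) _

theorem PT.snd' : PT fun p : α × β => p.2 :=
  PolyOn.snd (fun p : α × β => Enc.tr p.1) fun p => (Enc.tr p.2).ser

@[fun_prop] theorem PT.fst {f : α → β × γ} (hf : PT f) : PT fun a => (f a).1 := PT.fst'.comp hf

@[fun_prop] theorem PT.snd {f : α → β × γ} (hf : PT f) : PT fun a => (f a).2 := PT.snd'.comp hf

theorem PT.of_tr {f : α → β} {g : α → γ} (hg : PT g) (h : ∀ a, Enc.tr (f a) = Enc.tr (g a)) :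
    PT f := by
  change PolyOn _ fun a => (Enc.tr (f a)).ser
  simp only [h]
  exact hg

theorem PolyOn.reindex {A B : Type} {x y : A → List Bool} (h : PolyOn x y) (φ : B → A) :
    PolyOn (fun b => x (φ b)) fun b => y (φ b) := by
  obtain ⟨M, c, h⟩ := h
  exact ⟨M, c, fun b => h (φ b)⟩

@[fun_prop] theorem PT.cond {b : α → Bool} {f g : α → β} (hb : PT b) (hf : PT f) (hg : PT g) :
    PT fun a => bif b a then f a else g a := by
  refine PolyOn.branch (fun a => Enc.tr (b a)) hb ?_ ?_
  · convert hf.reindex (fun a : {a // Enc.tr (b a) ≠ .nil} => a.1) using 5 with a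
    rcases a with ⟨a, h⟩
    cases hb : b a
    · simp [Enc.tr, hb, Tree.ofBool] at h
    · simp [hb]
  · convert hg.reindex (fun a : {a // Enc.tr (b a) = .nil} => a.1) using 5 with a
    rcases a with ⟨a, h⟩
    cases hb : b a
    · simp [hb]
    · simp [Enc.tr, hb, Tree.ofBool] at h

/-- Case distinction for trees. -/
def Tree.case {γ : Type} (t : Tree) (n : γ) (c : Tree → Tree → γ) : γ :=
  match t with
  | nil => n
  | node l r => c l r

@[fun_prop] theorem PT.case {t : α → Tree} {n : α → γ} {c : α → Tree → Tree → γ} (ht : PT t)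
    (hn : PT n) (hc : PT fun p : α × Tree × Tree => c p.1 p.2.1 p.2.2) :
    PT fun a => (t a).case (n a) (c a) := by
  refine PolyOn.branch t ht ?_ ?_
  · have h : ∀ a : {a // t a ≠ .nil}, ∃ p : Tree × Tree, t a = .node p.1 p.2 := by
      rintro ⟨a, h⟩
      cases hb : t a with
      | nil => exact absurd hb h
      | node l r => exact ⟨(l, r), rfl⟩
    choose p hp using h
    have h₁ := (PT.id.pair ht).reindex fun a : {a // t a ≠ .nil} => a.1
    -- A tree `node l r` and the pair `(l, r)` have the same code, so taking the tree apart requires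
    -- no computation.
    have h₂ := PolyOn.reindex hc fun a : {a // t a ≠ .nil} => (a.1, p a)
    refine h₁.comp ?_
    convert h₂ using 4 with a a
    · dsimp only; rw [hp]; rfl
    · dsimp only; rw [hp]; rfl
  · convert hn.reindex (fun a : {a // t a = .nil} => a.1) using 4 with a
    dsimp only
    rw [a.2]
    rfl

/-- Case distinction for lists. -/
def lcase {β γ : Type} (l : List β) (n : γ) (c : β → List β → γ) : γ :=
  match l with
  | [] => n
  | b :: l => c b l

@[fun_prop] theorem PT.lcase {l : α → List β} {n : α → γ} {c : α → β → List β → γ} (hl : PT l)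
    (hn : PT n) (hc : PT fun p : α × β × List β => c p.1 p.2.1 p.2.2) :
    PT fun a => lcase (l a) (n a) (c a) := by
  refine PolyOn.branch (fun a => Enc.tr (l a)) hl ?_ ?_
  · have h : ∀ a : {a // Enc.tr (l a) ≠ .nil}, ∃ p : β × List β, l a = p.1 :: p.2 := by
      rintro ⟨a, h⟩
      cases hb : l a with
      | nil => rw [hb] at h; exact absurd rfl h
      | cons b l => exact ⟨(b, l), rfl⟩
    choose p hp using h
    have h₁ := (PT.id.pair hl).reindex fun a : {a // Enc.tr (l a) ≠ .nil} => a.1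
    -- A nonempty list has the same code as the pair of its head and tail.
    have h₂ := PolyOn.reindex hc fun a : {a // Enc.tr (l a) ≠ .nil} => (a.1, p a)
    refine h₁.comp ?_
    convert h₂ using 4 with a a
    · dsimp only; rw [hp]; rfl
    · dsimp only; rw [hp]; rfl
  · convert hn.reindex (fun a : {a // Enc.tr (l a) = .nil} => a.1) using 4 with a
    rcases a with ⟨a, h⟩
    cases hb : l a with
    | nil => simp [hb, Nexus.lcase]
    | cons b l => rw [hb] at h; exact absurd h (by simp [Enc.tr, Tree.ofList])

@[fun_prop] theorem PT.cons {f : α → β} {g : α → List β} (hf : PT f) (hg : PT g) :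
    PT fun a => f a :: g a := (hf.pair hg).of_tr fun _ => rfl

@[fun_prop] theorem PT.and {f g : α → Bool} (hf : PT f) (hg : PT g) : PT fun a => f a && g a := by
  have : PT fun a => bif f a then g a else false := by fun_prop
  convert this using 2 with a
  cases f a <;> rfl

@[fun_prop] theorem PT.or {f g : α → Bool} (hf : PT f) (hg : PT g) : PT fun a => f a || g a := by
  have : PT fun a => bif f a then true else g a := by fun_prop
  convert this using 2 with a
  cases f a <;> rfl

@[fun_prop] theorem PT.not {f : α → Bool} (hf : PT f) : PT fun a => !f a := by
  have : PT fun a => bif f a then false else true := by fun_prop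
  convert this using 2 with a
  cases f a <;> rfl

theorem PT.iterate {σ τ : Type} [Enc σ] [Enc τ] {step : σ × τ → σ × τ} (hs : PT step)
    {init : α → σ × τ} (hi : PT init) (n : α → ℕ)
    (hle : ∀ a, sz a ≤ sz (init a))
    (hn : PolyBd (fun a : α => sz a) n)
    (hsz : ∃ c, ∀ a, ∀ k ≤ n a, sz (step^[k] (init a)) ≤ (sz a + 2) ^ c)
    (hlt : ∀ a, ∀ k < n a, Enc.tr (step^[k] (init a)).1 ≠ .nil)
    (heq : ∀ a, Enc.tr (step^[n a] (init a)).1 = .nil) :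
    PT fun a => step^[n a] (init a) := by
  refine PolyOn.comp hi (PolyOn.iterate (l := fun s : σ × τ => Enc.tr s.1)
    (r := fun s : σ × τ => Enc.tr s.2) hs init n (hn.mono_left hle) ?_ hlt heq)
  obtain ⟨c, hc⟩ := hsz
  exact ⟨c, fun a k hk => (hc a k hk).trans
    (Nat.pow_le_pow_left (Nat.add_le_add_right (hle a) _) _)⟩

/-- The fold is an iteration that carries the parameter `a` in its state and ends when the list is
used up. Intermediate values could grow exponentially, so a polynomial bound along all prefixes has
to be supplied. -/
theorem PT.foldl {l : α → List β} {s : α → γ} {g : α → γ → β → γ} (hl : PT l) (hs : PT s)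
    (hg : PT fun p : α × γ × β => g p.1 p.2.1 p.2.2)
    (hb : ∃ f, PolyBd (fun a : α => sz a) f ∧
      ∀ a l', l' <+: l a → sz (l'.foldl (g a) (s a)) ≤ f a) :
    PT fun a => (l a).foldl (g a) (s a) := by
  let step : List β × α × γ → List β × α × γ := fun p =>
    Nexus.lcase p.1 p fun b l => (l, p.2.1, g p.2.1 p.2.2 b)
  have hstep : PT step := by unfold step; fun_prop
  have hit : ∀ a k, k ≤ (l a).length → step^[k] (l a, a, s a) =
      ((l a).drop k, a, ((l a).take k).foldl (g a) (s a)) := by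
    intro a k hk
    induction k with
    | zero => simp
    | succ k ih =>
      rw [Function.iterate_succ_apply', ih (by omega), List.drop_eq_getElem_cons hk,
        List.take_succ_eq_append_getElem hk, List.foldl_append]
      rfl
  have h : PT fun a => step^[(l a).length] (l a, a, s a) := by
    refine PT.iterate hstep (init := fun a => (l a, a, s a)) (by fun_prop) _
      (fun a => by simp; omega) (hl.polyBd.of_le fun a => length_le_sz _) ?_ ?_ ?_
    · obtain ⟨f, hf, hb⟩ := hb
      refine ((((hl.polyBd.add (.self _)).add hf).add (.const _ 2))).imp
        fun c hc a k hk => le_trans ?_ (hc a)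
      rw [hit a k hk]
      have h₁ := hb a _ (List.take_prefix k (l a))
      have h₂ := sz_le_of_sublist (List.drop_sublist k (l a))
      simp only [sz_pair]
      omega
    · intro a k hk
      rw [hit a k hk.le, List.drop_eq_getElem_cons hk]
      simp [Enc.tr, Tree.ofList]
    · intro a
      rw [hit a _ le_rfl, List.drop_length]
      rfl
  have h' : PT fun a => (step^[(l a).length] (l a, a, s a)).2.2 := by fun_prop
  convert h' using 2 with a
  rw [hit a _ le_rfl, List.take_length]

@[fun_prop] theorem PT.reverse {l : α → List β} (hl : PT l) : PT fun a => (l a).reverse := by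
  have h : ∀ l m : List β, l.foldl (fun acc b => b :: acc) m = l.reverse ++ m := by
    intro l
    induction l with
    | nil => simp
    | cons b l ih => simp [ih]
  have : PT fun a => (l a).foldl (fun acc b => b :: acc) [] := by
    refine PT.foldl hl (by fun_prop) (by fun_prop) ⟨_, hl.polyBd, fun a l' h' => ?_⟩
    rw [h, List.append_nil, sz_reverse]
    exact sz_le_of_prefix h'
  simpa [h] using this

@[fun_prop] theorem PT.append {l m : α → List β} (hl : PT l) (hm : PT m) :
    PT fun a => l a ++ m a := by
  have h : ∀ l m : List β, l.foldl (fun acc b => b :: acc) m = l.reverse ++ m := by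
    intro l
    induction l with
    | nil => simp
    | cons b l ih => simp [ih]
  have : PT fun a => (l a).reverse.foldl (fun acc b => b :: acc) (m a) := by
    refine PT.foldl (by fun_prop) (by fun_prop) (by fun_prop)
      ⟨_, hl.polyBd.add hm.polyBd, fun a l' h' => ?_⟩
    have h₁ := sz_le_of_prefix h'
    have h₂ := sz_append l'.reverse (m a)
    rw [h]
    rw [sz_reverse] at *
    omega
  simpa [h] using this

@[fun_prop] theorem PT.flatMap {l : α → List β} {f : α → β → List γ} (hl : PT l)
    (hf : PT fun p : α × β => f p.1 p.2) : PT fun a => (l a).flatMap (f a) := by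
  have h : ∀ (f : β → List γ) (l : List β) (m : List γ),
      l.foldl (fun acc b => acc ++ f b) m = m ++ l.flatMap f := by
    intro f l
    induction l with
    | nil => simp
    | cons b l ih => simp [ih]
  have : PT fun a => (l a).foldl (fun acc b => acc ++ f a b) [] := by
    obtain ⟨c, hc⟩ := hf.polyBd
    have hp : PolyBd (fun a : α => sz a) fun a => (sz a + sz (l a) + 3) ^ c :=
      (((PolyBd.self _).add hl.polyBd).add (.const _ 3)).pow c
    refine PT.foldl hl (by fun_prop) (by fun_prop)
      ⟨_, (hl.polyBd.mul hp).add (.const _ 1), fun a l' h' => ?_⟩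
    rw [h, List.nil_append]
    have hlen : l'.length ≤ sz (l a) := h'.length_le.trans (length_le_sz _)
    refine le_trans ?_ (Nat.add_le_add_right (Nat.mul_le_mul_right _ hlen) _)
    have hmem : ∀ b ∈ l', b ∈ l a := fun b hb => h'.subset hb
    clear h' hlen
    induction l' with
    | nil => simp
    | cons b l' ih =>
      have h₁ := ih fun b hb => hmem b (List.mem_cons_of_mem _ hb)
      have h₂ := hc (a, b)
      have h₃ := sz_le_of_mem (hmem b List.mem_cons_self)
      have h₄ := sz_append (f a b) (l'.flatMap (f a))
      have h₅ : (sz (a, b) + 2) ^ c ≤ (sz a + sz (l a) + 3) ^ c :=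
        Nat.pow_le_pow_left (by simp; omega) _
      rw [List.flatMap_cons, List.length_cons, Nat.succ_mul]
      dsimp only at h₂
      omega
  simpa [h] using this

@[fun_prop] theorem PT.map {l : α → List β} {f : α → β → γ} (hl : PT l)
    (hf : PT fun p : α × β => f p.1 p.2) : PT fun a => (l a).map (f a) := by
  have : PT fun a => (l a).flatMap fun b => [f a b] := by fun_prop
  simpa [List.map_eq_flatMap] using this

@[fun_prop] theorem PT.filter {l : α → List β} {f : α → β → Bool} (hl : PT l)
    (hf : PT fun p : α × β => f p.1 p.2) : PT fun a => (l a).filter (f a) := by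
  have h : ∀ (f : β → Bool) (l : List β), l.filter f =
      l.flatMap fun b => bif f b then [b] else [] := by
    intro f l
    induction l with
    | nil => rfl
    | cons b l ih => cases hb : f b <;> simp [hb, ih]
  simp only [h]
  fun_prop

@[fun_prop] theorem PT.any {l : α → List β} {f : α → β → Bool} (hl : PT l)
    (hf : PT fun p : α × β => f p.1 p.2) : PT fun a => (l a).any (f a) := by
  have : PT fun a => Nexus.lcase ((l a).filter (f a)) false fun _ _ => true := by fun_prop
  convert this using 2 with a
  induction l a with
  | nil => rfl
  | cons b l ih =>
    cases hb : f a b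
    · simpa [hb] using ih
    · simp [hb, Nexus.lcase]

@[fun_prop] theorem PT.all {l : α → List β} {f : α → β → Bool} (hl : PT l)
    (hf : PT fun p : α × β => f p.1 p.2) : PT fun a => (l a).all (f a) := by
  have : PT fun a => !(l a).any fun b => !f a b := by fun_prop
  simpa [List.all_eq_not_any_not] using this

@[fun_prop] theorem PT.tail {l : α → List β} (hl : PT l) : PT fun a => (l a).tail := by
  have : PT fun a => Nexus.lcase (l a) [] fun _ m => m := by fun_prop
  convert this using 2 with a
  cases l a <;> rfl

@[fun_prop] theorem PT.headD {l : α → List β} {d : α → β} (hl : PT l) (hd : PT d) :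
    PT fun a => (l a).headD (d a) := by
  have : PT fun a => Nexus.lcase (l a) (d a) fun b _ => b := by fun_prop
  convert this using 2 with a
  cases l a <;> rfl

@[fun_prop] theorem PT.isEmpty {l : α → List β} (hl : PT l) : PT fun a => (l a).isEmpty := by
  have : PT fun a => Nexus.lcase (l a) true fun _ _ => false := by fun_prop
  convert this using 2 with a
  cases l a <;> rfl

/-! ### Equality -/

/-- One step of the comparison of pairs of trees. -/
def eqStep (s : List (Tree × Tree) × Bool) : List (Tree × Tree) × Bool :=
  Nexus.lcase s.1 s fun p w => p.1.case (p.2.case (w, s.2) fun _ _ => ([], false))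
    fun l r => p.2.case ([], false) fun l' r' => ((l, l') :: (r, r') :: w, s.2)

/-- The list is an agenda of pairs still to be compared. Each step removes a pair of leaves,
replaces a pair of nodes by the pairs of subtrees, or, at a mismatch, empties the agenda and clears
the flag. The total size of the left trees drops in every case. -/
theorem eqStep_iterate (N : ℕ) (w : List (Tree × Tree)) (b : Bool)
    (hN : (w.map fun p => sz p.1).sum ≤ N) :
    ∃ n ≤ N, ∃ b' : Bool, (∀ k < n, (eqStep^[k] (w, b)).1 ≠ []) ∧
      (∀ k ≤ n, sz (eqStep^[k] (w, b)) ≤ sz w + 4) ∧ eqStep^[n] (w, b) = ([], b') ∧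
      (b' = true ↔ b = true ∧ ∀ p ∈ w, p.1 = p.2) := by
  have hbool := sz_bool
  have hdone : ∀ (w : List (Tree × Tree)) (b : Bool), w ≠ [] → eqStep (w, b) = ([], false) →
      (¬ ∀ p ∈ w, p.1 = p.2) → ∀ N : ℕ, 1 ≤ N →
      ∃ n ≤ N, ∃ b' : Bool, (∀ k < n, (eqStep^[k] (w, b)).1 ≠ []) ∧
      (∀ k ≤ n, sz (eqStep^[k] (w, b)) ≤ sz w + 4) ∧ eqStep^[n] (w, b) = ([], b') ∧
      (b' = true ↔ b = true ∧ ∀ p ∈ w, p.1 = p.2) := by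
    intro w b hw hs hne N hN
    refine ⟨1, hN, false, ?_, ?_, hs, by simp only [hne, and_false, Bool.false_eq_true]⟩
    · intro k hk
      obtain rfl : k = 0 := by omega
      exact hw
    · intro k hk
      obtain rfl | rfl : k = 0 ∨ k = 1 := by omega
      · have := hbool b; simp; omega
      · have := hbool false
        have := sz_pos w
        rw [Function.iterate_one, hs]; simp; omega
  have hgo : ∀ (w w' : List (Tree × Tree)) (b : Bool), w ≠ [] → eqStep (w, b) = (w', b) →
      sz w' ≤ sz w → ((∀ p ∈ w', p.1 = p.2) ↔ ∀ p ∈ w, p.1 = p.2) → ∀ N : ℕ, 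
      (∃ n ≤ N, ∃ b' : Bool, (∀ k < n, (eqStep^[k] (w', b)).1 ≠ []) ∧
      (∀ k ≤ n, sz (eqStep^[k] (w', b)) ≤ sz w' + 4) ∧ eqStep^[n] (w', b) = ([], b') ∧
      (b' = true ↔ b = true ∧ ∀ p ∈ w', p.1 = p.2)) →
      ∃ n ≤ N + 1, ∃ b' : Bool, (∀ k < n, (eqStep^[k] (w, b)).1 ≠ []) ∧
      (∀ k ≤ n, sz (eqStep^[k] (w, b)) ≤ sz w + 4) ∧ eqStep^[n] (w, b) = ([], b') ∧
      (b' = true ↔ b = true ∧ ∀ p ∈ w, p.1 = p.2) := by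
    rintro w w' b hw hs hsz hiff N ⟨n, hn, b', h₁, h₂, h₃, h₄⟩
    refine ⟨n + 1, by omega, b', ?_, ?_, ?_, by rw [h₄, hiff]⟩
    · rintro (_ | k) hk
      · exact hw
      · rw [Function.iterate_succ_apply, hs]
        exact h₁ k (by omega)
    · rintro (_ | k) hk
      · have := hbool b; simp; omega
      · rw [Function.iterate_succ_apply, hs]
        exact (h₂ k (by omega)).trans (by omega)
    · rw [Function.iterate_succ_apply, hs, h₃]
  induction N generalizing w with
  | zero =>
    cases w with
    | nil =>
      refine ⟨0, le_rfl, b, by simp, ?_, rfl, by simp⟩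
      intro k hk
      obtain rfl : k = 0 := by omega
      have := hbool b; simp; omega
    | cons p w =>
      have := sz_pos p.1
      simp at hN
      omega
  | succ N ih =>
    cases w with
    | nil =>
      obtain ⟨n, hn, h⟩ := ih [] (by simp)
      exact ⟨n, by omega, h⟩
    | cons p w =>
      obtain ⟨t, t'⟩ := p
      simp only [List.map_cons, List.sum_cons] at hN
      cases t with
      | nil =>
        cases t' with
        | nil =>
          refine hgo _ w _ (by simp) rfl (by simp; omega) (by simp) _ (ih w ?_)
          have := sz_pos Tree.nil
          omega
        | node l' r' => exact hdone _ _ (by simp) rfl (by simp) _ (by omega)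
      | node l r =>
        cases t' with
        | nil => exact hdone _ _ (by simp) rfl (by simp) _ (by omega)
        | node l' r' =>
          have e : ∀ l r : Tree, sz (Tree.node l r) = sz l + sz r + 1 := Tree.size_node
          refine hgo _ ((l, l') :: (r, r') :: w) _ (by simp) rfl ?_ (by simp [and_assoc]) _
            (ih _ ?_)
          · simp [e]; omega
          · rw [e] at hN; simp; omega

theorem PT.exists_tree_eq : ∃ F : Tree × Tree → Bool, PT F ∧ ∀ p, F p = true ↔ p.1 = p.2 := by
  have h := fun p : Tree × Tree => eqStep_iterate _ [p] true le_rfl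
  choose n hn b h₁ h₂ h₃ h₄ using h
  refine ⟨b, ?_, fun p => by rw [h₄]; simp⟩
  have : PT fun p : Tree × Tree => (eqStep^[n p] ([p], true)).2 := by
    refine PT.snd (PT.iterate (step := eqStep) (by unfold eqStep; fun_prop)
      (init := fun p : Tree × Tree => ([p], true)) (by fun_prop) n (fun p => by simp; omega)
      ((PolyBd.self _).of_le fun p => (hn p).trans (by
        obtain ⟨p, q⟩ := p; simp; omega)) ?_
      (fun p k hk h => h₁ p k hk (Enc.inj h)) fun p => by rw [h₃]; rfl)
    obtain ⟨c, hc⟩ := (PolyBd.self fun p : Tree × Tree => sz p).add (.const _ 6)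
    exact ⟨c, fun p k hk => (h₂ p k hk).trans (le_trans (by simp) (hc p))⟩
  convert this using 2 with p
  rw [h₃]

-- Codes are injective, so a single comparison of trees decides equality in all encoded types.
@[fun_prop] theorem PT.decide_eq {f g : α → β} [∀ a, Decidable (f a = g a)] (hf : PT f)
    (hg : PT g) : PT fun a => decide (f a = g a) := by
  obtain ⟨F, hF, h⟩ := PT.exists_tree_eq
  have : PT fun a => F (Enc.tr (f a), Enc.tr (g a)) := by
    refine hF.comp ((hf.pair hg).of_tr fun a => rfl)
  convert this using 2 with a
  rw [Bool.eq_iff_iff, h]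
  simp [Enc.inj.eq_iff]

@[fun_prop] theorem PT.contains {l : α → List β} {f : α → β} [∀ a, Decidable (f a ∈ l a)]
    (hl : PT l) (hf : PT f) : PT fun a => decide (f a ∈ l a) := by
  classical
  have : PT fun a => (l a).any fun b => decide (b = f a) := by fun_prop
  convert this using 2 with a
  rw [Bool.eq_iff_iff]
  simp

/-! ### Numbers -/

@[fun_prop] theorem PT.bits {f : α → ℕ} (hf : PT f) : PT fun a => (f a).bits := hf.of_tr fun _ => rfl

theorem PT.of_bits {f : α → ℕ} (hf : PT fun a => (f a).bits) : PT f := hf.of_tr fun _ => rfl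

@[fun_prop] theorem PT.bit {b : α → Bool} {f : α → ℕ} (hb : PT b) (hf : PT f) :
    PT fun a => Nat.bit (b a) (f a) := by
  refine PT.of_bits ?_
  -- Prepending the bit is right except for `Nat.bit false 0 = 0`, which has no bits.
  have : PT fun a => bif (f a).bits.isEmpty && !b a then [] else b a :: (f a).bits := by fun_prop
  convert this using 2 with a
  by_cases h : f a = 0
  · rw [h]
    cases b a <;> rfl
  · have h' : (f a).bits ≠ [] := fun h' => h (by rw [← ofBits_bits (f a), h']; rfl)
    rw [Nat.bits_append_bit _ _ fun h'' => absurd h'' h]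
    cases hb : (f a).bits
    · exact absurd hb h'
    · simp

/-- Leading zeros of the number, at the end of the list, are lost; all other bits are kept. -/
theorem sz_ofBits_le (l : List Bool) : sz (ofBits l) ≤ sz l := by
  induction l with
  | nil => simp [ofBits, sz, Enc.tr, Tree.ofList]
  | cons b l ih =>
    change sz (Nat.bit b (ofBits l)) ≤ _
    by_cases h : ofBits l = 0
    · rw [h]
      have := sz_pos l
      cases b
      · change 1 ≤ _
        exact sz_pos _
      · rw [sz_cons]
        change 3 + 1 + 1 ≤ 3 + sz l + 1
        omega
    · change sz (Nat.bit b (ofBits l)).bits ≤ _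
      rw [Nat.bits_append_bit _ _ fun h'' => absurd h'' h, sz_cons, sz_cons]
      change _ + sz (ofBits l) + 1 ≤ _
      omega

@[fun_prop] theorem PT.ofBits {l : α → List Bool} (hl : PT l) : PT fun a => ofBits (l a) := by
  have : PT fun a => (l a).reverse.foldl (fun n b => Nat.bit b n) 0 := by
    refine PT.foldl (by fun_prop) (by fun_prop) (by fun_prop) ⟨_, hl.polyBd, fun a l' h => ?_⟩
    have := sz_ofBits_le l'.reverse
    rw [Nexus.ofBits, List.foldr_reverse, sz_reverse] at this
    exact this.trans ((sz_le_of_prefix h).trans (sz_reverse _).le)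
  simpa [Nexus.ofBits, List.foldl_reverse] using this

end

end Nexus

/-! ### Atoms, terms, and the codes used in the problem -/

namespace Nexus

/-! ### Atoms and terms -/

instance {T : Type} [Enc T] : Enc (Atom T) where
  tr a := Enc.tr (a.name, a.args)
  inj a b h := by
    have := Enc.inj h
    exact Atom.ext (congrArg Prod.fst this) (congrArg Prod.snd this)

instance : Enc Term where
  tr
    | .const c => Enc.tr (false, c)
    | .var s => Enc.tr (true, s)
  inj a b h := by
    cases a <;> cases b <;> change Tree.node _ _ = Tree.node _ _ at h <;> injection h with h₁ h₂
    · exact congrArg Term.const (Enc.inj h₂)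
    · cases h₁
    · cases h₁
    · exact congrArg Term.var (Enc.inj h₂)

section

variable {α β γ : Type} [Enc α] [Enc β] [Enc γ]

@[fun_prop] theorem PT.atomName {f : α → Atom β} (hf : PT f) : PT fun a => (f a).name :=
  PT.fst (f := fun a => ((f a).name, (f a).args)) (hf.of_tr fun _ => rfl)

@[fun_prop] theorem PT.atomArgs {f : α → Atom β} (hf : PT f) : PT fun a => (f a).args :=
  PT.snd (f := fun a => ((f a).name, (f a).args)) (hf.of_tr fun _ => rfl)

@[fun_prop] theorem PT.atomMk {f : α → ℕ} {g : α → List β} (hf : PT f) (hg : PT g) :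
    PT fun a => (⟨f a, g a⟩ : Atom β) := (hf.pair hg).of_tr fun _ => rfl

@[fun_prop] theorem PT.termConst {f : α → ℕ} (hf : PT f) : PT fun a => Term.const (f a) :=
  ((PT.const false).pair hf).of_tr fun _ => rfl

@[fun_prop] theorem PT.termVar {f : α → List ℕ} (hf : PT f) : PT fun a => Term.var (f a) :=
  ((PT.const true).pair hf).of_tr fun _ => rfl

/-- Case distinction for terms. -/
def tcase {γ : Type} (t : Term) (f : ℕ → γ) (g : List ℕ → γ) : γ :=
  match t with
  | .const c => f c
  | .var s => g s

@[fun_prop] theorem PT.tcase {t : α → Term} {f : α → ℕ → γ} {g : α → List ℕ → γ} (ht : PT t)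
    (hf : PT fun p : α × ℕ => f p.1 p.2) (hg : PT fun p : α × List ℕ => g p.1 p.2) :
    PT fun a => tcase (t a) (f a) (g a) := by
  -- The payload is kept as a tree, since its type depends on the tag.
  let pay : Term → Tree := fun t => Nexus.tcase t Enc.tr Enc.tr
  let tag : Term → Bool := fun t => Nexus.tcase t (fun _ => false) fun _ => true
  have hpt : ∀ t : Term, Enc.tr t = Enc.tr (tag t, pay t) := by rintro (_ | _) <;> rfl
  have hboth : PT fun a => (tag (t a), pay (t a)) := ht.of_tr fun a => (hpt _).symm
  have hpay : PT fun a => (a, pay (t a)) := PT.id.pair hboth.snd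
  refine PolyOn.branch (fun a => Enc.tr (tag (t a))) hboth.fst ?_ ?_
  · have h : ∀ a : {a // Enc.tr (tag (t a)) ≠ .nil}, ∃ s, t a = .var s := by
      rintro ⟨a, h⟩
      cases hb : t a with
      | const c => rw [hb] at h; exact absurd rfl h
      | var s => exact ⟨s, rfl⟩
    choose s hs using h
    have h₁ := PolyOn.reindex hpay fun a : {a // Enc.tr (tag (t a)) ≠ .nil} => a.1
    have h₂ := PolyOn.reindex hg fun a : {a // Enc.tr (tag (t a)) ≠ .nil} => (a.1, s a)
    have h₃ := PolyOn.reindex ht fun a : {a // Enc.tr (tag (t a)) ≠ .nil} => a.1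
    refine PolyOn.comp h₁ ?_
    convert h₂ using 4 with a a
    · dsimp only; rw [hs]; rfl
    · dsimp only; rw [hs]; rfl
  · have h : ∀ a : {a // Enc.tr (tag (t a)) = .nil}, ∃ c, t a = .const c := by
      rintro ⟨a, h⟩
      cases hb : t a with
      | const c => exact ⟨c, rfl⟩
      | var s => rw [hb] at h; cases h
    choose s hs using h
    have h₁ := PolyOn.reindex hpay fun a : {a // Enc.tr (tag (t a)) = .nil} => a.1
    have h₂ := PolyOn.reindex hf fun a : {a // Enc.tr (tag (t a)) = .nil} => (a.1, s a)
    refine PolyOn.comp h₁ ?_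
    convert h₂ using 4 with a a
    · dsimp only; rw [hs]; rfl
    · dsimp only; rw [hs]; rfl

/-! ### Functions on strings -/

/-- `FP` works on the strings themselves and `PT` on the trees of the strings; `readBits` and
`printBits` translate. -/
theorem FP.pt {f : List Bool → List Bool} (hf : FP f) : PT f :=
  PolyOn.comp (PolyOn.printBits _root_.id) (PolyOn.comp hf.polyOn (PolyOn.readBits f))

theorem PT.polyOn_read {f : List Bool → α} (hf : PT f) :
    PolyOn _root_.id fun x => (Enc.tr (f x)).ser := PolyOn.comp (PolyOn.readBits _root_.id) hf

theorem PT.fp {f : List Bool → List Bool} (hf : PT f) : FP f :=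
  (PolyOn.comp hf.polyOn_read (PolyOn.printBits f)).fp

@[fun_prop] theorem PT.encList {e : β → List Bool} (he : PT e) {l : α → List β} (hl : PT l) :
    PT fun a => encList e (l a) := by
  unfold Nexus.encList
  fun_prop

@[fun_prop] theorem PT.encStr {f : α → List Bool} (hf : PT f) : PT fun a => encStr (f a) := by
  unfold Nexus.encStr
  fun_prop

@[fun_prop] theorem PT.encNat {f : α → ℕ} (hf : PT f) : PT fun a => encNat (f a) := by
  unfold Nexus.encNat
  fun_prop

@[fun_prop] theorem PT.encTuple {f : α → List ℕ} (hf : PT f) : PT fun a => encTuple (f a) := by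
  unfold Nexus.encTuple
  exact PT.encList (by fun_prop) hf

@[fun_prop] theorem PT.encTerm {f : α → Term} (hf : PT f) : PT fun a => encTerm (f a) := by
  have : PT fun a => Nexus.tcase (f a) (fun c => false :: Nexus.encNat c)
    fun s => true :: Nexus.encTuple s := by fun_prop
  convert this using 2 with a
  cases f a <;> rfl

@[fun_prop] theorem PT.encAtoms {e : β → List Bool} (he : PT e) {l : α → List (Atom β)}
    (hl : PT l) : PT fun a => encAtoms e (l a) := by
  unfold Nexus.encAtoms
  exact PT.encList ((PT.encNat (by fun_prop)).append (PT.encList he (by fun_prop))) hl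

@[fun_prop] theorem PT.encKB {l : α → List (Atom ℕ)} {o : α → List Bool} (hl : PT l) (ho : PT o) :
    PT fun a => encKB (l a) (o a) := by
  unfold Nexus.encKB
  exact (PT.encAtoms (by fun_prop) hl).append (by fun_prop)

theorem sz_bits_le (x : List Bool) : sz x ≤ 4 * x.length + 1 := length_ser_ofBits x

/-! ### Parsers -/

/-- `p` reads the code of an object off a string and returns the object and the rest. -/
structure IsParser (e : β → List Bool) (p : List Bool → β × List Bool) : Prop where
  pt : PT p
  length_le : ∀ x, (p x).2.length ≤ x.length
  spec : ∀ b x, p (e b ++ x) = (b, x)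

omit [Enc β] in
/-- One step of the parser for lists, on a state that consists of a flag for the end, the rest, and
the reversed list of the objects read. -/
def parseStep (p : List Bool → β × List Bool) (s : Bool × List Bool × List β) :
    Bool × List Bool × List β :=
  bif s.1 then s else Nexus.lcase s.2.1 (true, s.2) fun b r =>
    bif b then (false, (p r).2, (p r).1 :: s.2.2) else (true, r, s.2.2)

/-- The parser for lists. -/
def parseList (p : List Bool → β × List Bool) (x : List Bool) : List β × List Bool :=
  -- The string is its own fuel: the code of a list has more bits than the list has elements, which
  -- leaves a step for the end mark.
  let s := x.foldl (fun s _ => parseStep p s) (false, x, [])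
  (s.2.2.reverse, s.2.1)

theorem IsParser.list {e : β → List Bool} {p : List Bool → β × List Bool} (h : IsParser e p) :
    IsParser (encList e) (parseList p) := by
  have hstep : ∀ s, (parseStep p s).2.1.length ≤ s.2.1.length := by
    rintro ⟨b, r, acc⟩
    cases b
    · rcases r with _ | ⟨_ | _, r⟩
      · simp [parseStep, lcase]
      · simp [parseStep, lcase]
      · exact (h.length_le r).trans (Nat.le_succ _)
    · exact le_rfl
  have hlen : ∀ (u : List Bool) s,
      (u.foldl (fun s _ => parseStep p s) s).2.1.length ≤ s.2.1.length := by
    intro u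
    induction u with
    | nil => exact fun s => le_rfl
    | cons a u ih => exact fun s => (ih _).trans (hstep s)
  refine ⟨?_, fun x => hlen x _, ?_⟩
  · have hp := h.pt
    have : PT fun x : List Bool => x.foldl (fun s _ => parseStep p s) (false, x, []) := by
      obtain ⟨c, hc⟩ := hp.polyBd
      refine PT.foldl (by fun_prop) (by fun_prop) (by unfold parseStep; fun_prop)
        ⟨fun x => 3 + (4 * x.length + 1) + (x.length * ((4 * x.length + 3) ^ c + 1) + 1) + 2,
          ?_, fun x l' hl' => ?_⟩
      · have hx : PolyBd (fun x : List Bool => sz x) fun x => x.length :=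
          (PolyBd.self _).of_le length_le_sz
        have hk := PolyBd.const fun x : List Bool => sz x
        exact ((((hk 3).add (((hk 4).mul hx).add (hk 1))).add
          ((hx.mul (((((hk 4).mul hx).add (hk 3)).pow c).add (hk 1))).add (hk 1))).add (hk 2))
      -- The rest never becomes longer than `x`, so each step adds an object of size bounded in
      -- terms of `x` alone and the growth is additive.
      · have hs : ∀ s : Bool × List Bool × List β, s.2.1.length ≤ x.length →
            sz (parseStep p s).2.2 ≤ sz s.2.2 + ((4 * x.length + 3) ^ c + 1) := by
          rintro ⟨b, r, acc⟩ hr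
          cases b
          · rcases r with _ | ⟨_ | _, r⟩
            · simp [parseStep, lcase]
            · simp [parseStep, lcase]
            · have h₁ := hc r
              have h₂ : (sz r + 2) ^ c ≤ (4 * x.length + 3) ^ c := by
                refine Nat.pow_le_pow_left ?_ _
                have := sz_bits_le r
                simp at hr
                omega
              have h₃ : sz (p r) = sz (p r).1 + sz (p r).2 + 1 := sz_pair (p r).1 (p r).2
              dsimp only at h₁
              simp [parseStep, lcase]
              omega
          · simp [parseStep]
        have hacc : ∀ (u : List Bool) s, s.2.1.length ≤ x.length →
            sz (u.foldl (fun s _ => parseStep p s) s).2.2 ≤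
              sz s.2.2 + u.length * ((4 * x.length + 3) ^ c + 1) := by
          intro u
          induction u with
          | nil => intro s _; simp
          | cons a u ih =>
            intro s hr
            have h₁ := ih _ ((hstep s).trans hr)
            have h₂ := hs s hr
            rw [List.length_cons, Nat.succ_mul, List.foldl_cons]
            omega
        have h₁ := hacc l' (false, x, []) le_rfl
        have h₂ := hlen l' (false, x, [])
        have h₃ := Nat.mul_le_mul_right ((4 * x.length + 3) ^ c + 1) hl'.length_le
        dsimp only at h₁ h₂
        rw [sz_nil] at h₁
        generalize l'.foldl (fun s _ => parseStep p s) (false, x, []) = s at *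
        dsimp only
        have h₄ := sz_bool s.1
        have h₅ := sz_bits_le s.2.1
        have h₆ : sz s = sz s.1 + (sz s.2.1 + sz s.2.2 + 1) + 1 := by
          obtain ⟨s₁, s₂, s₃⟩ := s; simp
        omega
    unfold parseList
    fun_prop
  · intro l x
    have hdone : ∀ (u : List Bool) (s : List Bool × List β),
        u.foldl (fun s _ => parseStep p s) (true, s) = (true, s) := by
      intro u
      induction u with
      | nil => exact fun _ => rfl
      | cons a u ih => exact ih
    have key : ∀ (l : List β) (u : List Bool) (acc : List β), l.length < u.length →
        u.foldl (fun s _ => parseStep p s) (false, encList e l ++ x, acc) =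
          (true, x, l.reverse ++ acc) := by
      intro l
      induction l with
      | nil =>
        intro u acc hu
        cases u with
        | nil => simp at hu
        | cons b u => exact hdone _ _
      | cons a l ih =>
        intro u acc hu
        cases u with
        | nil => simp at hu
        | cons b u =>
          have hs : parseStep p (false, encList e (a :: l) ++ x, acc) =
              (false, encList e l ++ x, a :: acc) := by
            simp [parseStep, encList, lcase]
            have := h.spec a (encList e l ++ x)
            simp only [encList, List.append_assoc, List.singleton_append] at this
            simp [this]
          rw [List.foldl_cons, hs, ih u _ (by simpa using hu)]
          simp
    have hl : l.length < (encList e l ++ x).length := by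
      have : l.length < (encList e l).length := by
        induction l with
        | nil => simp [encList]
        | cons a l ih => simp [encList] at *; omega
      rw [List.length_append]
      omega
    rw [parseList, key _ _ _ hl]
    simp

/-- The parser for bits. -/
def parseBit (x : List Bool) : Bool × List Bool := lcase x (false, []) fun b r => (b, r)

theorem IsParser.bit : IsParser (fun b => [b]) parseBit :=
  ⟨by unfold parseBit; fun_prop, fun x => by cases x <;> simp [parseBit, lcase], fun _ _ => rfl⟩

/-- The parser for numbers. -/
def parseNat (x : List Bool) : ℕ × List Bool :=
  (ofBits (parseList parseBit x).1, (parseList parseBit x).2)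

theorem IsParser.nat : IsParser encNat parseNat := by
  have h := IsParser.bit.list
  have hpt := h.pt
  refine ⟨by unfold parseNat; fun_prop, h.length_le, fun n x => ?_⟩
  have := h.spec n.bits x
  change parseList parseBit (encNat n ++ x) = _ at this
  rw [parseNat, this]
  simp

/-- The parser for terms. -/
def parseTerm (x : List Bool) : Term × List Bool :=
  lcase x (.const 0, []) fun b r =>
    bif b then (.var (parseList parseNat r).1, (parseList parseNat r).2)
    else (.const (parseNat r).1, (parseNat r).2)

theorem IsParser.term : IsParser encTerm parseTerm := by
  have h := IsParser.nat
  have h' := IsParser.nat.list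
  have hpt := IsParser.bit.list.pt
  have hpt' := h'.pt
  refine ⟨by unfold parseTerm; fun_prop, fun x => ?_, ?_⟩
  · rcases x with _ | ⟨_ | _, r⟩
    · simp [parseTerm, lcase]
    · exact (h.length_le r).trans (Nat.le_succ _)
    · exact (h'.length_le r).trans (Nat.le_succ _)
  · rintro (c | s) x
    · have := h.spec c x
      simp [parseTerm, encTerm, lcase, this]
    · have := h'.spec s x
      change parseList parseNat (encTuple s ++ x) = _ at this
      simp [parseTerm, encTerm, lcase, this]

/-- The code of an atom. -/
def encAtom {T : Type} (e : T → List Bool) (a : Atom T) : List Bool :=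
  encNat a.name ++ encList e a.args

/-- The parser for atoms. -/
def parseAtom (p : List Bool → β × List Bool) (x : List Bool) : Atom β × List Bool :=
  (⟨(parseNat x).1, (parseList p (parseNat x).2).1⟩, (parseList p (parseNat x).2).2)

theorem IsParser.atom {e : β → List Bool} {p : List Bool → β × List Bool} (h : IsParser e p) :
    IsParser (encAtom e) (parseAtom p) := by
  have hpt := IsParser.bit.list.pt
  have hpt' := h.list.pt
  refine ⟨by unfold parseAtom; fun_prop,
    fun x => (h.list.length_le _).trans (IsParser.nat.length_le x), fun a x => ?_⟩
  rw [parseAtom, encAtom, List.append_assoc, IsParser.nat.spec, h.list.spec]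

theorem IsParser.atoms {e : β → List Bool} {p : List Bool → β × List Bool} (h : IsParser e p) :
    IsParser (encAtoms e) (parseList (parseAtom p)) := h.atom.list

theorem IsParser.injective {e : β → List Bool} {p : List Bool → β × List Bool}
    (h : IsParser e p) : Function.Injective e := by
  intro a b hab
  have h₁ := h.spec a []
  rw [hab, h.spec] at h₁
  exact (congrArg Prod.fst h₁).symm

end

end Nexus

/-! ### Savitch's search as a transition function -/

namespace Nexus

/-! ### Enumeration of bit vectors -/

/-- Increment of a bit vector, least bit first, with a carry; the first component is the overflow. -/
def incr : Bool → List Bool → Bool × List Bool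
  | c, [] => (c, [])
  | c, b :: w => ((incr (c && b) w).1, (c ^^ b) :: (incr (c && b) w).2)

theorem incr_false (w : List Bool) : incr false w = (false, w) := by
  induction w with
  | nil => rfl
  | cons b w ih => simp [incr, ih]

theorem length_incr (c : Bool) (w : List Bool) : (incr c w).2.length = w.length := by
  induction w generalizing c with
  | nil => rfl
  | cons b w ih => simp [incr, ih]

theorem incr_eq_foldl (c : Bool) (w : List Bool) :
    incr c w = ((w.foldl (fun s b => (s.1 && b, (s.1 ^^ b) :: s.2)) (c, [])).1,
      (w.foldl (fun s b => (s.1 && b, (s.1 ^^ b) :: s.2)) (c, [])).2.reverse) := by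
  have : ∀ (c : Bool) (acc : List Bool),
      w.foldl (fun (s : Bool × List Bool) b => (s.1 && b, (s.1 ^^ b) :: s.2)) (c, acc) =
        ((incr c w).1, (incr c w).2.reverse ++ acc) := by
    induction w with
    | nil => intro c acc; rfl
    | cons b w ih => intro c acc; simp [ih, incr]
  simp [this]

/-- All bit vectors of length `n`. -/
def allVec : ℕ → List (List Bool)
  | 0 => [[]]
  | n + 1 => (allVec n).flatMap fun w => [false :: w, true :: w]

theorem mem_allVec {n : ℕ} {w : List Bool} : w ∈ allVec n ↔ w.length = n := by
  induction n generalizing w with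
  | zero => simp [allVec]
  | succ n ih =>
    rcases w with _ | ⟨b, w⟩
    · simp [allVec]
    · simp only [allVec, List.mem_flatMap, ih, List.length_cons, Nat.add_right_cancel_iff]
      cases b <;> simp

theorem nodup_allVec (n : ℕ) : (allVec n).Nodup := by
  induction n with
  | zero => simp [allVec]
  | succ n ih =>
    rw [allVec, List.nodup_flatMap]
    refine ⟨fun w _ => by simp, ih.imp fun {v w} hvw => ?_⟩
    simp [Function.onFun, hvw.symm]

/-- Each element of the list is followed by its increment, and the last one overflows. -/
inductive Counts : List (List Bool) → Prop
  | single {w : List Bool} : (incr true w).1 = true → Counts [w]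
  | cons {w w' : List Bool} {l : List (List Bool)} : incr true w = (false, w') →
      Counts (w' :: l) → Counts (w :: w' :: l)

/-- The first bit is the least significant and varies fastest in `allVec`, so the list is in
counting order. A machine can run through it while storing only the current vector. -/
theorem counts_allVec (n : ℕ) : Counts (allVec n) := by
  induction n with
  | zero => exact .single rfl
  | succ n ih =>
    rw [allVec]
    generalize allVec n = l at ih ⊢
    induction ih with
    | @single w h => exact .cons (by simp [incr, incr_false]) (.single (by simp [incr, h]))
    | @cons w w' l h _ ih =>
      exact .cons (by simp [incr, incr_false]) (.cons (by simp [incr, h]) ih)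

theorem allVec_eq (n : ℕ) : ∃ l, allVec n = List.replicate n false :: l := by
  induction n with
  | zero => exact ⟨[], rfl⟩
  | succ n ih =>
    obtain ⟨l, h⟩ := ih
    exact ⟨_, by rw [allVec, h, List.flatMap_cons, List.replicate_succ]; rfl⟩

/-! ### Reachability by recursive halving -/

/-- There is a path of length at most `2 ^ k` from `u` to `v`, where `k` is the length of a list. -/
def halving (E : List Bool → List Bool → Bool) (n : ℕ) :
    List Bool → List Bool → List Bool → Bool
  | [], u, v => decide (u = v) || E u v
  | _ :: k, u, v => (allVec n).any fun w => halving E n k u w && halving E n k w v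

/-- `Path E n j u v`: a path of `j` steps from `u` to `v` through vectors of length `n`. -/
inductive Path (E : List Bool → List Bool → Bool) (n : ℕ) : ℕ → List Bool → List Bool → Prop
  | refl (u : List Bool) : Path E n 0 u u
  | step {u w v : List Bool} {j : ℕ} : u.length = n → E u w = true → Path E n j w v →
      Path E n (j + 1) u v

theorem Path.trans {E : List Bool → List Bool → Bool} {n i j : ℕ} {u v w : List Bool}
    (h : Path E n i u v) (h' : Path E n j v w) : Path E n (i + j) u w := by
  induction h with
  | refl => simpa using h'
  | step hu hE _ ih => rw [Nat.add_right_comm]; exact .step hu hE (ih h')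

/-- The end of a path need not have length `n`: below it is the empty vector. With `0 < j` the
intermediate vector is the source of a step and so has length `n`. -/
theorem Path.split {E : List Bool → List Bool → Bool} {n i j : ℕ} {u v : List Bool}
    (h : Path E n (i + j) u v) (hj : 0 < j) : ∃ w, w.length = n ∧ Path E n i u w ∧ Path E n j w v := by
  induction i generalizing u with
  | zero =>
    rw [Nat.zero_add] at h
    refine ⟨u, ?_, .refl u, h⟩
    cases h
    · omega
    · assumption
  | succ i ih =>
    rw [Nat.add_right_comm] at h
    cases h with
    | step hu hE h =>
      obtain ⟨w, hw, h₁, h₂⟩ := ih h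
      exact ⟨w, hw, .step hu hE h₁, h₂⟩

/-- A path of length at most `2 ^ (k + 1)` splits into two of length at most `2 ^ k`, as in
Savitch's theorem. -/
theorem halving_iff {E : List Bool → List Bool → Bool} {n : ℕ} (k : List Bool) {u v : List Bool}
    (hu : u.length = n) :
    halving E n k u v = true ↔ ∃ j ≤ 2 ^ k.length, Path E n j u v := by
  induction k generalizing u v with
  | nil =>
    simp only [halving, Bool.or_eq_true, decide_eq_true_eq, List.length_nil, pow_zero]
    constructor
    · rintro (rfl | h)
      · exact ⟨0, by omega, .refl u⟩
      · exact ⟨1, le_rfl, .step hu h (.refl v)⟩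
    · rintro ⟨j, hj, h⟩
      cases h with
      | refl => exact .inl rfl
      | @step _ w _ j _ hE h =>
        obtain rfl : j = 0 := by omega
        cases h
        exact .inr hE
  | cons b k ih =>
    simp only [halving, List.any_eq_true, Bool.and_eq_true, mem_allVec]
    constructor
    · rintro ⟨w, hw, h₁, h₂⟩
      obtain ⟨i, hi, h₁⟩ := (ih hu).1 h₁
      obtain ⟨j, hj, h₂⟩ := (ih hw).1 h₂
      exact ⟨i + j, by rw [List.length_cons, pow_succ]; omega, h₁.trans h₂⟩
    · rintro ⟨j, hj, h⟩
      rw [List.length_cons, pow_succ] at hj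
      by_cases hjk : j ≤ 2 ^ k.length
      -- A path that is already short is split at its start.
      · exact ⟨u, hu, (ih hu).2 ⟨0, Nat.zero_le _, .refl u⟩, (ih hu).2 ⟨j, hjk, h⟩⟩
      · obtain ⟨i, rfl⟩ := Nat.exists_eq_add_of_le (not_le.1 hjk).le
        obtain ⟨w, hw, h₁, h₂⟩ := h.split (by omega)
        exact ⟨w, hw, (ih hu).2 ⟨_, le_rfl, h₁⟩, (ih hw).2 ⟨i, by omega, h₂⟩⟩

/-! ### Recursive halving in polynomial space -/

/-- A pending call of `halving`: the two vectors, the intermediate vector, whether the first half has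
been done, and the depth of the recursive calls. -/
abbrev Frame := List Bool × List Bool × List Bool × Bool × List Bool

/-- A state consists of the context, the current vector, the bits still to be written, whether the
computation ends thereafter, two flags that tell whether bits are to be written and whether a call
is to be made, the arguments of that call, the result of the last call, and the pending calls. -/
abbrev State (X : Type) := X × List Bool × List Bool × Bool × Bool × Bool × List Bool × List Bool ×
  List Bool × Bool × List Frame

section

variable {X : Type}

/-- The modes of the search are writing (`emit`), calling (`callSt`) and returning (`ret`), told
apart by the two flags. Components without a role in a mode are reset to trivial values. -/
abbrev emit (c : X) (cur q : List Bool) (fin : Bool) : State X :=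
  (c, cur, q, fin, true, false, [], [], [], false, [])

abbrev callSt (c : X) (cur u v k : List Bool) (st : List Frame) : State X :=
  (c, cur, [], false, false, true, u, v, k, false, st)

abbrev ret (c : X) (cur : List Bool) (b : Bool) (st : List Frame) : State X :=
  (c, cur, [], false, false, false, [], [], [], b, st)

/-- Continue a pending call with the next intermediate vector. -/
def advance (c : X) (cur : List Bool) (f : Frame) (st : List Frame) : State X :=
  bif (incr true f.2.2.1).1 then ret c cur false st
  else callSt c cur f.1 (incr true f.2.2.1).2 f.2.2.2.2
    ((f.1, f.2.1, (incr true f.2.2.1).2, false, f.2.2.2.2) :: st)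

/-- The transition function. -/
def searchStep (L : X → List Bool) (E : X → List Bool → List Bool → Bool)
    (out : X → List Bool → List Bool) (y : State X) : Option (Option Bool) × State X :=
  -- Writing: when no bits are left, either halt or ask whether the empty vector can be reached from
  -- the current one.
  bif y.2.2.2.2.1 then
    lcase y.2.2.1
      (bif y.2.2.2.1 then (none, y) else (some none, callSt y.1 y.2.1 y.2.1 [] (L y.1) []))
      fun b q => (some (some b), emit y.1 y.2.1 q y.2.2.2.1)
  -- Calling: at depth zero test equality and the edge; otherwise open a frame with the all-zero
  -- midpoint and call its first half.
  else bif y.2.2.2.2.2.1 then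
    (some none, lcase y.2.2.2.2.2.2.2.2.1
      (ret y.1 y.2.1 (decide (y.2.2.2.2.2.2.1 = y.2.2.2.2.2.2.2.1) ||
        E y.1 y.2.2.2.2.2.2.1 y.2.2.2.2.2.2.2.1) y.2.2.2.2.2.2.2.2.2.2)
      fun _ k => callSt y.1 y.2.1 y.2.2.2.2.2.2.1 ((L y.1).map fun _ => false) k
        ((y.2.2.2.2.2.2.1, y.2.2.2.2.2.2.2.1, (L y.1).map (fun _ => false), false, k) ::
          y.2.2.2.2.2.2.2.2.2.2))
  -- Returning: with no pending call, queue the output for the current vector and move the counter,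
  -- appending the final `false` on overflow. Otherwise a success leads on to the second half or to
  -- the caller, and a failure to the next midpoint.
  else
    (some none, lcase y.2.2.2.2.2.2.2.2.2.2
      (emit y.1 (incr true y.2.1).2 ((bif y.2.2.2.2.2.2.2.2.2.1 then out y.1 y.2.1 else []) ++
        bif (incr true y.2.1).1 then [false] else []) (incr true y.2.1).1)
      fun f st => bif y.2.2.2.2.2.2.2.2.2.1 then
          bif f.2.2.2.1 then ret y.1 y.2.1 true st
          else callSt y.1 y.2.1 f.2.2.1 f.2.1 f.2.2.2.2
            ((f.1, f.2.1, f.2.2.1, true, f.2.2.2.2) :: st)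
        else advance y.1 y.2.1 f st)

variable {L : X → List Bool} {E : X → List Bool → List Bool → Bool}
  {out : X → List Bool → List Bool}

/-- The vectors of a pending call have length at most `n`. -/
def Frame.Short (n : ℕ) (f : Frame) : Prop :=
  f.1.length ≤ n ∧ f.2.1.length ≤ n ∧ f.2.2.1.length ≤ n ∧ f.2.2.2.2.length ≤ n

/-- The state has context `c`, and its components are bounded by `n` and `Q`. -/
def Good (c : X) (n Q : ℕ) (y : State X) : Prop :=
  y.1 = c ∧ y.2.1.length ≤ n ∧ y.2.2.1.length ≤ Q ∧ y.2.2.2.2.2.2.1.length ≤ n ∧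
  y.2.2.2.2.2.2.2.1.length ≤ n ∧ y.2.2.2.2.2.2.2.2.1.length + y.2.2.2.2.2.2.2.2.2.2.length ≤ n ∧
  ∀ f ∈ y.2.2.2.2.2.2.2.2.2.2, Frame.Short n f

theorem Yields.silent {Y : Type} {F : Y → Option (Option Bool) × Y} {B : Y → Prop} {y y' s w}
    (hF : F y = (some none, y')) (hB : B y) (h : Yields F B (some none, y') w s) :
    Yields F B (some none, y) w s := .step (o := none) hB (hF ▸ h)

theorem Yields.mono {Y : Type} {F : Y → Option (Option Bool) × Y} {B B' : Y → Prop} {s s' w}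
    (h : Yields F B s w s') (hB : ∀ y, B y → B' y) : Yields F B' s w s' := by
  induction h with
  | refl h => exact .refl (hB _ h)
  | step h _ ih => exact .step (hB _ h) ih

/-- Induction on the depth. Remaining depth plus number of pending calls never exceeds `n`, which is
what keeps the stack of frames polynomial. -/
theorem yields_call {c : X} {n Q : ℕ} (hn : (L c).length = n) {cur : List Bool}
    (hcur : cur.length ≤ n) (k u v : List Bool) (st : List Frame) (hu : u.length ≤ n)
    (hv : v.length ≤ n) (hst : ∀ f ∈ st, Frame.Short n f) (hk : k.length + st.length ≤ n) :
    Yields (searchStep L E out) (Good c n Q) (some none, callSt c cur u v k st) []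
      (some none, ret c cur (halving (E c) n k u v) st) := by
  induction k generalizing u v st with
  | nil =>
    have hk' : st.length ≤ n := by simpa using hk
    exact .silent rfl ⟨rfl, hcur, Nat.zero_le _, hu, hv, hk, hst⟩
      (.refl (show Good c n Q (ret c cur _ st) from
        ⟨rfl, hcur, Nat.zero_le _, Nat.zero_le _, Nat.zero_le _, by simpa using hk', hst⟩))
  | cons a k ih =>
    have hk' : k.length + (st.length + 1) ≤ n := by simp at hk; omega
    have hgood : ∀ b st', st'.length ≤ n → (∀ f ∈ st', Frame.Short n f) →
        Good c n Q (ret c cur b st') := fun b st' h h' =>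
      ⟨rfl, hcur, Nat.zero_le _, Nat.zero_le _, Nat.zero_le _, by simpa using h, h'⟩
    have hfr : ∀ w ph, w.length ≤ n → ∀ f ∈ ((u, v, w, ph, k) : Frame) :: st, Frame.Short n f := by
      intro w ph hw f hf
      rcases List.mem_cons.1 hf with rfl | hf
      · exact ⟨hu, hv, hw, by change k.length ≤ n; omega⟩
      · exact hst f hf
    -- `l` lists the midpoints still to be tried, beginning with the current one `w`.
    have loop : ∀ l, Counts l → (∀ w ∈ l, w.length = n) → ∀ w l', l = w :: l' →
        Yields (searchStep L E out) (Good c n Q)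
        (some none, callSt c cur u w k ((u, v, w, false, k) :: st)) []
        (some none, ret c cur (l.any fun w => halving (E c) n k u w && halving (E c) n k w v) st) := by
      intro l hl hlen
      have adv : ∀ w, w.length ≤ n → (incr true w).1 = true → ∀ ph,
          Yields (searchStep L E out) (Good c n Q)
          (some none, ret c cur false ((u, v, w, ph, k) :: st)) [] (some none, ret c cur false st) := by
        intro w hw hi ph
        refine .silent ?_ (hgood _ _ (by simp; omega) (hfr w _ hw)) (.refl (hgood _ _ (by omega) hst))
        simp [searchStep, lcase, advance, hi]
      have adv' : ∀ w w', w.length ≤ n → incr true w = (false, w') → ∀ ph b,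
          Yields (searchStep L E out) (Good c n Q)
            (some none, callSt c cur u w' k ((u, v, w', false, k) :: st)) [] (some none, ret c cur b st) →
          Yields (searchStep L E out) (Good c n Q)
            (some none, ret c cur false ((u, v, w, ph, k) :: st)) [] (some none, ret c cur b st) := by
        intro w w' hw hi ph b h
        refine .silent ?_ (hgood _ _ (by simp; omega) (hfr w _ hw)) h
        simp [searchStep, lcase, advance, hi]
      -- One midpoint: if both halves succeed, the call returns `true`; if one fails, the run goes
      -- on as supplied, and `ph` records which half failed.
      have body : ∀ w, w.length = n → ∀ b,
          ((halving (E c) n k u w && halving (E c) n k w v) = true → b = true) →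
          ((halving (E c) n k u w && halving (E c) n k w v) = false →
            ∀ ph, Yields (searchStep L E out) (Good c n Q)
            (some none, ret c cur false ((u, v, w, ph, k) :: st)) [] (some none, ret c cur b st)) →
          Yields (searchStep L E out) (Good c n Q)
            (some none, callSt c cur u w k ((u, v, w, false, k) :: st)) []
            (some none, ret c cur b st) := by
        intro w hw b h₁ h₂
        have hfirst := ih u w ((u, v, w, false, k) :: st) hu hw.le (hfr w _ hw.le) (by simpa using hk')
        cases hb₁ : halving (E c) n k u w
        · rw [hb₁] at hfirst
          exact hfirst.trans (h₂ (by simp [hb₁]) false)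
        · rw [hb₁] at hfirst
          have hsecond := ih w v ((u, v, w, true, k) :: st) hw.le hv (hfr w _ hw.le)
            (by simpa using hk')
          have hmid := hfirst.trans (.silent (by simp [searchStep, lcase])
            (hgood _ _ (by simp; omega) (hfr w _ hw.le)) hsecond)
          cases hb₂ : halving (E c) n k w v
          · rw [hb₂] at hmid
            exact hmid.trans (h₂ (by simp [hb₂]) true)
          · rw [hb₂] at hmid
            rw [h₁ (by simp [hb₁, hb₂])]
            refine hmid.trans (.silent (by simp [searchStep, lcase])
              (hgood _ _ (by simp; omega) (hfr w _ hw.le)) (.refl (hgood _ _ (by omega) hst)))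
      induction hl with
      | @single w h =>
        intro w' l' hw'
        obtain ⟨rfl, rfl⟩ := List.cons.inj hw'
        have hw := hlen w (by simp)
        refine body w hw _ (fun h => by simpa using h) fun hf ph => ?_
        have e : ([w].any fun w => halving (E c) n k u w && halving (E c) n k w v) = false := by
          simpa using hf
        rw [e]
        exact adv w hw.le h ph
      | @cons w w' l h hl ih' =>
        intro w'' l' hw'
        obtain ⟨rfl, rfl⟩ := List.cons.inj hw'
        have hw := hlen w (by simp)
        refine body w hw _ (fun h => by rw [List.any_cons, h]; rfl) fun hf ph => ?_
        rw [List.any_cons, hf, Bool.false_or]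
        exact adv' w w' hw.le h ph _ (ih' (fun x hx => hlen x (List.mem_cons_of_mem _ hx)) w' l rfl)
    obtain ⟨l, hl⟩ := allVec_eq n
    have := loop _ (counts_allVec n) (fun w hw => mem_allVec.1 hw) _ l hl
    refine .silent ?_ ⟨rfl, hcur, Nat.zero_le _, hu, hv, hk, hst⟩ this
    simp [searchStep, lcase, hn]

/-- The order `o` stands for a bit already scheduled before the queue `q`; the rest of the run is a
parameter. -/
theorem yields_emit {c : X} {n Q : ℕ} {cur : List Bool} (hcur : cur.length ≤ n)
    (q : List Bool) (hq : q.length ≤ Q) (fin : Bool) (o : Option Bool) {w : List Bool}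
    {s : Option (Option Bool) × State X}
    (h : Good c n Q (emit c cur [] fin) →
      Yields (searchStep L E out) (Good c n Q) (searchStep L E out (emit c cur [] fin)) w s) :
    Yields (searchStep L E out) (Good c n Q) (some o, emit c cur q fin) (o.toList ++ (q ++ w)) s := by
  have hg : ∀ q : List Bool, q.length ≤ Q → Good c n Q (emit c cur q fin) := fun q hq =>
    ⟨rfl, hcur, hq, Nat.zero_le _, Nat.zero_le _, Nat.zero_le _, by simp⟩
  induction q generalizing o with
  | nil => exact .step (hg _ hq) (h (hg _ hq))
  | cons b q ih => exact .step (hg _ hq) (ih (by simp at hq; omega) (some b))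

theorem yields_search {c : X} {n Q : ℕ} (hn : (L c).length = n)
    (hQ : ∀ u : List Bool, u.length = n → (out c u).length + 1 ≤ Q) :
    ∀ l, Counts l → (∀ w ∈ l, w.length = n) → ∀ cur l', l = cur :: l' →
    ∀ (q : List Bool) (o : Option Bool), q.length ≤ Q →
    ∃ y', Yields (searchStep L E out) (Good c n Q) (some o, emit c cur q false)
      (o.toList ++ (q ++ ((l.flatMap fun u => bif halving (E c) n (L c) u [] then out c u else []) ++
        [false]))) (none, y') := by
  -- One round for the vector `cur`: write what is queued, decide reachability, and queue the result
  -- along with the next vector.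
  have key : ∀ cur : List Bool, cur.length = n → ∀ (q : List Bool) (o : Option Bool) w s,
      q.length ≤ Q → Yields (searchStep L E out) (Good c n Q)
        (some none, emit c (incr true cur).2 ((bif halving (E c) n (L c) cur [] then out c cur else []) ++
        bif (incr true cur).1 then [false] else []) (incr true cur).1) w s →
      Yields (searchStep L E out) (Good c n Q) (some o, emit c cur q false)
        (o.toList ++ (q ++ w)) s := by
    intro cur hcur q o w s hq h
    refine yields_emit hcur.le q hq false o fun hg => ?_
    have h₁ := yields_call (E := E) (out := out) (Q := Q) hn hcur.le (L c) cur [] [] hcur.le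
      (Nat.zero_le _) (by simp) (by simp [hn])
    refine h₁.trans (.silent rfl h₁.right h)
  intro l hl
  induction hl with
  | @single w hw =>
    intro hlen cur l' hl q o hq
    obtain ⟨rfl, rfl⟩ := List.cons.inj hl
    have hlw := hlen w (by simp)
    refine ⟨emit c (incr true w).2 [] true, key w hlw q o _ _ hq ?_⟩
    · have hlen' : (bif halving (E c) n (L c) w [] then out c w else []).length + 1 ≤ Q := by
        have := hQ w hlw
        cases halving (E c) n (L c) w [] <;> simp <;> omega
      rw [hw, List.flatMap_singleton]
      have := yields_emit (L := L) (E := E) (out := out) (c := c) (n := n) (Q := Q)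
        (cur := (incr true w).2) (by rw [length_incr, hlw])
        ((bif halving (E c) n (L c) w [] then out c w else []) ++ [false]) (by simpa using hlen')
        true none (w := []) (s := (none, emit c (incr true w).2 [] true)) fun hg => .refl hg
      simpa using this
  | @cons w w' l hw hl ih =>
    intro hlen cur l' hl q o hq
    obtain ⟨rfl, rfl⟩ := List.cons.inj hl
    have hlw := hlen w (by simp)
    have hlen' : (bif halving (E c) n (L c) w [] then out c w else []).length ≤ Q := by
      have := hQ w hlw
      cases halving (E c) n (L c) w []
      · simp
      · rw [cond_true]
        omega
    obtain ⟨y', hy⟩ := ih (fun x hx => hlen x (List.mem_cons_of_mem _ hx)) w' l rfl _ none hlen'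
    refine ⟨y', key w hlw q o _ _ hq ?_⟩
    rw [hw]
    simpa using hy

variable [Enc X]

theorem PT.incr {α : Type} [Enc α] {f : α → List Bool} (hf : PT f) :
    PT fun a => incr true (f a) := by
  simp only [incr_eq_foldl]
  have hb : ∀ (l : List Bool) (c : Bool) (acc : List Bool),
      sz (l.foldl (fun (s : Bool × List Bool) b => (s.1 && b, (s.1 ^^ b) :: s.2)) (c, acc)) ≤
        4 * l.length + sz acc + 4 := by
    intro l
    induction l with
    | nil => intro c acc; have := sz_bool c; simp; omega
    | cons b l ih =>
      intro c acc
      have h₁ := ih (c && b) ((c ^^ b) :: acc)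
      have h₂ := sz_bool (c ^^ b)
      simp only [sz_cons] at h₁
      simp only [List.foldl_cons, List.length_cons]
      omega
  have : PT fun a => (f a).foldl (fun (s : Bool × List Bool) b => (s.1 && b, (s.1 ^^ b) :: s.2))
      (true, []) := by
    have hx : PT fun p : Bool × Bool => p.1 ^^ p.2 := by
      have : PT fun p : Bool × Bool => bif p.1 then !p.2 else p.2 := by fun_prop
      convert this using 2 with p
      rcases p with ⟨_ | _, _ | _⟩ <;> rfl
    refine PT.foldl hf (by fun_prop) ?_ ⟨fun a => 4 * sz (f a) + 5,
      ((PolyBd.const _ 4).mul hf.polyBd).add (.const _ 5), fun a l' hl' => ?_⟩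
    · exact PT.pair (by fun_prop) (PT.cons (hx.comp (f := fun p : α × (Bool × List Bool) × Bool =>
        (p.2.1.1, p.2.2)) (by fun_prop)) (by fun_prop))
    · have h₁ := hb l' true []
      have h₂ := hl'.length_le.trans (length_le_sz (f a))
      simp only [sz_nil] at h₁
      dsimp only
      omega
  fun_prop

instance : Enc (Option (Option Bool)) where
  tr := orderTree
  inj a b h := by
    rcases a with _ | _ | _ | _ <;> rcases b with _ | _ | _ | _ <;>
      simp_all [orderTree, Tree.ofBool]

@[fun_prop] theorem PT.someSome {α : Type} [Enc α] {f : α → Bool} (hf : PT f) :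
    PT fun a => some (some (f a)) :=
  (show PT fun a => [[f a]] by fun_prop).of_tr fun _ => rfl

theorem PT.searchStep (hL : PT L) (hE : PT fun p : X × List Bool × List Bool => E p.1 p.2.1 p.2.2)
    (hout : PT fun p : X × List Bool => out p.1 p.2) : PT (searchStep L E out) := by
  have hi : PT fun w => Nexus.incr true w := PT.incr PT.id
  have ha : PT fun p : X × List Bool × Frame × List Frame =>
      advance p.1 p.2.1 p.2.2.1 p.2.2.2 := by
    unfold advance
    fun_prop
  have hE' : PT fun y : State X => E y.1 y.2.2.2.2.2.2.1 y.2.2.2.2.2.2.2.1 :=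
    hE.comp (f := fun y : State X => (y.1, y.2.2.2.2.2.2.1, y.2.2.2.2.2.2.2.1)) (by fun_prop)
  have ho' : PT fun y : State X => out y.1 y.2.1 :=
    hout.comp (f := fun y : State X => (y.1, y.2.1)) (by fun_prop)
  have ha' : PT fun p : State X × Frame × List Frame => advance p.1.1 p.1.2.1 p.2.1 p.2.2 :=
    ha.comp (f := fun p : State X × Frame × List Frame => (p.1.1, p.1.2.1, p.2.1, p.2.2))
      (by fun_prop)
  have hL' : PT fun y : State X => L y.1 := hL.comp (by fun_prop)
  unfold Nexus.searchStep
  refine PT.cond (by fun_prop) ?_ (PT.cond (by fun_prop) ?_ ?_)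
  · fun_prop
  · fun_prop
  · fun_prop

theorem sz_bits_le_of {l : List Bool} {n : ℕ} (h : l.length ≤ n) : sz l ≤ 4 * n + 1 :=
  (sz_bits_le l).trans (by omega)

theorem sz_frames_le {n : ℕ} (st : List Frame) (h : ∀ f ∈ st, Frame.Short n f) :
    sz st ≤ st.length * (16 * n + 12) + 1 := by
  induction st with
  | nil => simp
  | cons f st ih =>
    have := ih fun g hg => h g (List.mem_cons_of_mem _ hg)
    obtain ⟨h₁, h₂, h₃, h₄⟩ := h f (by simp)
    obtain ⟨u, v, w, ph, k⟩ := f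
    have := sz_bits_le_of h₁
    have := sz_bits_le_of h₂
    have := sz_bits_le_of h₃
    have := sz_bits_le_of h₄
    have := sz_bool ph
    simp only [sz_cons, sz_pair, List.length_cons, Nat.add_mul] at *
    omega

theorem sz_state_le {c : X} {n Q : ℕ} {y : State X} (h : Good c n Q y) :
    sz y ≤ sz c + 4 * Q + n * (16 * n + 12) + 16 * n + 40 := by
  obtain ⟨c, cur, q, fin, e, cl, u, v, k, b, st⟩ := y
  obtain ⟨h₁, h₂, h₃, h₄, h₅, h₆, h₇⟩ := h
  dsimp only at *
  subst h₁
  have := sz_bits_le_of h₂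
  have := sz_bits_le_of h₃
  have := sz_bits_le_of h₄
  have := sz_bits_le_of h₅
  have hk : k.length ≤ n := by omega
  have := sz_bits_le_of hk
  have := sz_bool fin
  have := sz_bool e
  have := sz_bool cl
  have := sz_bool b
  have h₈ := sz_frames_le st h₇
  have : st.length * (16 * n + 12) ≤ n * (16 * n + 12) := Nat.mul_le_mul_right _ (by omega)
  simp only [sz_pair]
  omega

/-- A state holds the context, a counter, at most `n` frames of size linear in `n`, and queued
output, all polynomial in the input although `2 ^ n` vectors are visited. -/
theorem FPSPACE.enumerate {ctx : List Bool → X} (hctx : PT ctx) (hL : PT L)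
    (hE : PT fun p : X × List Bool × List Bool => E p.1 p.2.1 p.2.2)
    (hout : PT fun p : X × List Bool => out p.1 p.2) {pre : X → List Bool} (hpre : PT pre) :
    FPSPACE fun x => pre (ctx x) ++ (((allVec (L (ctx x)).length).flatMap fun u =>
      bif halving (E (ctx x)) (L (ctx x)).length (L (ctx x)) u [] then out (ctx x) u else []) ++
      [false]) := by
  have hc : PolyBd (fun x : List Bool => x.length) fun x => sz (ctx x) :=
    (PolyBd.of_le (((PolyBd.const _ 4).mul (.self _)).add (.const _ 1)) sz_bits_le).trans
      hctx.polyBd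
  have hn : PolyBd (fun x : List Bool => x.length) fun x => (L (ctx x)).length :=
    hc.trans ((hL.polyBd.comp ctx).of_le fun x => length_le_sz (L (ctx x)))
  have hp : PolyBd (fun x : List Bool => x.length) fun x => (pre (ctx x)).length :=
    hc.trans ((hpre.polyBd.comp ctx).of_le fun x => length_le_sz (pre (ctx x)))
  obtain ⟨a, ha⟩ := hout.polyBd
  -- The queue holds either the prefix or the output for one vector and possibly the end mark.
  let Q := fun x => (pre (ctx x)).length + (((sz (ctx x) + 4 * (L (ctx x)).length + 4) ^ a) + 1)
  let B := fun x => sz (ctx x) + 4 * Q x + (L (ctx x)).length * (16 * (L (ctx x)).length + 12) +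
    16 * (L (ctx x)).length + 40
  have hQ : PolyBd (fun x : List Bool => x.length) Q :=
    hp.add ((((hc.add ((PolyBd.const _ 4).mul hn)).add (.const _ 4)).pow a).add (.const _ 1))
  have hB : PolyBd (fun x : List Bool => x.length) B :=
    (((hc.add ((PolyBd.const _ 4).mul hQ)).add
      (hn.mul (((PolyBd.const _ 16).mul hn).add (.const _ 12)))).add
      ((PolyBd.const _ 16).mul hn)).add (.const _ 40)
  have hinit : PT fun x => ((some none : Option (Option Bool)),
      emit (ctx x) ((L (ctx x)).map fun _ => false) (pre (ctx x)) false) := by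
    have : PT fun x => L (ctx x) := hL.comp hctx
    have : PT fun x => pre (ctx x) := hpre.comp hctx
    fun_prop
  obtain ⟨d, hd⟩ := hB
  refine FPSPACE.of_yields (PT.searchStep hL hE hout) hinit.polyOn_read ⟨d, fun x => ?_⟩
  obtain ⟨l, hl⟩ := allVec_eq (L (ctx x)).length
  have hout' : ∀ u : List Bool, u.length = (L (ctx x)).length →
      (out (ctx x) u).length + 1 ≤ Q x := by
    intro u hu
    have h₁ := ha (ctx x, u)
    have h₂ := sz_bits_le_of hu.le
    have h₃ : (sz (ctx x, u) + 2) ^ a ≤ (sz (ctx x) + 4 * (L (ctx x)).length + 4) ^ a :=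
      Nat.pow_le_pow_left (by rw [sz_pair]; omega) a
    have h₄ := length_le_sz (out (ctx x) u)
    dsimp only at h₁
    show _ ≤ (pre (ctx x)).length + (_ + 1)
    omega
  obtain ⟨y', hy⟩ := yields_search (L := L) (E := E) (out := out) (c := ctx x) (Q := Q x) rfl
    hout' _ (counts_allVec _) (fun w hw => mem_allVec.1 hw) _ l hl (pre (ctx x)) none
    (Nat.le_add_right _ _)
  refine ⟨y', ?_⟩
  have := hy.mono fun y hy => (sz_state_le hy).trans (hd x)
  simpa [sz] using this

end

end Nexus

/-! ### The canonical characterization as a reachability problem -/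

namespace Nexus

/-! ### Paths of linked atoms -/

/-- The two atoms have a term in common. -/
def share (β γ : Atom Term) : Bool := β.args.any fun t => decide (t ∈ γ.args)

/-- Some variable `x_s` with `s` in the list occurs in the atom. -/
def isFree (Fr : List (List ℕ)) (β : Atom Term) : Bool :=
  β.args.any fun t => tcase t (fun _ => false) fun s => decide (s ∈ Fr)

theorem share_iff {β γ : Atom Term} : share β γ = true ↔ ∃ t ∈ β.args, t ∈ γ.args := by
  simp [share]

theorem isFree_iff {Fr : List (List ℕ)} {β : Atom Term} :
    isFree Fr β = true ↔ ∃ s ∈ Fr, Term.var s ∈ β.args := by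
  simp only [isFree, List.any_eq_true]
  constructor
  · rintro ⟨_ | s, ht, h⟩
    · simp [tcase] at h
    · exact ⟨s, by simpa [tcase] using h, ht⟩
  · rintro ⟨s, hs, h⟩
    exact ⟨_, h, by simpa [tcase] using hs⟩

/-- There is a path of linked atoms of `A` to an atom in which a free variable occurs. -/
inductive Linked (A : Set (Atom Term)) (Fr : List (List ℕ)) : Atom Term → Prop
  | base {β : Atom Term} : β ∈ A → isFree Fr β = true → Linked A Fr β
  | step {β γ : Atom Term} : β ∈ A → share β γ = true → Linked A Fr γ → Linked A Fr β

theorem Linked.mem {A : Set (Atom Term)} {Fr : List (List ℕ)} {β : Atom Term}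
    (h : Linked A Fr β) : β ∈ A := by
  cases h <;> assumption

/-- The term shared by the two parts of a connected structure provides the link between a path in
one part and a path in the other. -/
theorem Connected.reflTransGen {S : Set (Atom Term)} (hS : Connected S) :
    ∀ β ∈ S, ∀ γ ∈ S,
      Relation.ReflTransGen (fun β γ => β ∈ S ∧ γ ∈ S ∧ share β γ = true) β γ := by
  induction hS with
  | single a =>
    rintro _ rfl _ rfl
    exact .refl
  | @union S S' _ _ _ hd ih ih' =>
    have hl : ∀ β ∈ S, ∀ γ ∈ S, Relation.ReflTransGen
        (fun β γ => β ∈ S ∪ S' ∧ γ ∈ S ∪ S' ∧ share β γ = true) β γ := fun β hβ γ hγ =>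
      (ih β hβ γ hγ).lift id fun _ _ h => ⟨.inl h.1, .inl h.2.1, h.2.2⟩
    have hr : ∀ β ∈ S', ∀ γ ∈ S', Relation.ReflTransGen
        (fun β γ => β ∈ S ∪ S' ∧ γ ∈ S ∪ S' ∧ share β γ = true) β γ := fun β hβ γ hγ =>
      (ih' β hβ γ hγ).lift id fun _ _ h => ⟨.inr h.1, .inr h.2.1, h.2.2⟩
    obtain ⟨t, ⟨a, ha, hta⟩, b, hb, htb⟩ := hd
    rintro β (hβ | hβ) γ (hγ | hγ)
    · exact hl β hβ γ hγ
    · exact (hl β hβ a ha).trans (.head ⟨.inl ha, .inr hb, share_iff.2 ⟨t, hta, htb⟩⟩ (hr b hb γ hγ))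
    · exact (hr β hβ b hb).trans (.head ⟨.inr hb, .inl ha, share_iff.2 ⟨t, htb, hta⟩⟩ (hl a ha γ hγ))
    · exact hr β hβ γ hγ

/-- A connected structure contains a path from the atom to the free variable. Conversely, adding the
atoms of a path one at a time as singletons builds a connected structure. -/
theorem mem_canAtoms_iff {sel : List ℕ → Finset (Atom ℕ)} {us : List (List ℕ)} {β : Atom Term} :
    β ∈ canAtoms sel us ↔ Linked (allAtoms sel us) (tupleProd us) β := by
  constructor
  · rintro ⟨hβA, s, hs, S, hS, hSA, hβ, γ, hγ, hsγ⟩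
    clear hβA
    have := hS.reflTransGen β hβ γ hγ
    clear hβ
    induction this using Relation.ReflTransGen.head_induction_on with
    | refl => exact .base (hSA hγ) (isFree_iff.2 ⟨s, hs, hsγ⟩)
    | head h _ ih => exact .step (hSA h.1) h.2.2 ih
  · intro h
    refine ⟨h.mem, ?_⟩
    induction h with
    | @base β hβ hF =>
      obtain ⟨s, hs, hsβ⟩ := isFree_iff.1 hF
      exact ⟨s, hs, {β}, .single β, by simpa using hβ, rfl, β, rfl, hsβ⟩
    | @step β γ hβ hlink _ ih =>
      obtain ⟨s, hs, S, hS, hSA, hγ, hsS⟩ := ih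
      refine ⟨s, hs, ?_⟩
      -- The parts of a connected structure must be disjoint, so an atom that is present already is
      -- not added.
      by_cases hβS : β ∈ S
      · exact ⟨S, hS, hSA, hβS, hsS⟩
      · obtain ⟨t, htβ, htγ⟩ := share_iff.1 hlink
        refine ⟨{β} ∪ S, .union (.single β) hS (by simpa using hβS)
          ⟨t, ⟨β, rfl, htβ⟩, γ, hγ, htγ⟩, ?_, .inl rfl, ?_⟩
        · rintro _ (rfl | h)
          exacts [hβ, hSA h]
        · obtain ⟨a, ha, hsa⟩ := hsS
          exact ⟨a, .inr ha, hsa⟩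

/-! ### Membership in the direct product -/

/-- Pair the elements of a list with the columns of a list of rows. -/
def cols {β : Type} : List β → List (List ℕ) → List (β × List ℕ)
  | [], _ => []
  | b :: l, rows => (b, rows.map fun r => r.headD 0) :: cols l (rows.map List.tail)

theorem cols_eq {β : Type} (l : List β) (rows : List (List ℕ)) :
    cols l rows = l.zipIdx.map fun p => (p.1, rows.map fun r => r.getD p.2 0) := by
  -- The recursion shortens all rows; generalizing to rows with `k` entries dropped keeps track of
  -- the index.
  have : ∀ k, ∀ rows : List (List ℕ), cols l (rows.map (List.drop k)) =
      (l.zipIdx k).map fun p => (p.1, rows.map fun r => r.getD p.2 0) := by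
    induction l with
    | nil => intros; rfl
    | cons b l ih =>
      intro k rows
      rw [cols, List.zipIdx_cons, List.map_cons, ← ih (k + 1) rows]
      simp [Function.comp_def, List.headD_eq_head?_getD, List.getD_eq_getElem?_getD,
        List.head?_drop]
  simpa [List.drop_zero, show List.drop (α := ℕ) 0 = id from rfl] using this 0 rows

/-- The sequence of constants that a term stands for, where `m` is the length of `us`. -/
def seqOf (us : List (List ℕ)) (t : Term) : List ℕ := tcase t (fun c => us.map fun _ => c) id

/-- The sequence has the form `(c,…,c)`. -/
def isConst (s : List ℕ) : Bool := !s.isEmpty && s.all fun b => decide (b = s.headD 0)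

theorem isConst_iff {s : List ℕ} : isConst s = true ↔ ∃ c, IsConstSeq c s := by
  rcases s with _ | ⟨a, s⟩
  · simp [isConst, IsConstSeq]
  · simp only [isConst, IsConstSeq, List.isEmpty_cons, Bool.not_false, Bool.true_and,
      List.all_eq_true, List.headD_cons]
    refine ⟨fun h => ⟨a, by simp, fun b hb => of_decide_eq_true (h b hb)⟩, ?_⟩
    rintro ⟨c, -, h⟩ b hb
    exact decide_eq_true ((h b hb).trans (h a (by simp)).symm)

/-- Whether a term can occur in the atoms obtained from the product. -/
def okTerm (us : List (List ℕ)) (Fr : List (List ℕ)) (t : Term) : Bool :=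
  tcase t (fun _ => true) fun s => decide ((s.map fun _ => false) = us.map fun _ => false) &&
    (decide (s ∈ Fr) || !isConst s)

/-- An instance of the problem: the tuples of the unit, and lists of the atoms of their summaries. -/
abbrev Inst := List (List ℕ) × List (List (Atom ℕ))

/-- The columns of the tuples. -/
def Inst.free (I : Inst) : List (List ℕ) := (cols (I.1.headD []) I.1).map Prod.snd

theorem Inst.free_eq (I : Inst) : I.free = tupleProd I.1 := by
  rw [Inst.free, cols_eq, tupleProd, List.map_map, List.zipIdx_eq_zip_range', ← List.range_eq_range']
  conv_rhs => rw [← List.map_snd_zip (l₁ := I.1.headD []) (l₂ := List.range (I.1.headD []).length)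
    (by simp)]
  rw [List.map_map]
  rfl

/-- Membership in the set of atoms obtained from the product. -/
def Inst.test (I : Inst) (β : Atom Term) : Bool :=
  β.args.all (okTerm I.1 I.free) &&
    (cols I.2 (β.args.map (seqOf I.1))).all fun p => decide ((⟨β.name, p.2⟩ : Atom ℕ) ∈ p.1)

/-- The instance consists of the tuples and lists of their summaries. -/
def Inst.Spec (I : Inst) (sel : List ℕ → Finset (Atom ℕ)) : Prop :=
  I.1 ≠ [] ∧ List.Forall₂ (fun τ l => Lists l (sel τ : Set (Atom ℕ))) I.1 I.2

/-- A variable carries its sequence, and a constant `c` comes from `(c,…,c)`. Hence the product atom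
behind a given atom is unique and can be computed. -/
theorem replace_iff {us Fr : List (List ℕ)} (hus : us ≠ []) {s : List ℕ} {t : Term} :
    (s.length = us.length ∧ Replace Fr s t) ↔ okTerm us Fr t = true ∧ s = seqOf us t := by
  have hlen : ∀ s : List ℕ, (s.map fun _ => false) = (us.map fun _ => false) ↔
      s.length = us.length := by simp [List.map_const']
  constructor
  · rintro ⟨hs, h⟩
    cases h with
    | var h =>
      refine ⟨?_, rfl⟩
      simp only [okTerm, tcase, Bool.and_eq_true, Bool.or_eq_true, decide_eq_true_eq, hlen,
        Bool.not_eq_true', ← Bool.not_eq_true, isConst_iff]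
      exact ⟨hs, h⟩
    | const c h =>
      refine ⟨rfl, ?_⟩
      rw [seqOf, tcase, List.map_const', ← hs]
      exact List.eq_replicate_iff.2 ⟨rfl, h.2⟩
  · rintro ⟨h, rfl⟩
    rcases t with c | s
    · refine ⟨by simp [seqOf, tcase], .const _ _ ⟨?_, ?_⟩⟩
      · simpa [seqOf, tcase] using hus
      · simp [seqOf, tcase]
    · simp only [okTerm, tcase, Bool.and_eq_true, Bool.or_eq_true, decide_eq_true_eq, hlen,
        Bool.not_eq_true', ← Bool.not_eq_true, isConst_iff] at h
      exact ⟨h.1, .var _ h.2⟩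

/-- The only candidate for the product atom is the one given by `seqOf`, so the existential
quantifier turns into a test of its columns. -/
theorem Inst.Spec.mem_allAtoms {I : Inst} {sel : List ℕ → Finset (Atom ℕ)} (h : I.Spec sel)
    {β : Atom Term} : β ∈ allAtoms sel I.1 ↔ I.test β = true := by
  have hproj : ∀ α : Atom (List ℕ), (∀ (i : ℕ) (hi : i < (I.1.map sel).length),
      proj i α ∈ (I.1.map sel)[i]) ↔
      ∀ p ∈ cols I.2 α.args, (⟨α.name, p.2⟩ : Atom ℕ) ∈ p.1 := by
    intro α
    rw [cols_eq]
    simp only [List.mem_map, List.length_map]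
    have hl := h.2.length_eq
    constructor
    · rintro H _ ⟨⟨l, i⟩, hp, rfl⟩
      obtain ⟨hi, hl'⟩ := List.mem_zipIdx' hp
      have := H i (by omega)
      rw [List.getElem_map] at this
      dsimp only
      rw [hl']
      exact ((h.2.get (i := i) (by omega) hi).2 _).2 this
    · intro H i hi
      have := H _ ⟨(I.2[i], i), List.mk_mem_zipIdx_iff_getElem?.2 (by simp [← hl, hi]), rfl⟩
      rw [List.getElem_map]
      exact ((h.2.get (i := i) hi (by omega)).2 _).1 this
  simp only [Inst.test, Bool.and_eq_true, List.all_eq_true, decide_eq_true_eq, I.free_eq]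
  constructor
  · rintro ⟨α, ⟨hlen, hα⟩, hname, hrep⟩
    rw [hproj] at hα
    rw [List.length_map] at hlen
    have hall : List.Forall₂ (fun s t => okTerm I.1 (tupleProd I.1) t = true ∧ s = seqOf I.1 t)
        α.args β.args := by
      rw [List.forall₂_iff_get] at hrep ⊢
      exact ⟨hrep.1, fun i hi hi' => (replace_iff h.1).1 ⟨hlen _ (List.get_mem _ _), hrep.2 i hi hi'⟩⟩
    have hargs : α.args = β.args.map (seqOf I.1) := by
      rw [List.forall₂_iff_get] at hall
      refine List.ext_get (by simp [hall.1]) fun i hi hi' => ?_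
      simpa using (hall.2 i hi (by simpa using hi')).2
    refine ⟨fun t ht => ?_, ?_⟩
    · obtain ⟨i, hi, rfl⟩ := List.getElem_of_mem ht
      rw [List.forall₂_iff_get] at hall
      exact (hall.2 i (by rw [hall.1]; exact hi) hi).1
    · rw [← hargs, hname]
      exact hα
  · rintro ⟨hok, hα⟩
    refine ⟨⟨β.name, β.args.map (seqOf I.1)⟩, ⟨?_, (hproj _).2 hα⟩, rfl, ?_⟩
    · simp only [List.mem_map, List.length_map]
      rintro _ ⟨t, ht, rfl⟩
      exact ((replace_iff h.1).2 ⟨hok t ht, rfl⟩).1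
    · rw [List.forall₂_map_left_iff, List.forall₂_same]
      exact fun t ht => ((replace_iff h.1).2 ⟨hok t ht, rfl⟩).2

/-! ### These functions are computable in polynomial time -/

theorem PT.cols {α β : Type} [Enc α] [Enc β] {l : α → List β} {rows : α → List (List ℕ)}
    (hl : PT l) (hr : PT rows) : PT fun a => cols (l a) (rows a) := by
  have key : ∀ (l : List β) (rows : List (List ℕ)) (acc : List (β × List ℕ)),
      l.foldl (fun s b => (s.1.map List.tail, (b, s.1.map fun r => r.headD 0) :: s.2)) (rows, acc) =
        (l.foldl (fun r _ => r.map List.tail) rows, (Nexus.cols l rows).reverse ++ acc) := by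
    intro l
    induction l with
    | nil => intros; rfl
    | cons b l ih => intro rows acc; rw [List.foldl_cons, ih]; simp [Nexus.cols]
  have htail : ∀ rows : List (List ℕ), sz (rows.map List.tail) ≤ sz rows := by
    intro rows
    induction rows with
    | nil => simp
    | cons r rows ih =>
      have : sz r.tail ≤ sz r := sz_le_of_sublist (List.tail_sublist r)
      simp only [List.map_cons, sz_cons]
      omega
  have hhead : ∀ rows : List (List ℕ), sz (rows.map fun r => r.headD 0) ≤ sz rows := by
    intro rows
    induction rows with
    | nil => simp
    | cons r rows ih =>
      have : sz (r.headD 0) ≤ sz r := by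
        rcases r with _ | ⟨a, r⟩
        · decide
        · simp only [List.headD_cons, sz_cons]; omega
      simp only [List.map_cons, sz_cons]
      omega
  have hb : ∀ (l : List β) (rows : List (List ℕ)) (acc : List (β × List ℕ)),
      sz (l.foldl (fun s b => (s.1.map List.tail, (b, s.1.map fun r => r.headD 0) :: s.2))
        (rows, acc)) ≤ (sz l + 1) * (sz rows + 2) + sz acc := by
    intro l
    induction l with
    | nil => intro rows acc; simp only [List.foldl_nil, sz_pair, sz_nil]; omega
    | cons b l ih =>
      intro rows acc
      have h₁ := ih (rows.map List.tail) ((b, rows.map fun r => r.headD 0) :: acc)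
      have h₂ := htail rows
      have h₃ := hhead rows
      have h₄ : (sz l + 1) * (sz (rows.map List.tail) + 2) ≤ (sz l + 1) * (sz rows + 2) :=
        Nat.mul_le_mul_left _ (by omega)
      have h₅ : sz b * 1 ≤ sz b * (sz rows + 2) := Nat.mul_le_mul_left _ (by omega)
      simp only [List.foldl_cons, sz_cons, sz_pair, Nat.add_mul] at *
      omega
  have : PT fun a => (l a).foldl (fun (s : List (List ℕ) × List (β × List ℕ)) b =>
      (s.1.map List.tail, (b, s.1.map fun r => r.headD 0) :: s.2)) (rows a, []) := by
    refine PT.foldl hl (by fun_prop) (by fun_prop)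
      ⟨fun a => (sz (l a) + 1) * (sz (rows a) + 2) + 1, ?_, fun a l' hl' => ?_⟩
    · exact ((hl.polyBd.add (.const _ 1)).mul (hr.polyBd.add (.const _ 2))).add (.const _ 1)
    · refine (hb l' (rows a) []).trans ?_
      rw [sz_nil]
      exact Nat.add_le_add_right (Nat.mul_le_mul_right _
        (Nat.add_le_add_right (sz_le_of_prefix hl') _)) _
  have h := (this.snd).reverse
  simpa only [key, List.append_nil, List.reverse_reverse] using h

attribute [fun_prop] PT.cols

@[fun_prop] theorem PT.free {α : Type} [Enc α] {I : α → Inst} (hI : PT I) :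
    PT fun a => (I a).free := by
  unfold Inst.free
  fun_prop

@[fun_prop] theorem PT.seqOf {α : Type} [Enc α] {us : α → List (List ℕ)} {t : α → Term}
    (hus : PT us) (ht : PT t) : PT fun a => seqOf (us a) (t a) := by
  unfold Nexus.seqOf
  exact PT.tcase ht (by fun_prop) (by simp only [id_eq]; fun_prop)

@[fun_prop] theorem PT.isConst {α : Type} [Enc α] {s : α → List ℕ} (hs : PT s) :
    PT fun a => isConst (s a) := by
  unfold Nexus.isConst
  fun_prop

@[fun_prop] theorem PT.okTerm {α : Type} [Enc α] {us Fr : α → List (List ℕ)} {t : α → Term}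
    (hus : PT us) (hF : PT Fr) (ht : PT t) : PT fun a => okTerm (us a) (Fr a) (t a) := by
  unfold Nexus.okTerm
  exact PT.tcase ht (by fun_prop) (by fun_prop)

@[fun_prop] theorem PT.test {α : Type} [Enc α] {I : α → Inst} {β : α → Atom Term}
    (hI : PT I) (hβ : PT β) : PT fun a => (I a).test (β a) := by
  unfold Inst.test
  fun_prop

@[fun_prop] theorem PT.share {α : Type} [Enc α] {β γ : α → Atom Term} (hβ : PT β) (hγ : PT γ) :
    PT fun a => share (β a) (γ a) := by
  unfold Nexus.share
  fun_prop

@[fun_prop] theorem PT.isFree {α : Type} [Enc α] {Fr : α → List (List ℕ)} {β : α → Atom Term}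
    (hF : PT Fr) (hβ : PT β) : PT fun a => isFree (Fr a) (β a) := by
  unfold Nexus.isFree
  fun_prop

/-! ### Reading an instance -/

/-- Read the dataset, the theory and the unit, and compute the summaries with the function `g`. -/
def readInst (g : List Bool → List Bool) (x : List Bool) : Inst :=
  ((parseList (parseList parseNat) (parseList parseBit (parseList (parseAtom parseNat) x).2).2).1,
    (parseList (parseList parseNat) (parseList parseBit (parseList (parseAtom parseNat) x).2).2).1.map
      fun τ => (parseList (parseAtom parseNat) (g (encKB (parseList (parseAtom parseNat) x).1
        (parseList parseBit (parseList (parseAtom parseNat) x).2).1 ++ encTuple τ))).1)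

theorem PT.readInst {g : List Bool → List Bool} (hg : PT g) : PT (readInst g) := by
  have h₁ := IsParser.nat.list.list.pt
  have h₂ := IsParser.nat.atoms.pt
  have h₃ := IsParser.bit.list.pt
  unfold Nexus.readInst
  fun_prop

theorem readInst_spec {models : Semantics} {ς : Selector models} {K : KB} {g : List Bool → List Bool}
    {l : List (Atom ℕ)} {us : List (List ℕ)} (hus : us ≠ [])
    (h : ∀ τ ∈ us, ∃ l', Lists l' (ς.sel K τ : Set (Atom ℕ)) ∧
      g (encKB l K.O ++ encTuple τ) = encAtoms encNat l') :
    (readInst g (encKB l K.O ++ encList encTuple us)).1 = us ∧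
      (readInst g (encKB l K.O ++ encList encTuple us)).Spec (ς.sel K) := by
  have h₁ : parseList (parseAtom parseNat) (encKB l K.O ++ encList encTuple us) =
      (l, encStr K.O ++ encList encTuple us) := by
    rw [encKB, List.append_assoc]
    exact IsParser.nat.atoms.spec _ _
  have h₂ : parseList parseBit (encStr K.O ++ encList encTuple us) = (K.O, encList encTuple us) :=
    IsParser.bit.list.spec _ _
  have h₃ : parseList (parseList parseNat) (encList encTuple us) = (us, []) := by
    have := IsParser.nat.list.list.spec us []
    rwa [List.append_nil] at this
  have h₀ : (readInst g (encKB l K.O ++ encList encTuple us)).1 = us := by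
    simp only [readInst, h₁, h₂, h₃]
  refine ⟨h₀, by rwa [h₀], ?_⟩
  rw [h₀]
  simp only [readInst, h₁, h₂, h₃, List.forall₂_map_right_iff]
  rw [List.forall₂_same]
  intro τ hτ
  obtain ⟨l', hl', e⟩ := h τ hτ
  have := IsParser.nat.atoms.spec l' []
  rw [List.append_nil] at this
  rw [e, this]
  exact hl'

end Nexus

/-! ### The medium case: listing candidates and saturating -/

namespace Nexus

/-! ### The algorithm for units of bounded size -/

/-- The tuples of length at most `k` over a list. -/
def tuples {β : Type} : ℕ → List β → List (List β)
  | 0, _ => [[]]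
  | k + 1, l => [] :: l.flatMap fun a => (tuples k l).map fun t => a :: t

theorem mem_tuples {β : Type} {k : ℕ} {l t : List β} :
    t ∈ tuples k l ↔ t.length ≤ k ∧ ∀ a ∈ t, a ∈ l := by
  induction k generalizing t with
  | zero => rcases t with _ | ⟨a, t⟩ <;> simp [tuples]
  | succ k ih =>
    rcases t with _ | ⟨a, t⟩
    · simp [tuples]
    · simp only [tuples, List.mem_cons, List.mem_flatMap, List.mem_map, ih, List.length_cons]
      constructor
      · rintro (h | ⟨b, hb, s, ⟨hs, hs'⟩, h⟩)
        · simp at h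
        · obtain ⟨rfl, rfl⟩ := List.cons.inj h
          refine ⟨by omega, ?_⟩
          rintro c (rfl | hc)
          exacts [hb, hs' c hc]
      · rintro ⟨h, h'⟩
        exact .inr ⟨a, h' a (.inl rfl), t, ⟨by omega, fun c hc => h' c (.inr hc)⟩, rfl⟩

-- The exponent `k` is a constant of the algorithm. This is where bounds on the arity and on the
-- number of tuples are needed.
@[fun_prop] theorem PT.tuples {α β : Type} [Enc α] [Enc β] {l : α → List β} (k : ℕ) (hl : PT l) :
    PT fun a => tuples k (l a) := by
  induction k with
  | zero => exact PT.const _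
  | succ k ih =>
    exact PT.cons (PT.const _) (PT.flatMap hl
      (PT.map (ih.comp (f := fun p : α × β => p.1) PT.fst') (by fun_prop)))

section

variable {β : Type} [DecidableEq β]

/-- Remove repeated elements. -/
def uniq (l : List β) : List β :=
  l.foldl (fun acc a => bif decide (a ∈ acc) then acc else a :: acc) []

theorem foldl_uniq (l acc : List β) (h : acc.Nodup) :
    (l.foldl (fun acc a => bif decide (a ∈ acc) then acc else a :: acc) acc).Nodup ∧
    ∀ a, a ∈ l.foldl (fun acc a => bif decide (a ∈ acc) then acc else a :: acc) acc ↔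
      a ∈ l ∨ a ∈ acc := by
  induction l generalizing acc with
  | nil => simpa using h
  | cons b l ih =>
    rw [List.foldl_cons]
    by_cases hb : b ∈ acc
    · rw [decide_eq_true hb, cond_true]
      refine ⟨(ih acc h).1, fun a => ?_⟩
      rw [(ih acc h).2, List.mem_cons]
      constructor
      · tauto
      · rintro ((rfl | h) | h) <;> tauto
    · rw [decide_eq_false hb, cond_false]
      have h' : (b :: acc).Nodup := List.nodup_cons.2 ⟨hb, h⟩
      refine ⟨(ih _ h').1, fun a => ?_⟩
      rw [(ih _ h').2, List.mem_cons, List.mem_cons]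
      tauto

theorem nodup_uniq (l : List β) : (uniq l).Nodup := (foldl_uniq l [] List.nodup_nil).1

theorem mem_uniq {l : List β} {a : β} : a ∈ uniq l ↔ a ∈ l := by
  rw [uniq, (foldl_uniq l [] List.nodup_nil).2]
  simp

theorem sz_foldl_uniq_le [Enc β] (l acc : List β) :
    sz (l.foldl (fun acc a => bif decide (a ∈ acc) then acc else a :: acc) acc) ≤ sz l + sz acc := by
  induction l generalizing acc with
  | nil => simp
  | cons b l ih =>
    have h₁ := ih acc
    have h₂ := ih (b :: acc)
    rw [sz_cons] at h₂
    rw [List.foldl_cons, sz_cons]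
    by_cases hb : b ∈ acc
    · rw [decide_eq_true hb, cond_true]
      omega
    · rw [decide_eq_false hb, cond_false]
      omega

@[fun_prop] theorem PT.uniq {α : Type} [Enc α] [Enc β] {l : α → List β} (hl : PT l) :
    PT fun a => uniq (l a) := by
  refine PT.foldl hl (by fun_prop) (by fun_prop)
    ⟨_, hl.polyBd.add (.const _ 1), fun a l' hl' => ?_⟩
  have := sz_foldl_uniq_le l' []
  have := sz_le_of_prefix hl'
  simp only [sz_nil] at *
  omega

end

/-- The constants that occur in the summaries. -/
def Inst.consts (I : Inst) : List ℕ := I.2.flatMap fun l => l.flatMap fun a => a.args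

/-- Candidates for the terms, when there are at most `b` tuples. -/
def Inst.terms (b : ℕ) (I : Inst) : List Term :=
  (I.consts.map fun c => Term.const c) ++ (tuples b I.consts).map fun s => Term.var s

/-- Candidates for the atoms, when there are at most `b` tuples and the arity is at most `ω`. -/
def Inst.candidates (b ω : ℕ) (I : Inst) : List (Atom Term) :=
  (I.2.flatMap fun l => l.map fun a => a.name).flatMap fun p =>
    (tuples ω (I.terms b)).map fun ts => ⟨p, ts⟩

/-- The atoms obtained from the product. -/
def Inst.atoms (b ω : ℕ) (I : Inst) : List (Atom Term) :=
  uniq ((I.candidates b ω).filter fun β => I.test β)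

/-- The atoms in which a free variable occurs or that are linked to an atom of `C`. -/
def linkStep (Fr : List (List ℕ)) (Φ C : List (Atom Term)) : List (Atom Term) :=
  Φ.filter fun β => isFree Fr β || C.any fun γ => share β γ

/-- The atoms that are connected to a free variable. -/
def linked (Fr : List (List ℕ)) (Φ : List (Atom Term)) : List (Atom Term) :=
  Φ.foldl (fun C _ => linkStep Fr Φ C) []

theorem linked_eq (Fr : List (List ℕ)) (Φ : List (Atom Term)) :
    linked Fr Φ = (linkStep Fr Φ)^[Φ.length] [] := by
  rw [linked, List.foldl_const]

theorem linkStep_iterate_sublist (Fr : List (List ℕ)) (Φ : List (Atom Term)) (k : ℕ) :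
    ((linkStep Fr Φ)^[k] []).Sublist ((linkStep Fr Φ)^[k + 1] []) := by
  induction k with
  | zero => exact List.nil_sublist _
  | succ k ih =>
    rw [Function.iterate_succ_apply', Function.iterate_succ_apply' _ (k + 1)]
    refine List.monotone_filter_right _ fun β hβ => ?_
    simp only [Bool.or_eq_true, List.any_eq_true] at hβ ⊢
    exact hβ.imp_right fun ⟨γ, hγ, h⟩ => ⟨γ, ih.subset hγ, h⟩

/-- The iterates form an increasing chain of sublists of `Φ`, so their lengths become stationary
after at most `Φ.length` rounds, and a sublist of equal length is equal. -/
theorem linkStep_linked (Fr : List (List ℕ)) (Φ : List (Atom Term)) :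
    linkStep Fr Φ (linked Fr Φ) = linked Fr Φ := by
  have hb : ∀ k, ((linkStep Fr Φ)^[k] []).length ≤ Φ.length := by
    rintro (_ | k)
    · simp
    · rw [Function.iterate_succ_apply']
      exact List.length_filter_le _ _
  have := Nat.stabilises_of_monotone (f := fun k => ((linkStep Fr Φ)^[k] []).length)
    (b := Φ.length) (n := Φ.length + 1)
    (monotone_nat_of_le_succ fun k => (linkStep_iterate_sublist Fr Φ k).length_le) hb
    (fun k hk => ?_) (Nat.le_succ _)
  · rw [linked_eq, ← Function.iterate_succ_apply' (linkStep Fr Φ)]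
    exact ((linkStep_iterate_sublist Fr Φ _).eq_of_length this.symm).symm
  · have e := (linkStep_iterate_sublist Fr Φ k).eq_of_length hk
    show _ = ((linkStep Fr Φ)^[k + 1 + 1] []).length
    rw [Function.iterate_succ_apply' _ (k + 1), ← e, ← Function.iterate_succ_apply' (linkStep Fr Φ) k,
      ← e]

theorem mem_linked {Fr : List (List ℕ)} {Φ : List (Atom Term)} {β : Atom Term} :
    β ∈ linked Fr Φ ↔ Linked {β | β ∈ Φ} Fr β := by
  constructor
  · rw [linked_eq]
    generalize Φ.length = k
    induction k generalizing β with
    | zero => simp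
    | succ k ih =>
      rw [Function.iterate_succ_apply', linkStep, List.mem_filter, Bool.or_eq_true,
        List.any_eq_true]
      rintro ⟨hβ, h | ⟨γ, hγ, h⟩⟩
      · exact .base hβ h
      · exact .step hβ h (ih hγ)
  · intro h
    induction h with
    | base hβ h =>
      rw [← linkStep_linked, linkStep, List.mem_filter, h]
      exact ⟨hβ, rfl⟩
    | step hβ h _ ih =>
      rw [← linkStep_linked, linkStep, List.mem_filter, Bool.or_eq_true, List.any_eq_true]
      exact ⟨hβ, .inr ⟨_, ih, h⟩⟩

theorem nodup_linked {Fr : List (List ℕ)} {Φ : List (Atom Term)} (h : Φ.Nodup) :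
    (linked Fr Φ).Nodup := by
  rw [← linkStep_linked]
  exact h.filter _

@[fun_prop] theorem PT.linked {α : Type} [Enc α] {Fr : α → List (List ℕ)}
    {Φ : α → List (Atom Term)} (hF : PT Fr) (hΦ : PT Φ) : PT fun a => linked (Fr a) (Φ a) := by
  unfold Nexus.linked
  refine PT.foldl hΦ (by fun_prop) (by unfold linkStep; fun_prop)
    ⟨_, hΦ.polyBd, fun a l' _ => ?_⟩
  rw [List.foldl_const]
  rcases l'.length with _ | k
  · exact sz_pos (Φ a)
  · rw [Function.iterate_succ_apply']
    exact sz_le_of_sublist List.filter_sublist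

@[fun_prop] theorem PT.atoms {α : Type} [Enc α] {I : α → Inst} (b ω : ℕ) (hI : PT I) :
    PT fun a => (I a).atoms b ω := by
  have hc : PT fun I : Inst => I.consts := by
    unfold Inst.consts
    fun_prop
  have ht : PT fun I : Inst => I.terms b := by
    unfold Inst.terms
    fun_prop
  have : PT fun I : Inst => I.candidates b ω := by
    unfold Inst.candidates
    fun_prop
  unfold Inst.atoms
  fun_prop

theorem Inst.Spec.length_eq {I : Inst} {sel : List ℕ → Finset (Atom ℕ)} (h : I.Spec sel) :
    I.1.length = I.2.length := h.2.length_eq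

theorem okTerm_length {us Fr : List (List ℕ)} {t : Term} (h : okTerm us Fr t = true) :
    (seqOf us t).length = us.length := by
  rcases t with c | s
  · simp [seqOf, tcase]
  · simp only [okTerm, tcase, Bool.and_eq_true, decide_eq_true_eq] at h
    simpa [seqOf, tcase] using congrArg List.length h.1

theorem Inst.test_iff {I : Inst} {β : Atom Term} :
    I.test β = true ↔ (∀ t ∈ β.args, okTerm I.1 I.free t = true) ∧
      ∀ i (h : i < I.2.length),
        (⟨β.name, β.args.map fun t => (seqOf I.1 t).getD i 0⟩ : Atom ℕ) ∈ I.2[i] := by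
  simp only [Inst.test, Bool.and_eq_true, List.all_eq_true, cols_eq, List.map_map, List.mem_map,
    decide_eq_true_eq]
  refine and_congr_right fun _ => ?_
  constructor
  · intro H i hi
    exact H _ ⟨(I.2[i], i), List.mk_mem_zipIdx_iff_getElem?.2 (by simp [hi]), rfl⟩
  · rintro H _ ⟨⟨l, i⟩, hp, rfl⟩
    obtain ⟨hi, hl⟩ := List.mem_zipIdx' hp
    dsimp only
    rw [hl]
    exact H i hi

theorem Inst.Spec.seqOf_mem {I : Inst} {sel : List ℕ → Finset (Atom ℕ)} (h : I.Spec sel)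
    {β : Atom Term} (hβ : I.test β = true) {t : Term} (ht : t ∈ β.args) :
    (seqOf I.1 t).length = I.1.length ∧ ∀ c ∈ seqOf I.1 t, c ∈ I.consts := by
  obtain ⟨hok, hproj⟩ := Inst.test_iff.1 hβ
  have hlen := okTerm_length (hok t ht)
  refine ⟨hlen, fun c hc => ?_⟩
  obtain ⟨i, hi, rfl⟩ := List.getElem_of_mem hc
  rw [hlen, h.length_eq] at hi
  refine List.mem_flatMap.2 ⟨_, List.getElem_mem hi, List.mem_flatMap.2 ⟨_, hproj i hi,
    List.mem_map.2 ⟨t, ht, ?_⟩⟩⟩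
  rw [List.getD_eq_getElem]

/-- The unit is nonempty, so the first projection exists; it shows that predicate name and arity
already occur in a summary. -/
theorem Inst.Spec.exists_proj {I : Inst} {sel : List ℕ → Finset (Atom ℕ)} (h : I.Spec sel)
    {β : Atom Term} (hβ : I.test β = true) :
    ∃ l ∈ I.2, ∃ a ∈ l, a.name = β.name ∧ a.args.length = β.args.length := by
  obtain ⟨hok, hproj⟩ := Inst.test_iff.1 hβ
  have hpos : 0 < I.2.length := h.length_eq ▸ List.length_pos_of_ne_nil h.1
  exact ⟨_, List.getElem_mem hpos, _, hproj 0 hpos, rfl, by simp⟩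

theorem Inst.Spec.mem_atoms {I : Inst} {sel : List ℕ → Finset (Atom ℕ)} (h : I.Spec sel) {b ω : ℕ}
    (hb : I.1.length ≤ b) (hω : ∀ l ∈ I.2, ∀ a ∈ l, a.args.length ≤ ω) {β : Atom Term} :
    β ∈ I.atoms b ω ↔ β ∈ allAtoms sel I.1 := by
  rw [h.mem_allAtoms, Inst.atoms, mem_uniq, List.mem_filter]
  refine ⟨fun h => h.2, fun hβ => ⟨?_, hβ⟩⟩
  obtain ⟨l, hl, a, ha, hname, hargs⟩ := h.exists_proj hβ
  refine List.mem_flatMap.2 ⟨β.name, List.mem_flatMap.2 ⟨l, hl, List.mem_map.2 ⟨a, ha, hname⟩⟩,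
    List.mem_map.2 ⟨β.args, mem_tuples.2 ⟨hargs ▸ hω l hl a ha, fun t ht => ?_⟩, rfl⟩⟩
  obtain ⟨hlen, hmem⟩ := h.seqOf_mem hβ ht
  rcases t with c | s
  · refine List.mem_append_left _ (List.mem_map.2 ⟨c, hmem c ?_, rfl⟩)
    have := h.1
    simpa [seqOf, tcase] using this
  · exact List.mem_append_right _ (List.mem_map.2 ⟨s, mem_tuples.2 ⟨hlen.le.trans hb, hmem⟩, rfl⟩)

/-- Atoms of a summary are entailed or of the form `⊤(t)`; the latter account for the maximum with
1. -/
theorem arity_le_of_mem_sel {models : Semantics} {ς : Selector models} {K : KB} {ω : ℕ}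
    (hω : ArityLE models K ω) {τ : List ℕ} (hτ : IsTupleOver models K τ) {a : Atom ℕ}
    (ha : a ∈ ς.sel K τ) : a.args.length ≤ max ω 1 := by
  rcases ς.subset K τ hτ ha with h | ⟨t, _, rfl⟩
  · exact (hω a (.inr h)).trans (le_max_left _ _)
  · exact le_max_right _ _

/-- The function that reads the instance and computes the canonical characterization. -/
theorem Medium.exists_fp {models : Semantics} {ς : Selector models} {I : Set (KB × Finset (List ℕ))}
    (h : Medium ς I) : ∃ f, FP f ∧ SolvesCAN ς I f := by
  obtain ⟨b, hb⟩ := h.card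
  obtain ⟨ω, hω⟩ := h.arity
  obtain ⟨g, hg, hsel⟩ := h.sel
  have hread := PT.readInst hg.pt
  refine ⟨fun x => encFormula (readInst g x).free
    (linked (readInst g x).free ((readInst g x).atoms b (max ω 1))), PT.fp ?_, ?_⟩
  · have ht : PT fun t => encTuple t := PT.encTuple PT.id
    have ht' : PT fun t => encTerm t := PT.encTerm PT.id
    unfold encFormula
    fun_prop
  · intro K U hKU l us hl hus
    obtain ⟨hne, -, hover⟩ := h.unitOver K U hKU
    have hus' : us ≠ [] := by
      rintro rfl
      obtain ⟨τ, hτ⟩ := hne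
      simpa using (hus.2 τ).2 hτ
    have hτ : ∀ τ ∈ us, IsTupleOver models K τ := fun τ hτ => hover τ ((hus.2 τ).1 hτ)
    obtain ⟨h₁, hspec⟩ := readInst_spec (ς := ς) (K := K) (g := g) (l := l) hus' fun τ hτ' =>
      hsel K ⟨_, hKU, rfl⟩ τ (hτ τ hτ') l hl
    dsimp only
    generalize readInst g (encKB l K.O ++ encList encTuple us) = J at h₁ hspec
    subst h₁
    have hcard : J.1.length ≤ b := by
      refine le_trans ?_ (hb K U hKU)
      rw [← List.toFinset_card_of_nodup hus.1]
      exact Finset.card_le_card fun τ hτ => (hus.2 τ).1 (List.mem_toFinset.1 hτ)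
    have harity : ∀ l ∈ J.2, ∀ a ∈ l, a.args.length ≤ max ω 1 := by
      intro l hl a ha
      obtain ⟨i, hi, rfl⟩ := List.getElem_of_mem hl
      have hi' : i < J.1.length := by rw [hspec.length_eq]; exact hi
      exact arity_le_of_mem_sel (hω K U hKU) (hτ _ (List.getElem_mem hi'))
        (((hspec.2.get (i := i) hi' hi).2 _).1 ha)
    refine ⟨linked J.free (J.atoms b (max ω 1)), ⟨nodup_linked (nodup_uniq _), fun β => ?_⟩,
      by rw [J.free_eq]⟩
    rw [mem_linked, mem_canAtoms_iff, J.free_eq]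
    simp only [hspec.mem_atoms hcard harity]
    rfl

end Nexus

/-! ### The broad case: atoms as bit vectors of polynomial length -/

namespace Nexus

/-! ### The algorithm in polynomial space -/

theorem length_encList_le {β : Type} {e : β → List Bool} {l : List β} {k : ℕ}
    (h : ∀ a ∈ l, (e a).length ≤ k) : (encList e l).length ≤ l.length * (k + 1) + 1 := by
  induction l with
  | nil => simp [encList]
  | cons a l ih =>
    have h₁ := ih fun a ha => h a (List.mem_cons_of_mem _ ha)
    have h₂ := h a (by simp)
    simp only [encList, List.flatMap_cons, List.length_append, List.length_cons, Nat.add_mul] at *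
    omega

theorem length_le_encList {β : Type} {e : β → List Bool} {l : List β} {a : β} (h : a ∈ l) :
    (e a).length ≤ (encList e l).length := by
  obtain ⟨s, t, rfl⟩ := List.append_of_mem h
  simp only [encList, List.flatMap_append, List.flatMap_cons, List.length_append, List.length_cons]
  omega

theorem card_le_length_encList {β : Type} (e : β → List Bool) (l : List β) :
    l.length ≤ (encList e l).length := by
  induction l with
  | nil => simp
  | cons a l ih =>
    simp only [encList, List.flatMap_cons, List.length_append, List.length_cons] at *
    omega

/-- The summaries as one string. -/
def Inst.text (I : Inst) : List Bool := encAtoms encNat I.2.flatten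

/-- A list whose length is that of the vectors that represent atoms. -/
def Inst.unary (I : Inst) : List Bool :=
  -- Room for the code of any atom of the product and a leading bit: `I.text` covers the name and
  -- also bounds the number of arguments, and the inner block covers the code of a sequence of
  -- constants.
  true :: true :: I.text ++
    I.text.flatMap fun _ => true :: true :: true :: I.1.flatMap fun _ => true :: I.text

theorem Inst.length_unary (I : Inst) : I.unary.length =
    2 + I.text.length + I.text.length * (3 + I.1.length * (1 + I.text.length)) := by
  simp only [Inst.unary, List.length_append, List.length_cons, List.length_flatMap, List.map_const',
    List.sum_replicate, smul_eq_mul]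
  ring

theorem Inst.length_encAtom {I : Inst} {sel : List ℕ → Finset (Atom ℕ)} (h : I.Spec sel)
    {β : Atom Term} (hβ : I.test β = true) :
    (encAtom encTerm β).length + 1 ≤ I.unary.length := by
  have hatom : ∀ l ∈ I.2, ∀ a ∈ l, (encAtom encNat a).length ≤ I.text.length := fun l hl a ha =>
    length_le_encList (e := encAtom encNat) (List.mem_flatten.2 ⟨l, hl, ha⟩)
  have hconst : ∀ c ∈ I.consts, (encNat c).length ≤ I.text.length := by
    intro c hc
    obtain ⟨l, hl, hc⟩ := List.mem_flatMap.1 hc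
    obtain ⟨a, ha, hc⟩ := List.mem_flatMap.1 hc
    refine le_trans (length_le_encList hc) (le_trans ?_ (hatom l hl a ha))
    simp [encAtom]
  obtain ⟨l, hl, a, ha, hname, hargs⟩ := h.exists_proj hβ
  have h₁ := hatom l hl a ha
  rw [encAtom, List.length_append, hname] at h₁
  have h₂ := card_le_length_encList encNat a.args
  have hterm : ∀ t ∈ β.args,
      (encTerm t).length ≤ 2 + I.1.length * (1 + I.text.length) := by
    intro t ht
    obtain ⟨hlen, hmem⟩ := h.seqOf_mem hβ ht
    rcases t with c | s
    · have := hconst c (hmem c (by simpa [seqOf, tcase] using h.1))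
      have hpos : 0 < I.1.length := List.length_pos_of_ne_nil h.1
      have : 1 * (1 + I.text.length) ≤ I.1.length * (1 + I.text.length) :=
        Nat.mul_le_mul_right _ hpos
      rw [encTerm, List.length_cons]
      omega
    · have := length_encList_le (e := encNat) (l := s) fun c hc => hconst c (hmem c hc)
      rw [show s.length = I.1.length from hlen] at this
      rw [encTerm, List.length_cons, encTuple, Nat.add_comm 1 (List.length _)]
      omega
  have h₃ := length_encList_le hterm
  have h₄ : β.args.length * (2 + I.1.length * (1 + I.text.length) + 1) ≤
      I.text.length * (3 + I.1.length * (1 + I.text.length)) := by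
    refine Nat.mul_le_mul (by omega) (by omega)
  rw [encAtom, List.length_append, I.length_unary]
  omega

/-- The atom that a vector represents. -/
def atomOf (u : List Bool) : Atom Term := (parseAtom parseTerm u.tail).1

/-- The vector consists of the bit `true`, the code of an atom obtained from the product, and bits
`false`. -/
def Inst.valid (I : Inst) (u : List Bool) : Bool :=
  I.test (atomOf u) && decide (u = true :: (encAtom encTerm (atomOf u) ++
    (parseAtom parseTerm u.tail).2.map fun _ => false))

/-- The vectors represent linked atoms, or the first one represents an atom in which a free variable
occurs, and the second one is empty. -/
def Inst.edge (I : Inst) (u v : List Bool) : Bool :=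
  I.valid u && (bif v.isEmpty then isFree I.free (atomOf u)
    else I.valid v && share (atomOf u) (atomOf v))

/-- The vector of length `n` that represents an atom. -/
def node (n : ℕ) (β : Atom Term) : List Bool :=
  true :: (encAtom encTerm β ++ List.replicate (n - ((encAtom encTerm β).length + 1)) false)

theorem atomOf_node (n : ℕ) (β : Atom Term) : atomOf (node n β) = β := by
  rw [atomOf, node, List.tail_cons, IsParser.term.atom.spec]

theorem length_node {n : ℕ} {β : Atom Term} (h : (encAtom encTerm β).length + 1 ≤ n) :
    (node n β).length = n := by
  simp only [node, List.length_cons, List.length_append, List.length_replicate]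
  omega

theorem Inst.valid_node {I : Inst} {β : Atom Term} (h : I.test β = true) (n : ℕ) :
    I.valid (node n β) = true := by
  rw [Inst.valid, atomOf_node, h, node, List.tail_cons, IsParser.term.atom.spec]
  simp

/-- A valid vector is determined by its length and its atom, so the enumeration meets each atom
once. -/
theorem Inst.valid_iff {I : Inst} {u : List Bool} : I.valid u = true ↔
    I.test (atomOf u) = true ∧ u = node u.length (atomOf u) := by
  constructor
  · intro h
    rw [Inst.valid, Bool.and_eq_true, decide_eq_true_eq] at h
    refine ⟨h.1, ?_⟩
    have hlen := congrArg List.length h.2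
    rw [List.length_cons, List.length_append, List.length_map] at hlen
    conv_lhs => rw [h.2]
    rw [node, List.map_const']
    congr 3
    omega
  · rintro ⟨h₁, h₂⟩
    rw [h₂]
    exact Inst.valid_node h₁ _

/-- Paths can be chosen to be short. -/
theorem Path.exists_le {E : List Bool → List Bool → Bool} {n j : ℕ} {u v : List Bool}
    (hv : v.length ≠ n) (h : Path E n j u v) : ∃ i ≤ 2 ^ n, Path E n i u v := by
  classical
  -- The vectors of length `n` with a path of at most `k` steps to `v`. This increasing chain lives
  -- in a set of `2 ^ n` elements.
  let S : ℕ → Finset (List Bool) := fun k =>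
    (allVec n).toFinset.filter fun u => ∃ i ≤ k, Path E n i u v
  have hcard : (allVec n).toFinset.card = 2 ^ n := by
    rw [List.toFinset_card_of_nodup (nodup_allVec n)]
    clear h hv S
    induction n with
    | zero => rfl
    | succ n ih => simp [allVec, List.length_flatMap, ih, pow_succ]
  have hmem : ∀ {k u}, u ∈ S k ↔ u.length = n ∧ ∃ i ≤ k, Path E n i u v := by
    simp [S, mem_allVec]
  have hmono : Monotone S := fun k l hkl u hu => by
    obtain ⟨hu, i, hi, h⟩ := hmem.1 hu
    exact hmem.2 ⟨hu, i, hi.trans hkl, h⟩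
  -- If nothing is new after `m + 1` steps, then nothing ever is. The target `v` is not of length
  -- `n`, so a first step into it is treated separately.
  have hstab : ∀ m, (S m).card = (S (m + 1)).card → (S (m + 1)).card = (S (m + 2)).card := by
    intro m hm
    have e := Finset.eq_of_subset_of_card_le (hmono (Nat.le_succ m)) hm.ge
    congr 1
    refine (hmono (Nat.le_succ _)).antisymm fun u hu => ?_
    obtain ⟨hu, i, hi, h⟩ := hmem.1 hu
    cases h with
    | refl => exact absurd hu hv
    | @step _ w _ j _ hE h =>
      by_cases hw : w.length = n
      · have : w ∈ S m := by
          rw [e]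
          exact hmem.2 ⟨hw, j, by omega, h⟩
        obtain ⟨-, i, hi, h⟩ := hmem.1 this
        exact hmem.2 ⟨hu, i + 1, by omega, .step hu hE h⟩
      · cases h with
        | refl => exact hmem.2 ⟨hu, 1, by omega, .step hu hE (.refl _)⟩
        | step hw' => exact absurd hw' hw
  by_cases hj : j ≤ 2 ^ n
  · exact ⟨j, hj, h⟩
  have hst := Nat.stabilises_of_monotone (f := fun k => (S k).card) (b := 2 ^ n) (n := j)
    (fun k l hkl => Finset.card_le_card (hmono hkl))
    (fun k => (Finset.card_le_card (Finset.filter_subset _ _)).trans hcard.le) hstab (by omega)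
  have hu : u.length = n := by
    cases h with
    | refl => exact absurd (Nat.zero_le _) hj
    | step hu => exact hu
  have : u ∈ S (2 ^ n) := by
    rw [Finset.eq_of_subset_of_card_le (hmono (not_le.1 hj).le) hst.le]
    exact hmem.2 ⟨hu, j, le_rfl, h⟩
  exact (hmem.1 this).2

theorem Inst.Spec.exists_path {I : Inst} {sel : List ℕ → Finset (Atom ℕ)} (h : I.Spec sel)
    {β : Atom Term} (hβ : Linked (allAtoms sel I.1) (tupleProd I.1) β) :
    ∃ j, Path I.edge I.unary.length j (node I.unary.length β) [] := by
  have hlen : ∀ {β}, β ∈ allAtoms sel I.1 → (node I.unary.length β).length = I.unary.length :=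
    fun hβ => length_node (Inst.length_encAtom h (h.mem_allAtoms.1 hβ))
  induction hβ with
  | base hβ hF =>
    refine ⟨1, .step (hlen hβ) ?_ (.refl _)⟩
    rw [Inst.edge, Inst.valid_node (h.mem_allAtoms.1 hβ), atomOf_node, I.free_eq, hF]
    rfl
  | @step β γ hβ hs hγ ih =>
    obtain ⟨j, hj⟩ := ih
    refine ⟨j + 1, .step (hlen hβ) ?_ hj⟩
    rw [Inst.edge, Inst.valid_node (h.mem_allAtoms.1 hβ), Inst.valid_node (h.mem_allAtoms.1 hγ.mem),
      atomOf_node, atomOf_node, hs]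
    rfl

/-- Each edge certifies its source as valid; an edge into the empty vector also certifies a free
variable, any other edge a shared term. -/
theorem Inst.Spec.linked_of_path {I : Inst} {sel : List ℕ → Finset (Atom ℕ)} (h : I.Spec sel)
    {n j : ℕ} {u : List Bool} (hu : u ≠ []) (hp : Path I.edge n j u []) :
    I.valid u = true ∧ Linked (allAtoms sel I.1) (tupleProd I.1) (atomOf u) := by
  generalize hv : ([] : List Bool) = v at hp
  induction hp with
  | refl => exact absurd hv.symm hu
  | @step u w v j _ hE hp ih =>
    rw [Inst.edge, Bool.and_eq_true] at hE
    refine ⟨hE.1, ?_⟩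
    have hmem := h.mem_allAtoms.2 (Inst.valid_iff.1 hE.1).1
    rcases w with _ | ⟨b, w⟩
    · have := hE.2
      rw [List.isEmpty_nil, cond_true, I.free_eq] at this
      exact .base hmem this
    · have := hE.2
      rw [List.isEmpty_cons, cond_false, Bool.and_eq_true] at this
      exact .step hmem this.2 (ih (by simp) hv).2

/-- `I.unary` serves both as vector length `n` and as recursion depth: depth `n` allows paths of `2
^ n` steps, which suffice for a graph with `2 ^ n` vectors besides the target. -/
theorem Inst.Spec.halving_iff {I : Inst} {sel : List ℕ → Finset (Atom ℕ)} (h : I.Spec sel)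
    {u : List Bool} (hu : u.length = I.unary.length) :
    halving I.edge I.unary.length I.unary u [] = true ↔
      atomOf u ∈ canAtoms sel I.1 ∧ u = node I.unary.length (atomOf u) := by
  have hpos : I.unary.length ≠ 0 := by rw [I.length_unary]; omega
  rw [Nexus.halving_iff _ hu, mem_canAtoms_iff]
  constructor
  · rintro ⟨j, -, hj⟩
    obtain ⟨hv, hl⟩ := h.linked_of_path (by rintro rfl; exact hpos hu.symm) hj
    exact ⟨hl, hu ▸ (Inst.valid_iff.1 hv).2⟩
  · rintro ⟨hl, e⟩
    obtain ⟨j, hj⟩ := h.exists_path hl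
    rw [e]
    exact hj.exists_le (by simpa using hpos.symm)

@[fun_prop] theorem PT.encAtom {α : Type} [Enc α] {β : α → Atom Term} (hβ : PT β) :
    PT fun a => Nexus.encAtom Nexus.encTerm (β a) := by
  have : PT fun t => Nexus.encTerm t := PT.encTerm PT.id
  unfold Nexus.encAtom
  fun_prop

@[fun_prop] theorem PT.atomOf {α : Type} [Enc α] {u : α → List Bool} (hu : PT u) :
    PT fun a => atomOf (u a) := PT.fst (IsParser.term.atom.pt.comp (PT.tail hu))

@[fun_prop] theorem PT.valid {α : Type} [Enc α] {I : α → Inst} {u : α → List Bool} (hI : PT I)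
    (hu : PT u) : PT fun a => (I a).valid (u a) := by
  have h : PT fun a => (parseAtom parseTerm (u a).tail).2 :=
    PT.snd (IsParser.term.atom.pt.comp (PT.tail hu))
  unfold Inst.valid
  exact PT.and (by fun_prop) (PT.decide_eq hu (PT.cons (PT.const _)
    (PT.append (by fun_prop) (PT.map h (by fun_prop)))))

theorem Broad.exists_fpspace {models : Semantics} {ς : Selector models}
    {I : Set (KB × Finset (List ℕ))} (h : Broad ς I) : ∃ f, FPSPACE f ∧ SolvesCAN ς I f := by
  obtain ⟨g, hg, hsel⟩ := h.sel
  have ht' : PT fun t => encTuple t := PT.encTuple PT.id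
  have hE : PT fun p : Inst × List Bool × List Bool => p.1.edge p.2.1 p.2.2 := by
    unfold Inst.edge
    fun_prop
  have hL : PT Inst.unary := by
    have : PT Inst.text := by
      have : PT fun I : Inst => encAtoms encNat (I.2.flatMap fun l => l) :=
        PT.encAtoms (by fun_prop) (by fun_prop)
      simp only [List.flatMap_id'] at this
      exact this
    unfold Inst.unary
    fun_prop
  have hpre : PT fun I : Inst => encList encTuple I.free := by fun_prop
  have hout : PT fun p : Inst × List Bool => true :: encAtom encTerm (atomOf p.2) := by fun_prop
  refine ⟨_, FPSPACE.enumerate (out := fun _ u => true :: encAtom encTerm (atomOf u))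
    (PT.readInst hg.pt) hL hE hout hpre, ?_⟩
  intro K U hKU l us hl hus
  obtain ⟨hne, -, hover⟩ := h.unitOver K U hKU
  have hus' : us ≠ [] := by
    rintro rfl
    obtain ⟨τ, hτ⟩ := hne
    simpa using (hus.2 τ).2 hτ
  obtain ⟨h₁, hspec⟩ := readInst_spec (ς := ς) (K := K) (g := g) (l := l) hus' fun τ hτ =>
    hsel K ⟨_, hKU, rfl⟩ τ (hover τ ((hus.2 τ).1 hτ)) l hl
  dsimp only
  generalize readInst g (encKB l K.O ++ encList encTuple us) = J at h₁ hspec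
  subst h₁
  -- The atoms in the order in which the machine writes them.
  refine ⟨((allVec J.unary.length).filter fun u =>
    halving J.edge J.unary.length J.unary u []).map atomOf, ⟨?_, fun β => ?_⟩, ?_⟩
  · refine List.Nodup.map_on ?_ ((nodup_allVec _).filter _)
    intro u hu v hv huv
    rw [List.mem_filter, mem_allVec] at hu hv
    rw [((hspec.halving_iff hu.1).1 hu.2).2, ((hspec.halving_iff hv.1).1 hv.2).2, huv]
  · simp only [List.mem_map, List.mem_filter, mem_allVec]
    constructor
    · rintro ⟨u, ⟨hu, h⟩, rfl⟩
      exact ((hspec.halving_iff hu).1 h).1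
    · intro hβ
      have hlen : (node J.unary.length β).length = J.unary.length :=
        length_node (Inst.length_encAtom hspec (hspec.mem_allAtoms.1 hβ.1))
      refine ⟨node J.unary.length β, ⟨hlen, ?_⟩, atomOf_node _ _⟩
      rw [hspec.halving_iff hlen, atomOf_node]
      exact ⟨hβ, rfl⟩
  · rw [encFormula, J.free_eq, encAtoms, encList, encList, List.flatMap_map]
    congr 2
    induction allVec J.unary.length with
    | nil => rfl
    | cons u l ih =>
      rw [List.flatMap_cons, List.filter_cons, ih]
      cases halving J.edge J.unary.length J.unary u []
      · rfl
      · rfl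

end Nexus

namespace Nexus

/-! ### The size of the canonical characterization -/

/-- The term is a variable. -/
def isVar (t : Term) : Bool := tcase t (fun _ => false) fun _ => true

/-- The only two terms with a common sequence are `x_s` and `c` for `s = (c,…,c)`, the two roles
that produce clones. -/
theorem seqOf_injective {us : List (List ℕ)} (hus : us ≠ []) {t t' : Term}
    (h : seqOf us t = seqOf us t') (h' : isVar t = isVar t') : t = t' := by
  rcases t with c | s <;> rcases t' with c' | s'
  · obtain ⟨τ, us, rfl⟩ := List.exists_cons_of_ne_nil hus
    simp only [seqOf, tcase, List.map_cons, List.cons.injEq] at h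
    rw [h.1]
  · simp [isVar, tcase] at h'
  · simp [isVar, tcase] at h'
  · rw [show s = s' from h]

theorem Inst.spec_toList {sel : List ℕ → Finset (Atom ℕ)} {us : List (List ℕ)} (hus : us ≠ []) :
    Inst.Spec (us, us.map fun τ => (sel τ).toList) sel := by
  refine ⟨hus, ?_⟩
  dsimp only
  rw [List.forall₂_map_right_iff, List.forall₂_same]
  exact fun τ _ => ⟨Finset.nodup_toList _, fun a => Finset.mem_toList⟩

theorem mem_allAtoms_iff {sel : List ℕ → Finset (Atom ℕ)} {us : List (List ℕ)} (hus : us ≠ [])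
    {β : Atom Term} : β ∈ allAtoms sel us ↔
      (∀ t ∈ β.args, okTerm us (tupleProd us) t = true) ∧ ∀ i (h : i < us.length),
        (⟨β.name, β.args.map fun t => (seqOf us t).getD i 0⟩ : Atom ℕ) ∈ sel us[i] := by
  rw [(Inst.spec_toList hus).mem_allAtoms, Inst.test_iff, Inst.free_eq]
  simp

/-- The projections of an atom, and the positions of its variables. -/
def projections (us : List (List ℕ)) (ω : ℕ) (β : Atom Term) :
    (Fin us.length → Atom ℕ) × (Fin ω → Bool) :=
  (fun i => ⟨β.name, β.args.map fun t => (seqOf us t).getD i 0⟩,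
    fun j => isVar (β.args.getD j (.const 0)))

/-- The projections give the sequence behind each argument coordinate by coordinate, and the bit of
the position decides between variable and constant. -/
theorem projections_injOn {sel : List ℕ → Finset (Atom ℕ)} {us : List (List ℕ)} (hus : us ≠ [])
    {ω : ℕ} (hω : ∀ τ ∈ us, ∀ a ∈ sel τ, a.args.length ≤ ω) :
    Set.InjOn (projections us ω) (allAtoms sel us) := by
  intro β hβ γ hγ h
  have hpos : 0 < us.length := List.length_pos_of_ne_nil hus
  rw [mem_allAtoms_iff hus] at hβ hγ
  have hproj := fun i => congrFun (congrArg Prod.fst h) i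
  have hvar := fun j => congrFun (congrArg Prod.snd h) j
  simp only [projections, Atom.mk.injEq] at hproj hvar
  have hlen : β.args.length = γ.args.length := by
    simpa using congrArg List.length (hproj ⟨0, hpos⟩).2
  have hβω : β.args.length ≤ ω := by simpa using hω _ (List.getElem_mem hpos) _ (hβ.2 0 hpos)
  ext1
  · exact (hproj ⟨0, hpos⟩).1
  · refine List.ext_getElem hlen fun j hj hj' => seqOf_injective hus ?_ ?_
    · refine List.ext_getElem ?_ fun i hi hi' => ?_
      · rw [okTerm_length (hβ.1 _ (List.getElem_mem _)), okTerm_length (hγ.1 _ (List.getElem_mem _))]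
      · have hi'' := hi
        rw [okTerm_length (hβ.1 _ (List.getElem_mem _))] at hi''
        have := congrArg (fun l => l[j]?) (hproj ⟨i, hi''⟩).2
        simpa [hj, hj', hi, hi'] using this
    · simpa [hj, hj'] using hvar ⟨j, by omega⟩

theorem canAtoms_bound {models : Semantics} (ς : Selector models) {K : KB} {U : Finset (List ℕ)}
    {ω : ℕ} (hU : UnitOver models K U) (hω : ArityLE models K ω) {us : List (List ℕ)}
    (hus : Lists us (U : Set (List ℕ))) : (canAtoms (ς.sel K) us).Finite ∧
      (canAtoms (ς.sel K) us).ncard ≤ 2 ^ ω * ∏ τ ∈ U, (ς.sel K τ).card := by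
  obtain ⟨⟨τ, hτ⟩, -, hover⟩ := hU
  have hne : us ≠ [] := by
    rintro rfl
    simpa using (hus.2 τ).2 hτ
  -- A constant of the tuple occurs in an entailed atom, which has arity at least 1; so the atoms
  -- `⊤(t)` do not enlarge the bound.
  have hω₁ : 1 ≤ ω := by
    obtain ⟨hτ', hdom⟩ := hover τ hτ
    obtain ⟨c, hc⟩ := List.exists_mem_of_ne_nil τ hτ'
    obtain ⟨a, ha, hca⟩ := hdom c hc
    exact (List.length_pos_of_mem hca).trans_le (hω a (.inr ha))
  have hlen : ∀ τ ∈ us, ∀ a ∈ ς.sel K τ, a.args.length ≤ ω := fun τ hτ a ha =>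
    (arity_le_of_mem_sel hω (hover τ ((hus.2 τ).1 hτ)) ha).trans (by simp [hω₁])
  have hinj := projections_injOn hne hlen
  let T : Finset ((Fin us.length → Atom ℕ) × (Fin ω → Bool)) :=
    (Fintype.piFinset fun i : Fin us.length => ς.sel K us[i]) ×ˢ Finset.univ
  have hmaps : ∀ β ∈ allAtoms (ς.sel K) us, projections us ω β ∈ (T : Set _) := by
    intro β hβ
    rw [mem_allAtoms_iff hne] at hβ
    simp only [T, Finset.mem_coe, Finset.mem_product, Fintype.mem_piFinset, Finset.mem_univ,
      and_true]
    exact fun i => hβ.2 i i.2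
  have hsub : canAtoms (ς.sel K) us ⊆ allAtoms (ς.sel K) us := fun β hβ => hβ.1
  have hcard : T.card = 2 ^ ω * ∏ τ ∈ U, (ς.sel K τ).card := by
    rw [Finset.card_product, Fintype.card_piFinset, Finset.card_univ, Fintype.card_fun,
      Fintype.card_bool, Fintype.card_fin, mul_comm]
    congr 1
    have : U = us.toFinset := by
      ext τ
      rw [List.mem_toFinset]
      exact (hus.2 τ).symm
    rw [this, List.prod_toFinset _ hus.1]
    exact Fin.prod_univ_fun_getElem us fun τ => (ς.sel K τ).card
  refine ⟨.subset (.of_injOn hmaps hinj T.finite_toSet) hsub, ?_⟩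
  rw [← hcard, ← Set.ncard_coe_finset]
  exact Set.ncard_le_ncard_of_injOn _ (fun β hβ => hmaps β (hsub hβ)) (hinj.mono hsub)
    T.finite_toSet

end Nexus

/-! ### The instances of the lower bound and their selector -/

namespace Nexus

/-! ### A summary selector for unions of cycles -/

/-- The zeros at the end of the binary representation of a number. -/
def zeros (n : ℕ) : List Bool :=
  (n.bits.foldl (fun s b => bif s.1 || b then (true, s.2) else (false, false :: s.2))
    (false, ([] : List Bool))).2

/-- The constants of the cycles: the number of zeros at the end tells the cycle. -/
def cst (i j : ℕ) : ℕ := 2 ^ i * (2 * j + 1)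

theorem bits_cst (i j : ℕ) : (cst i j).bits = List.replicate i false ++ true :: j.bits := by
  induction i with
  | zero => simp [cst, Nat.bit1_bits]
  | succ i ih =>
    have : cst (i + 1) j = 2 * cst i j := by rw [cst, cst, pow_succ']; ring
    rw [this, Nat.bit0_bits _ (by simp [cst]), ih]
    rfl

theorem zeros_cst (i j : ℕ) : zeros (cst i j) = List.replicate i false := by
  have h₁ : ∀ (l acc : List Bool), l.foldl
      (fun s b => bif s.1 || b then (true, s.2) else (false, false :: s.2)) (true, acc) =
        (true, acc) := by
    intro l acc
    induction l with
    | nil => rfl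
    | cons b l ih => rw [List.foldl_cons]; exact ih
  have h₂ : ∀ (i : ℕ) (acc l : List Bool), (List.replicate i false ++ l).foldl
      (fun s b => bif s.1 || b then (true, s.2) else (false, false :: s.2)) (false, acc) =
        l.foldl (fun s b => bif s.1 || b then (true, s.2) else (false, false :: s.2))
          (false, List.replicate i false ++ acc) := by
    intro i
    induction i with
    | zero => intros; rfl
    | succ i ih =>
      intro acc l
      rw [List.replicate_succ, List.cons_append, List.foldl_cons]
      refine (ih (false :: acc) l).trans ?_
      congr 2
      rw [List.append_cons, ← List.replicate_succ', List.replicate_succ]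
  rw [zeros, bits_cst, h₂, List.foldl_cons]
  simp [h₁]

/-- The cycle can be read off a constant in polynomial time, without any knowledge of primes; this
makes the selector feasible. -/
theorem zeros_cst_inj {i j i' j' : ℕ} : zeros (cst i j) = zeros (cst i' j') ↔ i = i' := by
  rw [zeros_cst, zeros_cst]
  exact List.replicate_left_inj

theorem cst_inj {i j i' j' : ℕ} : cst i j = cst i' j' ↔ i = i' ∧ j = j' := by
  constructor
  · intro h
    obtain rfl := zeros_cst_inj.1 (congrArg zeros h)
    have := Nat.eq_of_mul_eq_mul_left (Nat.pow_pos (by norm_num)) h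
    exact ⟨rfl, by omega⟩
  · rintro ⟨rfl, rfl⟩
    rfl

@[fun_prop] theorem PT.zeros {α : Type} [Enc α] {n : α → ℕ} (hn : PT n) :
    PT fun a => zeros (n a) := by
  have hb : ∀ (l : List Bool) (d : Bool) (acc : List Bool), sz (l.foldl
      (fun s b => bif s.1 || b then (true, s.2) else (false, false :: s.2)) (d, acc)) ≤
        4 * l.length + sz acc + 4 := by
    intro l
    induction l with
    | nil => intro d acc; have := sz_bool d; simp; omega
    | cons b l ih =>
      intro d acc
      rw [List.foldl_cons, List.length_cons]
      cases d || b
      · refine (ih false (false :: acc)).trans ?_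
        have := sz_bool false
        rw [sz_cons]
        omega
      · exact (ih true acc).trans (by omega)
  have hbits : PT fun a => (n a).bits := by fun_prop
  refine PT.snd (PT.foldl hbits (by fun_prop) (by fun_prop)
    ⟨fun a => 4 * sz (n a).bits + 5, ((PolyBd.const _ 4).mul hbits.polyBd).add (.const _ 5),
      fun a l' hl' => ?_⟩)
  refine (hb l' false []).trans ?_
  have := hl'.length_le.trans (length_le_sz _)
  rw [sz_nil]
  dsimp only
  omega

/-- All terms of the atom have as many zeros at the end as some constant of the tuple. -/
def sameZeros (τ : List ℕ) (a : Atom ℕ) : Bool :=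
  a.args.all fun t => τ.any fun s => decide (zeros t = zeros s)

theorem sameZeros_iff {τ : List ℕ} {a : Atom ℕ} :
    sameZeros τ a = true ↔ ∀ t ∈ a.args, ∃ s ∈ τ, zeros t = zeros s := by
  simp [sameZeros]

/-- The list of the atoms of the summary of a tuple in a database. -/
def zeroSummary (l : List (Atom ℕ)) (τ : List ℕ) : List (Atom ℕ) :=
  uniq ((l ++ l.flatMap fun a : Atom ℕ => a.args.map fun t => (⟨0, [t]⟩ : Atom ℕ)).filter fun a =>
    sameZeros τ a)

theorem mem_zeroSummary {l : List (Atom ℕ)} {τ : List ℕ} {a : Atom ℕ} :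
    a ∈ zeroSummary l τ ↔
      (a ∈ l ∨ ∃ b ∈ l, ∃ t ∈ b.args, a = topAtom t) ∧ ∀ t ∈ a.args, ∃ s ∈ τ, zeros t = zeros s := by
  rw [zeroSummary, mem_uniq, List.mem_filter, sameZeros_iff]
  refine and_congr_left fun _ => ?_
  simp only [List.mem_append, List.mem_flatMap, List.mem_map, topAtom]
  refine or_congr Iff.rfl (exists_congr fun b => and_congr Iff.rfl (exists_congr fun t =>
    and_congr Iff.rfl eq_comm))

theorem ent_databaseSemantics (K : KB) : ent databaseSemantics K = (K.D : Set (Atom ℕ)) := by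
  ext a
  exact ⟨fun h => h _ (Set.Subset.refl _), fun h M hM => hM h⟩

/-- The selector of the atoms all of whose terms have as many zeros at the end as some constant of
the tuple. -/
noncomputable def zeroSelector : Selector databaseSemantics where
  sel K τ := (zeroSummary K.D.toList τ).toFinset
  subset K τ _ := by
    intro a ha
    rw [Finset.mem_coe, List.mem_toFinset, mem_zeroSummary] at ha
    rw [ent_databaseSemantics]
    rcases ha.1 with h | ⟨b, hb, t, ht, rfl⟩
    · exact .inl (Finset.mem_toList.1 h)
    · exact .inr ⟨t, ⟨b, Finset.mem_toList.1 hb, ht⟩, rfl⟩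
  closed K τ _ := by
    refine Set.Subset.antisymm (Set.union_subset (Set.Subset.refl _) ?_) Set.subset_union_left
    rintro _ ⟨t, ⟨a, ha, hta⟩, rfl⟩
    rw [Finset.mem_coe, List.mem_toFinset, mem_zeroSummary] at ha ⊢
    refine ⟨.inr ?_, fun s hs => ha.2 s ?_⟩
    · rcases ha.1 with h | ⟨b, hb, t', ht', rfl⟩
      · exact ⟨a, h, t, hta, rfl⟩
      · obtain rfl : t = t' := by simpa [topAtom] using hta
        exact ⟨b, hb, t, ht', rfl⟩
    · obtain rfl : s = t := by simpa [topAtom] using hs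
      exact hta
  contains K τ hτ c hc := by
    obtain ⟨a, ha, hca⟩ := hτ.2 c hc
    rw [ent_databaseSemantics] at ha
    refine ⟨topAtom c, ?_, by simp [topAtom]⟩
    rw [Finset.mem_coe, List.mem_toFinset, mem_zeroSummary]
    refine ⟨.inr ⟨a, Finset.mem_toList.2 ha, c, hca, rfl⟩, fun s hs => ⟨c, hc, ?_⟩⟩
    obtain rfl : s = c := by simpa [topAtom] using hs
    rfl

theorem entPolyTime_databaseSemantics (Ks : Set KB) : EntPolyTime databaseSemantics Ks := by
  refine ⟨fun x => encAtoms encNat (parseList (parseAtom parseNat) x).1,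
    (PT.encAtoms (by fun_prop) (PT.fst IsParser.nat.atoms.pt)).fp, fun K _ l hl => ⟨l, ?_, ?_⟩⟩
  · rwa [ent_databaseSemantics]
  · dsimp only
    rw [encKB, IsParser.nat.atoms.spec]

theorem selPolyTime_zeroSelector (Ks : Set KB) : SelPolyTime zeroSelector Ks := by
  have h₁ : PT fun x : List Bool => (parseList (parseAtom parseNat) x).1 :=
    PT.fst IsParser.nat.atoms.pt
  have h₂ : PT fun x : List Bool => (parseList parseNat
      (parseList parseBit (parseList (parseAtom parseNat) x).2).2).1 :=
    PT.fst (IsParser.nat.list.pt.comp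
      (PT.snd (IsParser.bit.list.pt.comp (PT.snd IsParser.nat.atoms.pt))))
  have h₃ : PT fun p : List (Atom ℕ) × List ℕ => zeroSummary p.1 p.2 := by
    unfold zeroSummary sameZeros
    fun_prop
  refine ⟨fun x => encAtoms encNat (zeroSummary (parseList (parseAtom parseNat) x).1
    (parseList parseNat (parseList parseBit (parseList (parseAtom parseNat) x).2).2).1),
    (PT.encAtoms (by fun_prop) (h₃.comp (h₁.pair h₂))).fp, fun K _ τ _ l hl => ?_⟩
  refine ⟨zeroSummary l τ, ⟨nodup_uniq _, fun a => ?_⟩, ?_⟩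
  · have hmem : ∀ b, b ∈ l ↔ b ∈ K.D.toList := fun b => by rw [hl.2, Finset.mem_toList]; rfl
    show _ ↔ a ∈ (((zeroSummary K.D.toList τ).toFinset : Finset (Atom ℕ)) : Set (Atom ℕ))
    rw [Finset.mem_coe, List.mem_toFinset, mem_zeroSummary, mem_zeroSummary]
    simp only [hmem]
  · have e₁ : parseList (parseAtom parseNat) (encKB l K.O ++ encTuple τ) =
        (l, encStr K.O ++ encTuple τ) := by
      rw [encKB, List.append_assoc]
      exact IsParser.nat.atoms.spec _ _
    have e₂ : parseList parseBit (encStr K.O ++ encTuple τ) = (K.O, encTuple τ) :=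
      IsParser.bit.list.spec _ _
    have e₃ : parseList parseNat (encTuple τ) = (τ, []) := by
      have := IsParser.nat.list.spec τ []
      rwa [List.append_nil] at this
    simp only [e₁, e₂, e₃]

theorem mem_cycle {i : ℕ} {a : Atom ℕ} : a ∈ cycle cst i ↔ ∃ j < Nat.nth Nat.Prime i,
    a = ⟨1, [cst i j, cst i ((j + 1) % Nat.nth Nat.Prime i)]⟩ ∨ a = topAtom (cst i j) := by
  simp only [cycle, Finset.mem_union, Finset.mem_image, Finset.mem_range]
  constructor
  · rintro (⟨j, hj, rfl⟩ | ⟨j, hj, rfl⟩)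
    exacts [⟨j, hj, .inl rfl⟩, ⟨j, hj, .inr rfl⟩]
  · rintro ⟨j, hj, rfl | rfl⟩
    exacts [.inl ⟨j, hj, rfl⟩, .inr ⟨j, hj, rfl⟩]

theorem prime_nth_pos (i : ℕ) : 0 < Nat.nth Nat.Prime i := (Nat.prime_nth_prime i).pos

theorem mem_args_cycle {i : ℕ} {a : Atom ℕ} (h : a ∈ cycle cst i) :
    a.args ≠ [] ∧ ∀ t ∈ a.args, ∃ j < Nat.nth Nat.Prime i, t = cst i j := by
  obtain ⟨j, hj, rfl | rfl⟩ := mem_cycle.1 h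
  · refine ⟨by simp, fun t ht => ?_⟩
    rcases List.mem_pair.1 ht with rfl | rfl
    exacts [⟨j, hj, rfl⟩, ⟨_, Nat.mod_lt _ (prime_nth_pos i), rfl⟩]
  · exact ⟨by simp [topAtom], fun t ht => ⟨j, hj, by simpa [topAtom] using ht⟩⟩

theorem card_cycle (i : ℕ) : (cycle cst i).card = 2 * Nat.nth Nat.Prime i := by
  rw [cycle, Finset.card_union_of_disjoint, Finset.card_image_of_injective,
    Finset.card_image_of_injective, Finset.card_range]
  · omega
  · intro j j' h
    simpa [topAtom, cst_inj] using h
  · intro j j' h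
    simp only [Atom.mk.injEq, List.cons.injEq, cst_inj] at h
    exact h.2.1.2
  · rw [Finset.disjoint_left]
    simp only [Finset.mem_image, not_exists, not_and]
    rintro _ ⟨j, -, rfl⟩ j' - h
    simp [topAtom] at h

/-- An atom of cycle `i'` contains only constants with `i'` trailing zeros, and the cycles already
contain their atoms `⊤(t)`. -/
theorem zeroSelector_cycleKB {m : ℕ} (hm : 2 ≤ m) {i : ℕ} (hi : i < m) :
    zeroSelector.sel (cycleKB cst m hm) [cst i 0] = cycle cst i := by
  have hD : ∀ a, a ∈ (cycleKB cst m hm).D.toList ↔ ∃ i < m, a ∈ cycle cst i := by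
    simp [cycleKB]
  ext a
  show a ∈ (zeroSummary (cycleKB cst m hm).D.toList [cst i 0]).toFinset ↔ _
  rw [List.mem_toFinset, mem_zeroSummary]
  simp only [hD, List.mem_singleton, exists_eq_left]
  constructor
  · rintro ⟨h, h'⟩
    have : ∃ i < m, a ∈ cycle cst i := by
      rcases h with h | ⟨b, ⟨i', hi', hb⟩, t, ht, rfl⟩
      · exact h
      · obtain ⟨j, hj, rfl⟩ := (mem_args_cycle hb).2 t ht
        exact ⟨i', hi', mem_cycle.2 ⟨j, hj, .inr rfl⟩⟩
    obtain ⟨i', hi', ha⟩ := this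
    -- An atom without arguments would pass the test for every tuple, so nonemptiness matters.
    obtain ⟨hne, hargs⟩ := mem_args_cycle ha
    obtain ⟨t, ht⟩ := List.exists_mem_of_ne_nil _ hne
    obtain ⟨j, -, rfl⟩ := hargs t ht
    obtain rfl := zeros_cst_inj.1 (h' _ ht)
    exact ha
  · intro h
    refine ⟨.inl ⟨i, hi, h⟩, fun t ht => ?_⟩
    obtain ⟨j, -, rfl⟩ := (mem_args_cycle h).2 t ht
    exact zeros_cst_inj.2 rfl

theorem broad_zeroSelector : Broad zeroSelector (cycleInstances cst) where
  unitOver := by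
    rintro K U ⟨m, hm, h⟩
    obtain ⟨rfl, rfl⟩ := Prod.mk.inj h
    refine ⟨⟨[cst 0 0], Finset.mem_image.2 ⟨0, Finset.mem_range.2 (by omega), rfl⟩⟩,
      ⟨1, one_pos, ?_⟩, ?_⟩
    · simp [cycleUnit]
    · intro τ hτ
      obtain ⟨i, hi, rfl⟩ := Finset.mem_image.1 hτ
      refine ⟨by simp, fun c hc => ?_⟩
      obtain rfl := List.mem_singleton.1 hc
      rw [ent_databaseSemantics]
      exact ⟨topAtom (cst i 0), Finset.mem_biUnion.2 ⟨i, hi, mem_cycle.2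
        ⟨0, prime_nth_pos i, .inr rfl⟩⟩, by simp [topAtom]⟩
  arity := by
    refine ⟨2, ?_⟩
    rintro K U ⟨m, hm, h⟩ a ha
    obtain ⟨rfl, rfl⟩ := Prod.mk.inj h
    rw [ent_databaseSemantics, Finset.mem_coe, or_self] at ha
    obtain ⟨i, -, ha⟩ := Finset.mem_biUnion.1 ha
    obtain ⟨j, -, rfl | rfl⟩ := mem_cycle.1 ha <;> simp [Atom.arity, topAtom]
  ent := entPolyTime_databaseSemantics _
  sel := selPolyTime_zeroSelector _

end Nexus

/-! ### The product of the cycles is one long cycle -/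

namespace Nexus

/-! ### The canonical characterization of a unit of cycles -/

/-- The constants of the cycles in the list that are reached after `t` steps. -/
noncomputable def walk (is : List ℕ) (t : ℕ) : List ℕ :=
  is.map fun i => cst i (t % Nat.nth Nat.Prime i)

/-- The edges of the walk, and the atoms for its vertices. -/
noncomputable def walkAtoms (is : List ℕ) (N : ℕ) : Finset (Atom Term) :=
  ((Finset.range N).image fun t => ⟨1, [.var (walk is t), .var (walk is (t + 1))]⟩) ∪
  ((Finset.range N).image fun t => topAtom (.var (walk is t)))

theorem mem_walkAtoms {is : List ℕ} {N : ℕ} {a : Atom Term} : a ∈ walkAtoms is N ↔ ∃ t < N,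
    a = ⟨1, [.var (walk is t), .var (walk is (t + 1))]⟩ ∨ a = topAtom (.var (walk is t)) := by
  simp only [walkAtoms, Finset.mem_union, Finset.mem_image, Finset.mem_range]
  constructor
  · rintro (⟨j, hj, rfl⟩ | ⟨j, hj, rfl⟩)
    exacts [⟨j, hj, .inl rfl⟩, ⟨j, hj, .inr rfl⟩]
  · rintro ⟨j, hj, rfl | rfl⟩
    exacts [.inl ⟨j, hj, rfl⟩, .inr ⟨j, hj, rfl⟩]

theorem coprime_nth {i j : ℕ} (h : i ≠ j) :
    Nat.Coprime (Nat.nth Nat.Prime i) (Nat.nth Nat.Prime j) :=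
  (Nat.coprime_primes (Nat.prime_nth_prime i) (Nat.prime_nth_prime j)).2
    fun e => h (Nat.nth_injective Nat.infinite_setOfPred_prime e)

section

variable {is : List ℕ} (his : is.Nodup)
include his

theorem pairwise_coprime : is.Pairwise (Function.onFun Nat.Coprime (Nat.nth Nat.Prime)) :=
  his.imp fun h => coprime_nth h

/-- The constants of a cycle are distinct, so equality of vertices means congruence modulo each
prime, hence modulo the product. -/
theorem walk_eq_iff {t t' : ℕ} :
    walk is t = walk is t' ↔ t ≡ t' [MOD (is.map (Nat.nth Nat.Prime)).prod] := by
  rw [Nat.modEq_list_map_prod_iff (pairwise_coprime his), walk, walk, List.map_inj_left]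
  exact forall₂_congr fun i hi => by simp [cst_inj, Nat.ModEq]

theorem walk_mod (t : ℕ) : walk is (t % (is.map (Nat.nth Nat.Prime)).prod) = walk is t :=
  (walk_eq_iff his).2 (Nat.mod_modEq _ _)

/-- Chinese remainder theorem: every choice of one vertex in each cycle is reached by the walk. -/
theorem exists_walk {r : List ℕ} (hr : r.length = is.length)
    (h : ∀ i (hi : i < is.length), ∃ j < Nat.nth Nat.Prime is[i], r.getD i 0 = cst is[i] j) :
    ∃ t < (is.map (Nat.nth Nat.Prime)).prod, r = walk is t := by
  choose! j hj hj' using h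
  -- The residues are indexed by the members of `is`, whereas `j` is indexed by positions; `idxOf`
  -- converts.
  obtain ⟨t, ht⟩ := Nat.chineseRemainderOfList (fun i => j (is.idxOf i)) (Nat.nth Nat.Prime) is
    (pairwise_coprime his)
  refine ⟨t % (is.map (Nat.nth Nat.Prime)).prod, Nat.mod_lt _ ?_, ?_⟩
  · refine Nat.pos_of_ne_zero fun h => ?_
    obtain ⟨i, -, hi⟩ := List.mem_map.1 (List.prod_eq_zero_iff.1 h)
    exact (prime_nth_pos i).ne' hi
  · rw [walk_mod his]
    refine List.ext_getElem (by simp [walk, hr]) fun i hi hi' => ?_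
    rw [hr] at hi
    have h₁ := hj' i hi
    rw [List.getD_eq_getElem _ _ (hr ▸ hi)] at h₁
    have h₂ := ht is[i] (List.getElem_mem hi)
    rw [his.idxOf_getElem i hi] at h₂
    have h₃ : t % Nat.nth Nat.Prime is[i] = j i :=
      Eq.trans h₂ (Nat.mod_eq_of_lt (hj i hi))
    simp [walk, h₁, h₃]

theorem card_walkAtoms : (walkAtoms is (is.map (Nat.nth Nat.Prime)).prod).card =
    2 * (is.map (Nat.nth Nat.Prime)).prod := by
  have hinj : ∀ t < (is.map (Nat.nth Nat.Prime)).prod, ∀ t' < (is.map (Nat.nth Nat.Prime)).prod,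
      walk is t = walk is t' → t = t' := fun t ht t' ht' h =>
    Nat.ModEq.eq_of_lt_of_lt ((walk_eq_iff his).1 h) ht ht'
  rw [walkAtoms, Finset.card_union_of_disjoint, Finset.card_image_of_injOn,
    Finset.card_image_of_injOn, Finset.card_range]
  · omega
  · intro t ht t' ht' h
    rw [Finset.mem_coe, Finset.mem_range] at ht ht'
    refine hinj t ht t' ht' ?_
    simpa [topAtom] using h
  · intro t ht t' ht' h
    rw [Finset.mem_coe, Finset.mem_range] at ht ht'
    simp only [Atom.mk.injEq, List.cons.injEq, Term.var.injEq] at h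
    exact hinj t ht t' ht' h.2.1
  · rw [Finset.disjoint_left]
    simp only [Finset.mem_image, not_exists, not_and]
    rintro _ ⟨j, -, rfl⟩ j' - h
    simp [topAtom] at h

/-- Different cycles have no constant in common. With at least two cycles there are therefore
neither constants nor clones in the characterization, and the count is exact. -/
theorem walk_not_const (hlen : 2 ≤ is.length) (t c : ℕ) : ¬ IsConstSeq c (walk is t) := by
  rintro ⟨-, h⟩
  rcases is with _ | ⟨i, _ | ⟨j, is⟩⟩
  · simp at hlen
  · simp at hlen
  · have h₁ := h (cst i (t % Nat.nth Nat.Prime i)) (by simp [walk])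
    have h₂ := h (cst j (t % Nat.nth Nat.Prime j)) (by simp [walk])
    have := (cst_inj.1 (h₁.trans h₂.symm)).1
    simp [this] at his

theorem okTerm_walk (hlen : 2 ≤ is.length) {Fr : List (List ℕ)} {t : Term} {k : ℕ}
    (h : okTerm (is.map fun i => [cst i 0]) Fr t = true ∧
      seqOf (is.map fun i => [cst i 0]) t = walk is k) : t = .var (walk is k) := by
  rcases t with c | s
  · refine absurd ⟨?_, ?_⟩ (walk_not_const his hlen k c)
    · rw [← h.2]
      simp only [seqOf, tcase, ne_eq, List.map_eq_nil_iff]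
      rintro rfl
      simp at hlen
    · rw [← h.2]
      simp [seqOf, tcase]
  · rw [← h.2]
    rfl

variable {sel : List ℕ → Finset (Atom ℕ)} (hsel : ∀ i ∈ is, sel [cst i 0] = cycle cst i)
include hsel

/-- All vertices of the product lie on the walk, and an atom over them projects to edges exactly
when its second vertex is the successor of the first in every coordinate. -/
theorem allAtoms_cycles (hlen : 2 ≤ is.length) : allAtoms sel (is.map fun i => [cst i 0]) =
    (walkAtoms is (is.map (Nat.nth Nat.Prime)).prod : Set (Atom Term)) := by
  have hne : (is.map fun i => [cst i 0]) ≠ [] := by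
    simp only [ne_eq, List.map_eq_nil_iff]
    rintro rfl
    simp at hlen
  have hok : ∀ k, okTerm (is.map fun i => [cst i 0]) (tupleProd (is.map fun i => [cst i 0]))
      (.var (walk is k)) = true := by
    intro k
    have : isConst (walk is k) = false := by
      rw [← Bool.not_eq_true, isConst_iff]
      exact fun ⟨c, hc⟩ => walk_not_const his hlen k c hc
    simp only [okTerm, tcase, this, Bool.not_false, Bool.or_true, Bool.and_true]
    simp [walk]
  ext β
  rw [mem_allAtoms_iff hne, Finset.mem_coe, mem_walkAtoms]
  simp only [List.length_map, List.getElem_map]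
  constructor
  · rintro ⟨hβ, h⟩
    have hget : ∀ i (hi : i < is.length), (⟨β.name, β.args.map fun t =>
        (seqOf (is.map fun i => [cst i 0]) t).getD i 0⟩ : Atom ℕ) ∈ cycle cst is[i] :=
      fun i hi => hsel is[i] (List.getElem_mem hi) ▸ h i hi
    have hwalk : ∀ t ∈ β.args, ∃ k < (is.map (Nat.nth Nat.Prime)).prod, t = .var (walk is k) := by
      intro t ht
      obtain ⟨k, hk, e⟩ := exists_walk his (r := seqOf (is.map fun i => [cst i 0]) t)
        (by simpa using okTerm_length (hβ t ht)) fun i hi =>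
          (mem_args_cycle (hget i hi)).2 _ (List.mem_map.2 ⟨t, ht, rfl⟩)
      exact ⟨k, hk, okTerm_walk his hlen ⟨hβ t ht, e⟩⟩
    obtain ⟨name, args⟩ := β
    have h₀ := mem_cycle.1 (hget 0 (by omega))
    obtain ⟨j₀, -, h₀ | h₀⟩ := h₀
    · obtain ⟨rfl, h₀⟩ := Atom.mk.inj h₀
      obtain ⟨t, t', rfl⟩ : ∃ t t', args = [t, t'] := by
        have := congrArg List.length h₀
        simpa [List.length_eq_two] using this
      obtain ⟨k, hk, rfl⟩ := hwalk t (by simp)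
      obtain ⟨k', hk', rfl⟩ := hwalk t' (by simp)
      refine ⟨k, hk, .inl ?_⟩
      congr 4
      rw [walk, walk, List.map_inj_left]
      intro i hi
      obtain ⟨n, hn, rfl⟩ := List.getElem_of_mem hi
      obtain ⟨j, hj, h | h⟩ := mem_cycle.1 (hget n hn)
      · have := (Atom.mk.inj h).2
        simp only [seqOf, tcase, walk, List.map_cons, List.map_nil, id_eq, List.cons.injEq,
          List.getD_eq_getElem?_getD, List.getElem?_map, hn, List.getElem?_eq_getElem,
          Option.map_some, Option.getD_some, cst_inj, true_and, and_true] at this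
        rw [this.2, ← this.1, Nat.mod_add_mod]
      · simp [topAtom] at h
    · obtain ⟨rfl, h₀⟩ := Atom.mk.inj h₀
      obtain ⟨t, rfl⟩ : ∃ t, args = [t] := by
        have := congrArg List.length h₀
        simpa [List.length_eq_one_iff] using this
      obtain ⟨k, hk, rfl⟩ := hwalk t (by simp)
      exact ⟨k, hk, .inr rfl⟩
  · rintro ⟨k, hk, rfl | rfl⟩
    · refine ⟨fun t ht => ?_, fun i hi => ?_⟩
      · rcases List.mem_pair.1 ht with rfl | rfl <;> exact hok _
      · rw [hsel _ (List.getElem_mem hi), mem_cycle]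
        refine ⟨k % Nat.nth Nat.Prime is[i], Nat.mod_lt _ (prime_nth_pos _), .inl ?_⟩
        simp [seqOf, tcase, walk, hi]
    · refine ⟨fun t ht => ?_, fun i hi => ?_⟩
      · obtain rfl := List.mem_singleton.1 ht
        exact hok _
      · rw [hsel _ (List.getElem_mem hi), mem_cycle]
        refine ⟨k % Nat.nth Nat.Prime is[i], Nat.mod_lt _ (prime_nth_pos _), .inr ?_⟩
        simp [seqOf, tcase, walk, hi, topAtom]

/-- Consecutive edges of the walk share a vertex, so all of them are linked back to the edge leaving
the free vertex `walk is 0`. -/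
theorem canAtoms_cycles (hlen : 2 ≤ is.length) : canAtoms sel (is.map fun i => [cst i 0]) =
    (walkAtoms is (is.map (Nat.nth Nat.Prime)).prod : Set (Atom Term)) := by
  have hall := allAtoms_cycles his hsel hlen
  refine Set.Subset.antisymm (fun β hβ => hall ▸ hβ.1) fun β hβ => ?_
  have hedge : ∀ t, (⟨1, [.var (walk is t), .var (walk is (t + 1))]⟩ : Atom Term) ∈
      allAtoms sel (is.map fun i => [cst i 0]) := by
    intro t
    rw [hall, Finset.mem_coe, mem_walkAtoms]
    refine ⟨t % (is.map (Nat.nth Nat.Prime)).prod, Nat.mod_lt _ ?_, .inl ?_⟩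
    · obtain ⟨k, hk, -⟩ := mem_walkAtoms.1 (Finset.mem_coe.1 hβ)
      omega
    · rw [walk_mod his]
      congr 4
      rw [walk_eq_iff his]
      exact (Nat.ModEq.add_right 1 (Nat.mod_modEq _ _)).symm
  have hfree : walk is 0 ∈ tupleProd (is.map fun i => [cst i 0]) := by
    rcases is with _ | ⟨i, is⟩
    · simp at hlen
    · simp [tupleProd, walk, Function.comp_def]
  have hlinked : ∀ t, Linked (allAtoms sel (is.map fun i => [cst i 0]))
      (tupleProd (is.map fun i => [cst i 0]))
      ⟨1, [.var (walk is t), .var (walk is (t + 1))]⟩ := by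
    intro t
    induction t with
    | zero => exact .base (hedge 0) (isFree_iff.2 ⟨_, hfree, by simp⟩)
    | succ t ih => exact .step (hedge _) (share_iff.2 ⟨.var (walk is (t + 1)), by simp, by simp⟩) ih
  rw [mem_canAtoms_iff]
  obtain ⟨t, ht, rfl | rfl⟩ := mem_walkAtoms.1 (Finset.mem_coe.1 hβ)
  · exact hlinked t
  · exact .step (hall ▸ hβ) (share_iff.2 ⟨.var (walk is t), by simp [topAtom], by simp⟩) (hlinked t)

end

theorem exists_indices {m : ℕ} {us : List (List ℕ)}
    (hus : Lists us (cycleUnit cst m : Set (List ℕ))) :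
    ∃ is : List ℕ, is.Nodup ∧ (∀ i, i ∈ is ↔ i < m) ∧ us = is.map fun i => [cst i 0] := by
  have hmem : ∀ τ, τ ∈ us ↔ ∃ i < m, [cst i 0] = τ := by
    intro τ
    rw [hus.2, Finset.mem_coe, cycleUnit, Finset.mem_image]
    simp
  have : us ∈ Set.range (List.map fun i => [cst i 0]) := by
    rw [Set.range_list_map]
    exact fun τ hτ => ((hmem τ).1 hτ).imp fun i h => h.2
  obtain ⟨is, rfl⟩ := this
  refine ⟨is, List.Nodup.of_map _ hus.1, fun i => ?_, rfl⟩
  have := hmem [cst i 0]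
  simpa [cst_inj] using this

theorem ncard_canAtoms_cycles {m : ℕ} (hm : 2 ≤ m) {us : List (List ℕ)}
    (hus : Lists us (cycleUnit cst m : Set (List ℕ))) :
    (canAtoms (zeroSelector.sel (cycleKB cst m hm)) us).ncard =
      2 * ∏ i ∈ Finset.range m, Nat.nth Nat.Prime i := by
  obtain ⟨is, his, hmem, rfl⟩ := exists_indices hus
  have hrange : Finset.range m = is.toFinset := by
    ext i
    rw [Finset.mem_range, List.mem_toFinset, hmem]
  have hlen : is.length = m := by
    rw [← List.toFinset_card_of_nodup his, ← hrange, Finset.card_range]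
  rw [canAtoms_cycles his (fun i hi => zeroSelector_cycleKB hm ((hmem i).1 hi)) (hlen ▸ hm),
    Set.ncard_coe_finset, card_walkAtoms his, hrange, List.prod_toFinset _ his]

theorem two_pow_le_prod (m : ℕ) : 2 ^ m ≤ ∏ i ∈ Finset.range m, Nat.nth Nat.Prime i := by
  calc 2 ^ m = ∏ _i ∈ Finset.range m, 2 := by simp
    _ ≤ _ := Finset.prod_le_prod' fun i _ => (Nat.prime_nth_prime i).two_le

end Nexus

/-! ### Output length against input length -/

namespace Nexus

/-! ### The lower bound -/

/-- A query erases one stack and leaves the others alone, so an oracle does not help to write more.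
-/
theorem OracleTM.length_oracleStep_le {M : OracleTM} {A : Set (List Bool)} {C : ℕ}
    (hC : ∀ l, pushes (M.m l) ≤ C) {c c' : M.toFinTM2.Cfg} (h : M.oracleStep A c = some c')
    (k : M.K) : (c'.stk k).length ≤ (c.stk k).length + C := by
  classical
  rw [OracleTM.oracleStep] at h
  by_cases hq : c.l = some M.query
  · rw [if_pos hq] at h
    obtain rfl := Option.some.inj h
    by_cases hk : k = M.kq
    · subst hk
      simp
    · simp [hk]
  · rw [if_neg hq] at h
    exact length_step_le hC h k

theorem OracleTM.length_iterate_le {M : OracleTM} {A : Set (List Bool)} {C : ℕ}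
    (hC : ∀ l, pushes (M.m l) ≤ C) (k : M.K) (t : ℕ) {c c' : M.toFinTM2.Cfg}
    (h : (flip bind (M.oracleStep A))^[t] (some c) = some c') :
    (c'.stk k).length ≤ (c.stk k).length + C * t := by
  induction t generalizing c' with
  | zero =>
    obtain rfl := Option.some.inj h
    simp
  | succ t ih =>
    rw [Function.iterate_succ_apply'] at h
    cases hc : (flip bind (M.oracleStep A))^[t] (some c) with
    | none =>
      rw [hc] at h
      exact absurd (show none = some c' from h) (by simp)
    | some c'' =>
      rw [hc] at h
      have h₁ := ih hc
      have h₂ := OracleTM.length_oracleStep_le hC (c := c'') h k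
      rw [Nat.mul_succ]
      omega

/-- This holds for every oracle, which is why the lower bound does not depend on the complexity of
`A`. -/
theorem FPOracle.polyBd {A : Set (List Bool)} {f : List Bool → List Bool} (h : FPOracle A f) :
    PolyBd (fun x : List Bool => x.length) fun x => (f x).length := by
  obtain ⟨M, e₀, e₁, p, h⟩ := h
  have := M.ΛFin
  obtain ⟨C, hC⟩ := exists_pushes_le M.m
  refine ((PolyBd.self _).add ((PolyBd.const _ C).mul ((PolyBd.self _).eval p))).of_le fun x => ?_
  obtain ⟨⟨⟨t, ht⟩, htp⟩⟩ := h x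
  have := OracleTM.length_iterate_le hC M.k₁ t ht
  rw [haltList_stk, initList_stk, Function.update_self, List.length_map] at this
  refine this.trans (Nat.add_le_add ?_ (Nat.mul_le_mul_left _ htp))
  by_cases h : M.k₁ = M.k₀
  · rw [h, Function.update_self, List.length_map]
  · rw [Function.update_of_ne h]
    simp

/-- Bertrand's postulate, iterated. The crude bound is enough, since an input of length `2 ^ O(m)`
is still short compared with `m!`. -/
theorem nth_prime_le (i : ℕ) : Nat.nth Nat.Prime i ≤ 2 ^ (i + 1) := by
  induction i with
  | zero => simp [Nat.nth_prime_zero_eq_two]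
  | succ i ih =>
    obtain ⟨q, hq, hlt, hle⟩ :=
      Nat.exists_prime_lt_and_le_two_mul (Nat.nth Nat.Prime i) (prime_nth_pos i).ne'
    refine le_trans (le_of_not_gt fun h => ?_) (hle.trans ?_)
    · exact absurd (Nat.le_nth_of_lt_nth_succ h hq) (by omega)
    · rw [pow_succ]
      omega

theorem factorial_le_prod (m : ℕ) : m.factorial ≤ ∏ i ∈ Finset.range m, Nat.nth Nat.Prime i := by
  rw [← Finset.prod_range_add_one_eq_factorial]
  exact Finset.prod_le_prod' fun i _ => (Nat.le_succ _).trans (Nat.add_two_le_nth_prime i)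

theorem length_encNat_cst {m i j : ℕ} (hi : i < m) (hj : j < Nat.nth Nat.Prime i) :
    (encNat (cst i j)).length ≤ 4 * m + 1 := by
  have hlen : ∀ l : List Bool, (encStr l).length = 2 * l.length + 1 := by
    intro l
    induction l with
    | nil => rfl
    | cons b l ih =>
      simp only [encStr, encList, List.flatMap_cons, List.length_append, List.length_cons,
        List.length_nil] at *
      omega
  have hj' : j < 2 ^ (i + 1) := hj.trans_le (nth_prime_le i)
  have hbits : j.bits.length ≤ i + 1 := by
    rw [Nat.size_eq_bits_len]
    exact Nat.size_le.2 hj'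
  rw [encNat, hlen, bits_cst, List.length_append, List.length_replicate, List.length_cons]
  omega

theorem length_encAtoms_cycles {m : ℕ} {l : List (Atom ℕ)} (hl : l.Nodup)
    (h : ∀ a, a ∈ l ↔ a ∈ (Finset.range m).biUnion (cycle cst)) :
    (encAtoms encNat l).length ≤ m * (2 * 2 ^ m) * (8 * m + 9) + 1 := by
  have hcard : l.length ≤ m * (2 * 2 ^ m) := by
    have : l.toFinset = (Finset.range m).biUnion (cycle cst) := by
      ext a
      rw [List.mem_toFinset, h]
    rw [← List.toFinset_card_of_nodup hl, this]
    refine (Finset.card_biUnion_le_card_mul _ _ _ fun i hi => ?_).trans_eq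
      (by rw [Finset.card_range])
    rw [card_cycle]
    exact Nat.mul_le_mul_left _ ((nth_prime_le i).trans
      (Nat.pow_le_pow_right (by norm_num) (Finset.mem_range.1 hi)))
  refine (length_encList_le (k := 8 * m + 8) fun a ha => ?_).trans
    (Nat.add_le_add_right (Nat.mul_le_mul_right _ hcard) _)
  obtain ⟨i, hi, ha⟩ := Finset.mem_biUnion.1 ((h a).1 ha)
  have hargs : ∀ t ∈ a.args, (encNat t).length ≤ 4 * m + 1 := by
    intro t ht
    obtain ⟨j, hj, rfl⟩ := (mem_args_cycle ha).2 t ht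
    exact length_encNat_cst (Finset.mem_range.1 hi) hj
  have h₁ := length_encList_le hargs
  have h₂ : a.args.length ≤ 2 ∧ (encNat a.name).length ≤ 3 := by
    obtain ⟨j, hj, rfl | rfl⟩ := mem_cycle.1 ha
    · exact ⟨by simp, by simp [encNat, encStr, encList]⟩
    · exact ⟨by simp [topAtom], by simp [topAtom, encNat, encStr, encList]⟩
  have h₃ : a.args.length * (4 * m + 1 + 1) ≤ 2 * (4 * m + 1 + 1) := Nat.mul_le_mul_right _ h₂.1
  rw [List.length_append]
  omega

theorem length_encList_cycleUnit {m : ℕ} {us : List (List ℕ)}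
    (hus : Lists us (cycleUnit cst m : Set (List ℕ))) :
    (encList encTuple us).length ≤ m * (4 * m + 4) + 1 := by
  obtain ⟨is, his, hmem, rfl⟩ := exists_indices hus
  have hlen : is.length = m := by
    have : Finset.range m = is.toFinset := by
      ext i
      rw [Finset.mem_range, List.mem_toFinset, hmem]
    rw [← List.toFinset_card_of_nodup his, ← this, Finset.card_range]
  refine (length_encList_le (k := 4 * m + 3) fun τ hτ => ?_).trans_eq
    (by rw [List.length_map, hlen])
  obtain ⟨i, hi, rfl⟩ := List.mem_map.1 hτ
  refine (length_encList_le (k := 4 * m + 1) fun c hc => ?_).trans (by simp)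
  obtain rfl := List.mem_singleton.1 hc
  exact length_encNat_cst ((hmem i).1 hi) (prime_nth_pos i)

theorem not_exists_fpph : ¬ ∃ f, FPPH f ∧ SolvesCAN zeroSelector (cycleInstances cst) f := by
  rintro ⟨f, ⟨A, -, hA⟩, hf⟩
  obtain ⟨d, hd⟩ := hA.polyBd
  -- With `d` the exponent of the output bound, `m` is chosen such that `(2 ^ (9 * d)) ^ m < m!`.
  obtain ⟨m, hm₂, hm⟩ := ((Filter.eventually_ge_atTop 2).and
    (Nat.eventually_pow_lt_factorial_sub (2 ^ (9 * d)) 0)).exists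
  obtain ⟨body, hbody, hfx⟩ := hf (cycleKB cst m hm₂) (cycleUnit cst m) ⟨m, hm₂, rfl⟩
    (cycleKB cst m hm₂).D.toList (cycleUnit cst m).toList
    ⟨Finset.nodup_toList _, fun a => Finset.mem_toList⟩
    ⟨Finset.nodup_toList _, fun a => Finset.mem_toList⟩
  have hunit : Lists (cycleUnit cst m).toList (cycleUnit cst m : Set (List ℕ)) :=
    ⟨Finset.nodup_toList _, fun a => Finset.mem_toList⟩
  set x := encKB (cycleKB cst m hm₂).D.toList (cycleKB cst m hm₂).O ++
    encList encTuple (cycleUnit cst m).toList with hx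
  have hmpow : m < 2 ^ m := Nat.lt_two_pow_self
  -- With `P = 2 ^ m ≥ 4` the length is at most a cubic polynomial in `P`; the exponent 9 leaves a
  -- factor `P ^ 6 ≥ 4 ^ 6` to absorb its coefficients.
  have hxlen : x.length + 2 ≤ 2 ^ (9 * m) := by
    have h₁ := length_encAtoms_cycles (m := m) (Finset.nodup_toList (cycleKB cst m hm₂).D)
      fun a => Finset.mem_toList
    have h₂ := length_encList_cycleUnit hunit
    have h₃ : (encStr (cycleKB cst m hm₂).O).length = 1 := rfl
    rw [hx, encKB, List.length_append, List.length_append, h₃]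
    have hP : 4 ≤ 2 ^ m := (Nat.pow_le_pow_right (by norm_num) hm₂ : 2 ^ 2 ≤ 2 ^ m)
    rw [show 9 * m = m * 9 by ring, pow_mul]
    generalize 2 ^ m = P at *
    have hP9 : 4 ^ 6 * P ^ 3 ≤ P ^ 9 := by
      rw [show 9 = 6 + 3 from rfl, pow_add]
      exact Nat.mul_le_mul_right _ (Nat.pow_le_pow_left hP 6)
    have h₄ : m * (2 * P) * (8 * m + 9) ≤ P * (2 * P) * (8 * P + 9) := by gcongr
    have h₅ : m * (4 * m + 4) ≤ P * (4 * P + 4) := by gcongr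
    nlinarith [Nat.pow_le_pow_left hP 2, Nat.pow_le_pow_left hP 3, Nat.zero_le (P ^ 3)]
  -- The code of a list has at least one bit per element, and each atom appears in the output.
  have hcount : 2 * ∏ i ∈ Finset.range m, Nat.nth Nat.Prime i ≤ (f x).length := by
    rw [← ncard_canAtoms_cycles hm₂ hunit, hfx, encFormula, List.length_append]
    refine le_trans ?_ ((card_le_length_encList _ body).trans (Nat.le_add_left _ _))
    have : canAtoms (zeroSelector.sel (cycleKB cst m hm₂)) (cycleUnit cst m).toList =
        (body.toFinset : Set (Atom Term)) := by
      ext a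
      rw [Finset.mem_coe, List.mem_toFinset, hbody.2]
    rw [this, Set.ncard_coe_finset]
    exact List.toFinset_card_le _
  have h₁ := (hd x).trans (Nat.pow_le_pow_left hxlen d)
  have h₂ := factorial_le_prod m
  rw [← pow_mul, show 9 * m * d = 9 * d * m by ring, pow_mul] at h₁
  rw [Nat.sub_zero] at hm
  dsimp only at h₁
  omega

end Nexus

theorem mainTheorem6 :
    -- upper bounds: broad, medium and handy case
    (∀ (models : Semantics) (ς : Selector models) (I : Set (KB × Finset (List ℕ))),
      (Broad ς I → ∃ f, FPSPACE f ∧ SolvesCAN ς I f) ∧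
      (Medium ς I → ∃ f, FP f ∧ SolvesCAN ς I f) ∧
      (Handy ς I → ∃ f, FP f ∧ SolvesCAN ς I f)) ∧
    -- the bound on the size of the canonical characterization
    (∀ (models : Semantics) (ς : Selector models) (K : KB) (U : Finset (List ℕ)) (ω : ℕ),
      UnitOver models K U → ArityLE models K ω → ∀ us : List (List ℕ), Lists us U →
        (canAtoms (ς.sel K) us).Finite ∧
        (canAtoms (ς.sel K) us).ncard ≤ 2 ^ ω * ∏ τ ∈ U, (ς.sel K τ).card) ∧
    -- the family of cycles of prime lengths, and the lower bound in the broad case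
    (∃ (c : ℕ → ℕ → ℕ) (ς : Selector databaseSemantics), Function.Injective2 c ∧
      (∀ (m : ℕ) (hm : 2 ≤ m),
        (∀ i < m, ς.sel (cycleKB c m hm) [c i 0] = cycle c i ∧ 2 < (cycle c i).card) ∧
        ∀ us : List (List ℕ), Lists us (cycleUnit c m) →
          2 ^ (m - 1) * (canAtoms (ς.sel (cycleKB c m hm)) us).ncard =
            ∏ i ∈ Finset.range m, (cycle c i).card ∧
          2 ^ m ≤ (canAtoms (ς.sel (cycleKB c m hm)) us).ncard) ∧
      Broad ς (cycleInstances c) ∧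
      ¬ ∃ f, FPPH f ∧ SolvesCAN ς (cycleInstances c) f) := by
  refine ⟨fun models ς I => ⟨fun h => h.exists_fpspace, fun h => h.exists_fp,
    fun h => h.toMedium.exists_fp⟩, fun models ς K U ω hU hω us hus => canAtoms_bound ς hU hω hus,
    cst, zeroSelector, fun i j i' j' h => cst_inj.1 h, fun m hm => ⟨fun i hi =>
      ⟨zeroSelector_cycleKB hm hi, ?_⟩, fun us hus => ?_⟩, broad_zeroSelector, not_exists_fpph⟩
  · have := (Nat.prime_nth_prime i).two_le
    rw [card_cycle]
    omega
  · rw [ncard_canAtoms_cycles hm hus]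
    refine ⟨?_, (two_pow_le_prod m).trans (by omega)⟩
    -- Each cycle has `2 * p` atoms, so the product of the cardinalities is `2 ^ m * ∏ p = 2 ^ (m -
    -- 1) * (2 * ∏ p)`.
    simp only [card_cycle]
    rw [Finset.prod_mul_distrib, Finset.prod_const, Finset.card_range, ← mul_assoc, ← pow_succ,
      Nat.sub_add_cancel (by omega)]
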